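/- Consider the two-dimensional two-component Yukawa gas: particles $\xi=(x,\sigma)$ with position $x\in\mathbb R^2$ and charge $\sigma\in\{-1,1\}$, with single-particle measure $d\rho(\xi)=d^2x\,d\nu(\sigma)$, $\nu$ uniform on $\{-1,1\}$, and activity $z$. Let $\kappa:(-\infty,0]\to\mathbb R$ be monotone decreasing with $\kappa(0)=1$ and $\kappa(t)\to\infty$ as $t\to-\infty$, and put $$v(t,x)=\beta(-\Delta+\kappa(t))^{-1}(x)=\frac{\beta}{2\pi}K_0\bigl(\sqrt{\kappa(t)}\,|x|\bigr).$$ The gas with ultraviolet cutoff $t_0<0$ has energy $$\beta U_n(\xi_1,\dots,\xi_n)=\sum_{i<j}\sigma_i\sigma_j\bigl(v(0,x_i-x_j)-v(t_0,x_i-x_j)\bigr).$$ For a compact $X\subset\mathbb R^2$ of positive area and $\Lambda=X\times\{-1,1\}$ let $$\Xi_\Lambda(z)=\sum_{n\ge0}\frac{z^n}{n!}\int_{\Lambda^n}d^n\rho\;e^{-\beta U_n},\qquad \beta p_\Lambda=\frac1{|X|}\ln\Xi_\Lambda=\sum_{n\ge1}b_{\Lambda,n}z^n,\qquad \rho_\Lambda=z\,\frac{\partial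 p_\Lambda}{\partial z},$$ the last two understood as (Mayer) power series in $z$, so that $\frac{\beta}{z}\rho_\Lambda=\sum_{n\ge1}n\,b_{\Lambda,n}z^{n-1}$. Let $0<\beta<16\pi/3$ (in particular, any $4\pi\le\beta<16\pi/3$) and $$R=\frac{16\pi-3\beta}{16\pi\beta e}.$$ Then for every $t_0<0$ and $n\ge1$ the limit $b_n(t_0)=\lim_{\Lambda\nearrow\mathbb R^2}b_{\Lambda,n}$ (in the sense of van Hove) exists, and the Mayer series of the density with its $O(z)$ term $2b_2z$ removed, $$\sum_{n\ge1,\;n\ne2}n\,b_n(t_0)\,z^{n-1},$$ converges absolutely for all complex $z$ with $|z|<R$ and all $t_0<0$, and converges uniformly in the cutoff $t_0$: for each $r<R$ its partial sums converge uniformly on $\{(t_0,z):t_0<0,\ |z|\le r\}$. -/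

import Mathlib

open MeasureTheory Filter Topology PowerSeries

noncomputable section

namespace YukawaGas

/-- The plane `ℝ²` with its Euclidean norm. -/
abbrev Plane : Type := EuclideanSpace ℝ (Fin 2)

/-- The modified Bessel function of the second kind of order zero,
`K₀(w) = ∫₀^∞ exp (-w cosh u) du`, for `w > 0`. -/
def besselK0 (w : ℝ) : ℝ :=
  ∫ u in Set.Ioi (0 : ℝ), Real.exp (-w * Real.cosh u)

/-- The covariance `β (-Δ + m)⁻¹(x) = (β / 2π) K₀(√m |x|)` on the plane, for `m > 0`.
The value at the single point `x = 0`, where the kernel has a logarithmic singularity, plays no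
role: below it only enters integrals over particle positions, where coincident positions form a
null set. -/
def covariance (β m : ℝ) (x : Plane) : ℝ :=
  β / (2 * Real.pi) * besselK0 (Real.sqrt m * ‖x‖)

/-- A scale function: monotone decreasing on `(-∞, 0]`, with `κ 0 = 1` and `κ(-∞) = ∞`. -/
structure IsScaleFunction (κ : ℝ → ℝ) : Prop where
  antitoneOn : AntitoneOn κ (Set.Iic 0)
  map_zero : κ 0 = 1
  tendsto_atBot : Tendsto κ atBot atTop

/-- The Yukawa potential (multiplied by `β`) with ultraviolet cutoff `t₀ ≤ 0`:
`v(0, x) - v(t₀, x)`, where `v(t, x) = β (-Δ + κ(t))⁻¹(x)`. As `t₀ → -∞` it tends to the full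
Yukawa potential `v(0, x) = β (-Δ + 1)⁻¹(x)`. -/
def cutoffPotential (β : ℝ) (κ : ℝ → ℝ) (t₀ : ℝ) (x : Plane) : ℝ :=
  covariance β (κ 0) x - covariance β (κ t₀) x

/-- The energy `β Uₙ(ξ) = ∑_{i < j} σᵢ σⱼ v(xᵢ - xⱼ)` of `n` particles with charges
`σᵢ ∈ {-1, 1}` and positions `xᵢ`. -/
def energy (v : Plane → ℝ) {n : ℕ} (σ : Fin n → ℤˣ) (x : Fin n → Plane) : ℝ :=
  ∑ i, ∑ j ∈ Finset.Ioi i, ((σ i : ℤ) : ℝ) * ((σ j : ℤ) : ℝ) * v (x i - x j)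

/-- The grand canonical partition function in the region `X`, as a power series in the activity:
its `n`-th coefficient is `(1 / n!) ∫ dⁿρ exp (-β Uₙ)` over `(X × {-1, 1})ⁿ`, where `ρ` is the
product of Lebesgue measure and the uniform probability measure on the charges `{-1, 1}`. -/
def partitionSeries (v : Plane → ℝ) (X : Set Plane) : ℝ⟦X⟧ :=
  PowerSeries.mk fun n =>
    (1 / (n.factorial : ℝ)) *
      ∫ x in {x : Fin n → Plane | ∀ i, x i ∈ X},
        (1 / 2 ^ n : ℝ) * ∑ σ : Fin n → ℤˣ, Real.exp (-energy v σ x)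

/-- The Mayer series of the pressure: the power series in the activity of
`β p_Λ = (1 / |Λ|) ln Ξ_Λ`. -/
def pressureSeries (v : Plane → ℝ) (X : Set Plane) : ℝ⟦X⟧ :=
  (volume.real X)⁻¹ • PowerSeries.logOf (partitionSeries v X)

/-- The Mayer series of `(β / z) ρ_Λ = β ∂p_Λ/∂z`, where `ρ_Λ = z ∂p_Λ/∂z` is the density. Its
coefficient of `z ^ m` is `(m + 1) b_{Λ, m + 1}`. -/
def densitySeries (v : Plane → ℝ) (X : Set Plane) : ℝ⟦X⟧ :=
  PowerSeries.derivative ℝ (pressureSeries v X)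

/-- The sequence of compact regions `X j` tends to the plane in the sense of van Hove. -/
structure IsVanHove (X : ℕ → Set Plane) : Prop where
  isCompact : ∀ j, IsCompact (X j)
  volume_pos : ∀ j, 0 < volume.real (X j)
  boundary : ∀ r : ℝ, 0 < r →
    Tendsto (fun j => volume.real (Metric.thickening r (frontier (X j))) / volume.real (X j))
      atTop (𝓝 0)

/-- The `m`-th term `c m * z ^ m` of a power series from which the linear term has been
removed. -/
def termWithoutLinear (c : ℕ → ℝ) (z : ℂ) (m : ℕ) : ℂ :=
  if m = 1 then 0 else (c m : ℂ) * z ^ m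

end YukawaGas

end

/-! The potential with cutoff is `β` times the integral over masses `μ` from `1` to `κ t₀` of the
kernel of `(-Δ + μ)⁻²` (`flowPotential`, `flowPotential_eq_covariance_sub`). Lowering the mass from
`M = κ t₀` to `1` switches the interaction on continuously, and the Ursell functions, whose
integrals are the Mayer coefficients, obey a flow equation in the mass (`hasDerivAt_ursell`): a term
linear in the Ursell function, and a sum over splittings of the cluster into two interacting
subclusters. An integrating factor removes the linear term. Since the kernel is positive definite,
this costs at most `(μ/m) ^ (nβ/8π)` for `n` particles (`exp_pairEnergy_sub_le`,
`enorm_gasUrsell_le`).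

The kernel has `L¹` norm `μ⁻²`, and induction on the cluster bounds the integrated Ursell function
by `n^(n-2) (λ/m)^(n-1)` with `λ = β / (1 - 3β/16π)` (`marginal_gasUrsell_le`). The power of `n`
counts labelled trees: deleting an edge of a tree leaves two rooted trees (`sum_powerset_tree`). The
mass integral converges uniformly in `M` when `nβ/8π < n - 1`. Among `n ≥ 3` the case `n = 3` is the
worst and gives `β < 16π/3`. For `n = 2` the condition would be `β < 4π`, which is why the linear
term is removed.

Pairs still occur as subclusters. There a neutral pair acts only as a dipole: writing the kernel as
an overlap of heat kernels (`crossEnergy_greenSq`), its smeared charge has `L¹` norm at most `|x -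
y| / √t`, and this factor makes the pair integral converge for `β < 6π`
(`lintegral_neutral_pair_le`). A pair of equal charges is harmless because it repels.

The coefficients of `ln Ξ` are identified with integrals of Ursell functions by the moment-cumulant
recursion (`derivative_logOf_moment`), and their van Hove limits follow from translation invariance
and dominated convergence (`tendsto_average_integral`). Finally `n^n / n! ≤ e^n` gives a geometric
bound of ratio `eλ|z|`, independent of `t₀`, and `R = 1/(eλ)`. -/

noncomputable section

namespace YukawaGas

/-! ### Energies of clusters under a pair interaction. -/

section PairEnergy

variable {ι : Type*}

/-- The interaction `∑ u y z` of the clusters `Y` and `Z`. -/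
def crossEnergy (u : ι → ι → ℝ) (Y Z : Finset ι) : ℝ := ∑ y ∈ Y, ∑ z ∈ Z, u y z

/-- The energy of the cluster `I`, without self-interactions, for a symmetric pair interaction
`u`. -/
def pairEnergy (u : ι → ι → ℝ) (I : Finset ι) : ℝ := (crossEnergy u I I - ∑ i ∈ I, u i i) / 2

theorem pairEnergy_empty (u : ι → ι → ℝ) : pairEnergy u ∅ = 0 := by
  simp [pairEnergy, crossEnergy]

theorem pairEnergy_singleton (u : ι → ι → ℝ) (i : ι) : pairEnergy u {i} = 0 := by
  simp [pairEnergy, crossEnergy]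

theorem crossEnergy_empty_right (u : ι → ι → ℝ) (Y : Finset ι) : crossEnergy u Y ∅ = 0 := by
  simp [crossEnergy]

end PairEnergy

/-! ### Ursell functions: recursion and flow equation. -/

section Ursell

variable {ι : Type*} [DecidableEq ι]

/-- The connected part (Ursell function) of a function `E` on finite sets, defined by
`E I = ∑ ursell E J * E (I \ J)`, where `J` runs over the subsets of `I` that contain a chosen
element of `I`. -/
def ursell (E : Finset ι → ℝ) (I : Finset ι) : ℝ :=
  if h : I.Nonempty then
    E I - ∑ J ∈ (I.powerset.filter fun J => h.choose ∈ J ∧ J ≠ I).attach,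
      ursell E J.1 * E (I \ J.1)
  else 0
termination_by I.card
decreasing_by
  have h1 := J.2
  rw [Finset.mem_filter, Finset.mem_powerset] at h1
  exact Finset.card_lt_card (h1.1.ssubset_of_ne h1.2.2)

theorem ursell_empty (E : Finset ι → ℝ) : ursell E ∅ = 0 := by
  rw [ursell, dif_neg Finset.not_nonempty_empty]

theorem sum_powerset_mem_eq_add {M : Type*} [AddCommMonoid M] {I : Finset ι} {i : ι} (hi : i ∈ I)
    (f : Finset ι → M) :
    ∑ J ∈ I.powerset with i ∈ J, f J = f I + ∑ J ∈ I.powerset with i ∈ J ∧ J ≠ I, f J := by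
  rw [← Finset.add_sum_erase _ f (a := I) (by simp [hi])]
  congr 1
  refine Finset.sum_congr ?_ fun _ _ => rfl
  ext J
  simp only [Finset.mem_erase, Finset.mem_filter]
  tauto

/-- The defining recursion of the Ursell function does not depend on the choice of the root. -/
theorem sum_ursell_mul {E : Finset ι → ℝ} (hE : E ∅ = 1) (I : Finset ι) {i : ι} (hi : i ∈ I) :
    ∑ J ∈ I.powerset with i ∈ J, ursell E J * E (I \ J) = E I := by
  induction I using Finset.strongInduction generalizing i with
  | H I ih =>
  have hI : I.Nonempty := ⟨i, hi⟩
  have h0 : ∑ J ∈ I.powerset with hI.choose ∈ J, ursell E J * E (I \ J) = E I := by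
    rw [sum_powerset_mem_eq_add hI.choose_spec, Finset.sdiff_self, hE, mul_one]
    conv_lhs => rw [ursell]
    rw [dif_pos hI, Finset.sum_attach _ (fun J => ursell E J * E (I \ J)), sub_add_cancel]
  -- If the block of `a` misses `b`, its complement is expanded again around `b`. Both resulting
  -- sums, over one block holding both points and over two disjoint blocks, are symmetric in `a` and
  -- `b`, so the choice of root is immaterial.
  have key : ∀ a b : ι, a ∈ I → b ∈ I →
      ∑ J ∈ I.powerset with a ∈ J, ursell E J * E (I \ J) =
        ∑ J ∈ I.powerset with a ∈ J ∧ b ∈ J, ursell E J * E (I \ J) +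
          ∑ J ∈ I.powerset with a ∈ J ∧ b ∉ J,
            ∑ K ∈ (I \ J).powerset with b ∈ K, ursell E J * ursell E K * E ((I \ J) \ K) := by
    intro a b ha hb
    rw [← Finset.sum_filter_add_sum_filter_not (I.powerset.filter fun J => a ∈ J)
      (fun J => b ∈ J), Finset.filter_filter, Finset.filter_filter]
    congr 1
    refine Finset.sum_congr rfl fun J hJ => ?_
    simp only [Finset.mem_filter, Finset.mem_powerset] at hJ
    have hb' : b ∈ I \ J := Finset.mem_sdiff.2 ⟨hb, hJ.2.2⟩
    rw [← ih (I \ J) (Finset.sdiff_ssubset hJ.1 ⟨a, hJ.2.1⟩) hb', Finset.mul_sum]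
    simp only [mul_assoc]
  rw [← h0, key i hI.choose hi hI.choose_spec, key hI.choose i hI.choose_spec hi]
  congr 1
  · simp only [and_comm]
  · rw [Finset.sum_comm' (s' := fun K => (I \ K).powerset.filter fun J => i ∈ J)
      (t' := I.powerset.filter fun K => hI.choose ∈ K ∧ i ∉ K)]
    · refine Finset.sum_congr rfl fun J _ => Finset.sum_congr rfl fun K _ => ?_
      rw [sdiff_right_comm, mul_comm (ursell E K)]
    · intro J K
      simp only [Finset.mem_filter, Finset.mem_powerset, Finset.subset_sdiff]
      constructor
      · rintro ⟨⟨h1, h2, h3⟩, ⟨h4, h5⟩, h6⟩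
        exact ⟨⟨⟨h1, h5.symm⟩, h2⟩, h4, h6, Finset.disjoint_left.1 h5.symm h2⟩
      · rintro ⟨⟨⟨h1, h5⟩, h2⟩, h4, h6, h7⟩
        exact ⟨⟨h1, h2, Finset.disjoint_right.1 h5 h6⟩, ⟨h4, h5.symm⟩, h6⟩

theorem ursell_eq_sub {E : Finset ι → ℝ} (hE : E ∅ = 1) {I : Finset ι} {i : ι} (hi : i ∈ I) :
    ursell E I = E I - ∑ J ∈ I.powerset with i ∈ J ∧ J ≠ I, ursell E J * E (I \ J) := by
  have h := sum_ursell_mul hE I hi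
  rw [sum_powerset_mem_eq_add hi, Finset.sdiff_self, hE, mul_one] at h
  linarith

theorem ursell_singleton {E : Finset ι → ℝ} (hE : E ∅ = 1) (i : ι) : ursell E {i} = E {i} := by
  rw [ursell_eq_sub hE (Finset.mem_singleton_self i), Finset.sum_eq_zero, sub_zero]
  intro J hJ
  simp only [Finset.mem_filter, Finset.mem_powerset, Finset.subset_singleton_iff] at hJ
  rcases hJ.1 with rfl | rfl <;> simp at hJ

theorem ursell_pair {E : Finset ι → ℝ} (hE : E ∅ = 1) {i j : ι} (hij : i ≠ j) :
    ursell E {i, j} = E {i, j} - E {i} * E {j} := by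
  rw [ursell_eq_sub hE (Finset.mem_insert_self i _), Finset.sum_eq_single {i}]
  · rw [ursell_singleton hE]
    congr 3
    ext k
    simp only [Finset.mem_sdiff, Finset.mem_insert, Finset.mem_singleton]
    constructor
    · rintro ⟨h | h, h'⟩ <;> tauto
    · rintro rfl
      exact ⟨Or.inr rfl, hij.symm⟩
  · intro J hJ hJ'
    simp only [Finset.mem_filter, Finset.mem_powerset] at hJ
    exfalso
    by_cases hj : j ∈ J
    · refine hJ.2.2 (hJ.1.antisymm fun k hk => ?_)
      simp only [Finset.mem_insert, Finset.mem_singleton] at hk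
      rcases hk with rfl | rfl
      exacts [hJ.2.1, hj]
    · refine hJ' (Finset.eq_singleton_iff_unique_mem.2 ⟨hJ.2.1, fun k hk => ?_⟩)
      have := hJ.1 hk
      simp only [Finset.mem_insert, Finset.mem_singleton] at this
      rcases this with rfl | rfl
      exacts [rfl, absurd hk hj]
  · intro h
    exfalso
    apply h
    simp only [Finset.mem_filter, Finset.mem_powerset, Finset.mem_singleton, true_and,
      Finset.singleton_subset_iff, Finset.mem_insert, true_or]
    intro h
    have : j ∈ ({i} : Finset ι) := h ▸ by simp
    exact hij (Finset.mem_singleton.1 this).symm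

theorem ursell_congr {E E' : Finset ι → ℝ} {I : Finset ι} (h : ∀ J ⊆ I, E J = E' J) :
    ursell E I = ursell E' I := by
  induction I using Finset.strongInduction with
  | H I ih =>
  rw [ursell, ursell]
  split_ifs with hI
  · rw [h I subset_rfl]
    congr 1
    refine Finset.sum_congr rfl fun J _ => ?_
    have hJ := J.2
    simp only [Finset.mem_filter, Finset.mem_powerset] at hJ
    rw [ih J.1 (hJ.1.ssubset_of_ne hJ.2.2) fun K hK => h K (hK.trans hJ.1),
      h _ Finset.sdiff_subset]
  · rfl

theorem measurable_ursell {α : Type*} [MeasurableSpace α] {E : α → Finset ι → ℝ}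
    (hE : ∀ J, Measurable fun a => E a J) (I : Finset ι) :
    Measurable fun a => ursell (E a) I := by
  induction I using Finset.strongInduction with
  | H I ih =>
  by_cases hI : I.Nonempty
  · have : (fun a => ursell (E a) I) = fun a => E a I -
        ∑ J ∈ (I.powerset.filter fun J => hI.choose ∈ J ∧ J ≠ I).attach,
          ursell (E a) J.1 * E a (I \ J.1) := by
      ext a
      rw [ursell, dif_pos hI]
    rw [this]
    refine (hE I).sub (Finset.measurable_sum _ fun J _ => ?_)
    have hJ := J.2
    simp only [Finset.mem_filter, Finset.mem_powerset] at hJ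
    exact (ih J.1 (hJ.1.ssubset_of_ne hJ.2.2)).mul (hE _)
  · have : (fun a => ursell (E a) I) = fun _ => 0 := by
      ext a
      rw [ursell, dif_neg hI]
    rw [this]
    exact measurable_const

theorem pairEnergy_union {u : ι → ι → ℝ} (hu : ∀ i j, u i j = u j i) {Y Z : Finset ι}
    (h : Disjoint Y Z) :
    pairEnergy u (Y ∪ Z) = pairEnergy u Y + pairEnergy u Z + crossEnergy u Y Z := by
  have hc : crossEnergy u Z Y = crossEnergy u Y Z := by
    unfold crossEnergy
    rw [Finset.sum_comm]
    simp only [hu]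
  unfold pairEnergy at *
  unfold crossEnergy at *
  simp only [Finset.sum_union h, Finset.sum_add_distrib]
  rw [hc]
  ring

theorem pairEnergy_pair {u : ι → ι → ℝ} (hu : ∀ i j, u i j = u j i) {i j : ι} (hij : i ≠ j) :
    pairEnergy u {i, j} = u i j := by
  have h : ({i, j} : Finset ι) = {i} ∪ {j} := rfl
  rw [h, pairEnergy_union hu (Finset.disjoint_singleton.2 hij), pairEnergy_singleton,
    pairEnergy_singleton]
  simp [crossEnergy]

/-- The cross energy is a sum over points `z` of the second cluster, and each `z` can serve as the
root of the recursion for `E K`. -/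
theorem sum_crossEnergy_mul_ursell {u : ι → ι → ℝ} {E : Finset ι → ℝ} (hE : E ∅ = 1)
    (Y K : Finset ι) :
    ∑ Z ∈ K.powerset, crossEnergy u Y Z * ursell E Z * E (K \ Z) = crossEnergy u Y K * E K := by
  have h : ∀ Z, crossEnergy u Y Z = ∑ z ∈ Z, ∑ y ∈ Y, u y z := fun Z => by
    rw [crossEnergy, Finset.sum_comm]
  simp only [h, Finset.sum_mul]
  rw [Finset.sum_comm' (s' := fun z => K.powerset.filter fun Z => z ∈ Z) (t' := K)]
  · refine Finset.sum_congr rfl fun z hz => ?_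
    rw [Finset.sum_comm]
    refine Finset.sum_congr rfl fun y _ => ?_
    simp only [mul_assoc]
    rw [← Finset.mul_sum, sum_ursell_mul hE K hz]
  · intro Z z
    simp only [Finset.mem_filter, Finset.mem_powerset]
    constructor
    · rintro ⟨h1, h2⟩; exact ⟨⟨h1, h2⟩, h1 h2⟩
    · rintro ⟨h1, _⟩; exact h1

/-- The flow equation of the Ursell functions: differentiating the pair interaction `u` with
derivative `u'` in a parameter, `ursell' = -U' ursell - ∑ W'(Y, Z) ursell Y ursell Z`. -/
theorem hasDerivAt_ursell {u : ℝ → ι → ι → ℝ} {u' : ι → ι → ℝ} {t : ℝ}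
    (hu : ∀ i j, HasDerivAt (fun s => u s i j) (u' i j) t) (hu' : ∀ i j, u' i j = u' j i)
    (I : Finset ι) {i : ι} (hi : i ∈ I) :
    HasDerivAt (fun s => ursell (fun J => Real.exp (-pairEnergy (u s) J)) I)
      (-pairEnergy u' I * ursell (fun J => Real.exp (-pairEnergy (u t) J)) I -
        ∑ Y ∈ I.powerset with i ∈ Y, crossEnergy u' Y (I \ Y) *
          ursell (fun J => Real.exp (-pairEnergy (u t) J)) Y *
          ursell (fun J => Real.exp (-pairEnergy (u t) J)) (I \ Y)) t := by
  induction I using Finset.strongInduction with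
  | H I ih =>
  set E : ℝ → Finset ι → ℝ := fun s J => Real.exp (-pairEnergy (u s) J) with hEdef
  have hE0 : ∀ s, E s ∅ = 1 := fun s => by simp [hEdef, pairEnergy_empty]
  have hU : ∀ J, HasDerivAt (fun s => pairEnergy (u s) J) (pairEnergy u' J) t := fun J => by
    unfold pairEnergy crossEnergy
    exact ((HasDerivAt.fun_sum fun a _ => HasDerivAt.fun_sum fun b _ => hu a b).sub
      (HasDerivAt.fun_sum fun a _ => hu a a)).div_const 2
  have hE : ∀ J, HasDerivAt (fun s => E s J) (-pairEnergy u' J * E t J) t := fun J => by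
    simpa [hEdef, mul_comm] using (hU J).neg.exp
  have hrec : (fun s => ursell (E s) I) = fun s => E s I -
      ∑ J ∈ I.powerset with i ∈ J ∧ J ≠ I, ursell (E s) J * E s (I \ J) :=
    funext fun s => ursell_eq_sub (hE0 s) hi
  change HasDerivAt (fun s => ursell (E s) I) _ t
  rw [hrec]
  set S : Finset ι → ℝ := fun J => ∑ Y ∈ J.powerset with i ∈ Y, crossEnergy u' Y (J \ Y) *
    ursell (E t) Y * ursell (E t) (J \ Y) with hS
  have hd := (hE I).sub (HasDerivAt.fun_sum (u := I.powerset.filter fun J => i ∈ J ∧ J ≠ I)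
    (A := fun J s => ursell (E s) J * E s (I \ J))
    (A' := fun J => (-pairEnergy u' J * ursell (E t) J - S J) * E t (I \ J) +
      ursell (E t) J * (-pairEnergy u' (I \ J) * E t (I \ J))) fun J hJ => by
        simp only [Finset.mem_filter, Finset.mem_powerset] at hJ
        exact (ih J (hJ.1.ssubset_of_ne hJ.2.2) hJ.2.1).mul (hE _))
  refine hd.congr_deriv ?_
  change _ = -pairEnergy u' I * ursell (E t) I - S I
  -- Nested sets `Y ⊆ J` correspond to disjoint blocks `Y`, `Z` through `Z = J \ Y`, and the sum
  -- over `Z` is then carried out by `sum_crossEnergy_mul_ursell`. The term `J = I` is `S I` on the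
  -- left and zero on the right, so the identity can be solved for `S I`.
  have hSsum : ∑ J ∈ I.powerset with i ∈ J, S J * E t (I \ J) =
      ∑ J ∈ I.powerset with i ∈ J, crossEnergy u' J (I \ J) * ursell (E t) J * E t (I \ J) := by
    simp only [hS, Finset.sum_mul]
    have h1 : ∀ Y, crossEnergy u' Y (I \ Y) * ursell (E t) Y * E t (I \ Y) =
        ∑ Z ∈ (I \ Y).powerset, crossEnergy u' Y Z * ursell (E t) Y * ursell (E t) Z *
          E t ((I \ Y) \ Z) := fun Y => by
      rw [mul_right_comm, ← sum_crossEnergy_mul_ursell (hE0 t), Finset.sum_mul]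
      exact Finset.sum_congr rfl fun _ _ => by ring
    simp only [h1]
    rw [Finset.sum_sigma', Finset.sum_sigma']
    refine Finset.sum_nbij' (fun p => ⟨p.2, p.1 \ p.2⟩) (fun p => ⟨p.1 ∪ p.2, p.1⟩) ?_ ?_ ?_ ?_ ?_
    · rintro ⟨J, Y⟩ h
      simp only [Finset.mem_sigma, Finset.mem_filter, Finset.mem_powerset] at h ⊢
      exact ⟨⟨h.2.1.trans h.1.1, h.2.2⟩, Finset.sdiff_subset_sdiff h.1.1 subset_rfl⟩
    · rintro ⟨Y, Z⟩ h
      simp only [Finset.mem_sigma, Finset.mem_filter, Finset.mem_powerset] at h ⊢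
      exact ⟨⟨Finset.union_subset h.1.1 (h.2.trans Finset.sdiff_subset),
        Finset.mem_union_left _ h.1.2⟩, Finset.subset_union_left, h.1.2⟩
    · rintro ⟨J, Y⟩ h
      simp only [Finset.mem_sigma, Finset.mem_filter, Finset.mem_powerset] at h
      simp [Finset.union_sdiff_of_subset h.2.1]
    · rintro ⟨Y, Z⟩ h
      simp only [Finset.mem_sigma, Finset.mem_filter, Finset.mem_powerset,
        Finset.subset_sdiff] at h
      simp [Finset.union_sdiff_cancel_left h.2.2.symm]
    · rintro ⟨J, Y⟩ h
      simp only [Finset.mem_sigma, Finset.mem_filter, Finset.mem_powerset] at h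
      have : (I \ Y) \ (J \ Y) = I \ J := by
        ext a
        have := @h.2.1 a
        simp only [Finset.mem_sdiff]
        tauto
      simp only [this]
  rw [sum_powerset_mem_eq_add hi, sum_powerset_mem_eq_add hi, Finset.sdiff_self,
    crossEnergy_empty_right, hE0, zero_mul, zero_mul, zero_add, mul_one] at hSsum
  have hUI := sum_ursell_mul (hE0 t) I hi
  rw [sum_powerset_mem_eq_add hi, Finset.sdiff_self, hE0, mul_one] at hUI
  rw [← hUI, mul_add, Finset.mul_sum, add_sub_assoc, ← Finset.sum_sub_distrib]
  have : ∀ J ∈ I.powerset.filter (fun J => i ∈ J ∧ J ≠ I),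
      -pairEnergy u' I * (ursell (E t) J * E t (I \ J)) -
        ((-pairEnergy u' J * ursell (E t) J - S J) * E t (I \ J) +
          ursell (E t) J * (-pairEnergy u' (I \ J) * E t (I \ J))) =
        S J * E t (I \ J) - crossEnergy u' J (I \ J) * ursell (E t) J * E t (I \ J) := by
    intro J hJ
    simp only [Finset.mem_filter, Finset.mem_powerset] at hJ
    have h2 := pairEnergy_union hu' (Finset.disjoint_sdiff (s := J) (t := I))
    rw [Finset.union_sdiff_of_subset hJ.1] at h2
    rw [h2]
    ring
  rw [Finset.sum_congr rfl this, Finset.sum_sub_distrib, ← hSsum]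
  ring

end Ursell

/-! ### Heat kernel, the kernel of `(-Δ + μ)⁻²`, smeared charges and stability. -/

section Kernels

/-- The heat kernel `(2πt)⁻¹ exp (-|x|² / 2t)` on the plane. -/
def heatKernel (t : ℝ) (x : Plane) : ℝ := (2 * Real.pi * t)⁻¹ * Real.exp (-(2 * t)⁻¹ * ‖x‖ ^ 2)

/-- The kernel of `(-Δ + μ)⁻²` on the plane. -/
def greenSq (μ : ℝ) (x : Plane) : ℝ :=
  (4 * Real.pi)⁻¹ * ∫ t in Set.Ioi (0 : ℝ), Real.exp (-μ * t - ‖x‖ ^ 2 / (4 * t))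

theorem integrableOn_exp_neg_sub {μ : ℝ} (hμ : 0 < μ) {a : ℝ} (ha : 0 ≤ a) :
    IntegrableOn (fun t => Real.exp (-μ * t - a / (4 * t))) (Set.Ioi 0) := by
  refine (exp_neg_integrableOn_Ioi 0 hμ).mono' (by fun_prop) ?_
  filter_upwards [ae_restrict_mem measurableSet_Ioi] with t ht
  rw [Real.norm_eq_abs, Real.abs_exp, Real.exp_le_exp]
  have : 0 < t := ht
  have : 0 ≤ a / (4 * t) := by positivity
  linarith

theorem greenSq_nonneg (μ : ℝ) (x : Plane) : 0 ≤ greenSq μ x := by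
  unfold greenSq
  have : 0 ≤ ∫ t in Set.Ioi (0 : ℝ), Real.exp (-μ * t - ‖x‖ ^ 2 / (4 * t)) :=
    integral_nonneg fun t => (Real.exp_pos _).le
  positivity

theorem greenSq_zero {μ : ℝ} (hμ : 0 < μ) : greenSq μ 0 = (4 * Real.pi * μ)⁻¹ := by
  simp only [greenSq, norm_zero]
  simp only [ne_eq, OfNat.ofNat_ne_zero, not_false_eq_true, zero_pow, zero_div, sub_zero]
  rw [integral_exp_mul_Ioi (by linarith) 0]
  simp
  field_simp

theorem greenSq_neg (μ : ℝ) (x : Plane) : greenSq μ (-x) = greenSq μ x := by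
  simp [greenSq]

theorem measurable_greenSq : Measurable fun p : ℝ × Plane => greenSq p.1 p.2 := by
  unfold greenSq
  refine Measurable.const_mul ?_ _
  refine (StronglyMeasurable.integral_prod_right (f := fun (p : ℝ × Plane) (t : ℝ) =>
    Real.exp (-p.1 * t - ‖p.2‖ ^ 2 / (4 * t))) ?_).measurable
  apply Measurable.stronglyMeasurable
  simp only [Function.uncurry_def]
  fun_prop

theorem continuousOn_greenSq (x : Plane) : ContinuousOn (fun μ => greenSq μ x) (Set.Ioi 0) := by
  intro μ hμ
  have hμ' : 0 < μ := hμ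
  refine ContinuousAt.continuousWithinAt ?_
  unfold greenSq
  refine continuousAt_const.mul ?_
  refine continuousAt_of_dominated (bound := fun t => Real.exp (-(μ / 2) * t)) ?_ ?_
    (exp_neg_integrableOn_Ioi 0 (half_pos hμ')) ?_
  · exact Eventually.of_forall fun s => by fun_prop
  · filter_upwards [lt_mem_nhds (half_lt_self hμ')] with s hs
    filter_upwards [ae_restrict_mem measurableSet_Ioi] with t ht
    have ht' : 0 < t := ht
    rw [Real.norm_eq_abs, Real.abs_exp, Real.exp_le_exp]
    have : 0 ≤ ‖x‖ ^ 2 / (4 * t) := by positivity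
    nlinarith
  · exact Eventually.of_forall fun t => by fun_prop

theorem heatKernel_nonneg {t : ℝ} (ht : 0 < t) (x : Plane) : 0 ≤ heatKernel t x := by
  unfold heatKernel; positivity

theorem heatKernel_neg (t : ℝ) (x : Plane) : heatKernel t (-x) = heatKernel t x := by
  simp [heatKernel]

theorem measurable_heatKernel : Measurable fun p : ℝ × Plane => heatKernel p.1 p.2 := by
  unfold heatKernel
  fun_prop

theorem integral_exp_neg_mul_norm_sq {b : ℝ} (hb : 0 < b) :
    ∫ x : Plane, Real.exp (-b * ‖x‖ ^ 2) = Real.pi / b := by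
  rw [GaussianFourier.integral_rexp_neg_mul_sq_norm hb]
  simp

theorem integrable_exp_neg_mul_norm_sq {b : ℝ} (hb : 0 < b) :
    Integrable fun x : Plane => Real.exp (-b * ‖x‖ ^ 2) :=
  Integrable.of_integral_ne_zero (by rw [integral_exp_neg_mul_norm_sq hb]; positivity)

theorem integrable_heatKernel {t : ℝ} (ht : 0 < t) : Integrable (heatKernel t) :=
  (integrable_exp_neg_mul_norm_sq (by positivity)).const_mul _

theorem integral_heatKernel {t : ℝ} (ht : 0 < t) : ∫ x, heatKernel t x = 1 := by
  unfold heatKernel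
  rw [integral_const_mul, integral_exp_neg_mul_norm_sq (by positivity)]
  field_simp

theorem lintegral_heatKernel {t : ℝ} (ht : 0 < t) : ∫⁻ x, ‖heatKernel t x‖ₑ = 1 := by
  simp_rw [Real.enorm_eq_ofReal (heatKernel_nonneg ht _)]
  rw [← ofReal_integral_eq_lintegral_ofReal (integrable_heatKernel ht)
    (Eventually.of_forall (heatKernel_nonneg ht)), integral_heatKernel ht, ENNReal.ofReal_one]

/-- Completing the square about the midpoint turns a product of two Gaussians into one Gaussian in
`w`. -/
theorem norm_sub_sq_add_norm_sub_sq (x y w : Plane) :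
    ‖x - w‖ ^ 2 + ‖y - w‖ ^ 2 = 2 * ‖(2⁻¹ : ℝ) • (x + y) - w‖ ^ 2 + ‖x - y‖ ^ 2 / 2 := by
  have h := parallelogram_law_with_norm ℝ (x - w) (y - w)
  have h1 : x - w - (y - w) = x - y := by abel
  have h2 : x - w + (y - w) = (2 : ℝ) • ((2⁻¹ : ℝ) • (x + y) - w) := by
    rw [smul_sub, smul_smul]; norm_num [two_smul]; abel
  rw [h1, h2, norm_smul, Real.norm_two] at h
  linarith

theorem integrable_exp_mul_exp {b : ℝ} (hb : 0 < b) (x y : Plane) :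
    Integrable fun w : Plane => Real.exp (-b * ‖x - w‖ ^ 2) * Real.exp (-b * ‖y - w‖ ^ 2) := by
  refine (((integrable_exp_neg_mul_norm_sq hb).comp_sub_left x)).mono' (by fun_prop)
    (Eventually.of_forall fun w => ?_)
  rw [Real.norm_eq_abs, abs_mul, Real.abs_exp, Real.abs_exp]
  refine mul_le_of_le_one_right (Real.exp_pos _).le (Real.exp_le_one_iff.2 ?_)
  have := mul_nonneg hb.le (sq_nonneg ‖y - w‖)
  linarith

theorem integral_exp_mul_exp {b : ℝ} (hb : 0 < b) (x y : Plane) :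
    ∫ w : Plane, Real.exp (-b * ‖x - w‖ ^ 2) * Real.exp (-b * ‖y - w‖ ^ 2) =
      Real.pi / (2 * b) * Real.exp (-(b / 2) * ‖x - y‖ ^ 2) := by
  have : ∀ w, Real.exp (-b * ‖x - w‖ ^ 2) * Real.exp (-b * ‖y - w‖ ^ 2) =
      Real.exp (-(b / 2) * ‖x - y‖ ^ 2) *
        Real.exp (-(2 * b) * ‖(2⁻¹ : ℝ) • (x + y) - w‖ ^ 2) := fun w => by
    rw [← Real.exp_add, ← Real.exp_add]
    congr 1
    linear_combination (-b) * norm_sub_sq_add_norm_sub_sq x y w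
  simp_rw [this]
  rw [integral_const_mul, integral_sub_left_eq_self
    (fun w : Plane => Real.exp (-(2 * b) * ‖w‖ ^ 2)) volume, integral_exp_neg_mul_norm_sq
    (by positivity), mul_comm]

theorem integrable_heatKernel_mul {t : ℝ} (ht : 0 < t) (x y : Plane) :
    Integrable fun w => heatKernel t (x - w) * heatKernel t (y - w) := by
  convert (integrable_exp_mul_exp (b := (2 * t)⁻¹) (by positivity) x y).const_mul
    ((2 * Real.pi * t)⁻¹ * (2 * Real.pi * t)⁻¹) using 2
  unfold heatKernel
  ring

/-- The semigroup property of the heat kernel, integrated against `t exp (-μ t)`. -/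
theorem mul_integral_heatKernel_mul {t : ℝ} (ht : 0 < t) (μ : ℝ) (x y : Plane) :
    t * Real.exp (-μ * t) * ∫ w, heatKernel t (x - w) * heatKernel t (y - w) =
      (4 * Real.pi)⁻¹ * Real.exp (-μ * t - ‖x - y‖ ^ 2 / (4 * t)) := by
  have : ∀ w, heatKernel t (x - w) * heatKernel t (y - w) =
      ((2 * Real.pi * t)⁻¹ * (2 * Real.pi * t)⁻¹) *
        (Real.exp (-(2 * t)⁻¹ * ‖x - w‖ ^ 2) * Real.exp (-(2 * t)⁻¹ * ‖y - w‖ ^ 2)) := fun w => by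
    unfold heatKernel
    ring
  simp_rw [this]
  rw [integral_const_mul, integral_exp_mul_exp (by positivity), sub_eq_add_neg (-μ * t), Real.exp_add]
  have h2 : -(‖x - y‖ ^ 2 / (4 * t)) = -((2 * t)⁻¹ / 2) * ‖x - y‖ ^ 2 := by
    field_simp
    ring
  rw [h2]
  field_simp
  ring

variable {ι : Type*}

/-- The smeared charge density `∑ σ_y q_t(x_y - w)` of a cluster `Y`. -/
def smearedCharge (s : ι → ℝ) (x : ι → Plane) (Y : Finset ι) (t : ℝ) (w : Plane) : ℝ :=
  ∑ y ∈ Y, s y * heatKernel t (x y - w)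

theorem mul_integral_smearedCharge_mul (s : ι → ℝ) (x : ι → Plane) (Y Z : Finset ι) (μ : ℝ)
    {t : ℝ} (ht : 0 < t) :
    t * Real.exp (-μ * t) * ∫ w, smearedCharge s x Y t w * smearedCharge s x Z t w =
      ∑ y ∈ Y, ∑ z ∈ Z, s y * s z *
        ((4 * Real.pi)⁻¹ * Real.exp (-μ * t - ‖x y - x z‖ ^ 2 / (4 * t))) := by
  have h : ∀ w, smearedCharge s x Y t w * smearedCharge s x Z t w =
      ∑ y ∈ Y, ∑ z ∈ Z, s y * s z * (heatKernel t (x y - w) * heatKernel t (x z - w)) := fun w => by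
    unfold smearedCharge
    rw [Finset.sum_mul_sum]
    exact Finset.sum_congr rfl fun y _ => Finset.sum_congr rfl fun z _ => by ring
  simp_rw [h]
  rw [integral_finsetSum _ fun y _ => integrable_finsetSum _ fun z _ =>
    (integrable_heatKernel_mul ht (x y) (x z)).const_mul _, Finset.mul_sum]
  refine Finset.sum_congr rfl fun y _ => ?_
  rw [integral_finsetSum _ fun z _ => (integrable_heatKernel_mul ht (x y) (x z)).const_mul _,
    Finset.mul_sum]
  refine Finset.sum_congr rfl fun z _ => ?_
  rw [integral_const_mul, ← mul_integral_heatKernel_mul ht]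
  ring

/-- The interaction of two clusters through `greenSq` is a superposition of overlaps of their
smeared charges. -/
theorem crossEnergy_greenSq (s : ι → ℝ) (x : ι → Plane) (Y Z : Finset ι) {μ : ℝ} (hμ : 0 < μ) :
    crossEnergy (fun i j => s i * s j * greenSq μ (x i - x j)) Y Z =
      ∫ t in Set.Ioi (0 : ℝ), t * Real.exp (-μ * t) *
        ∫ w, smearedCharge s x Y t w * smearedCharge s x Z t w := by
  have hi : ∀ y z, IntegrableOn (fun t => s y * s z *
        ((4 * Real.pi)⁻¹ * Real.exp (-μ * t - ‖x y - x z‖ ^ 2 / (4 * t)))) (Set.Ioi 0) :=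
    fun y z => ((integrableOn_exp_neg_sub hμ (sq_nonneg _)).const_mul _).const_mul _
  rw [setIntegral_congr_fun measurableSet_Ioi fun t ht =>
    mul_integral_smearedCharge_mul s x Y Z μ ht,
    integral_finsetSum _ fun y _ => integrable_finsetSum _ fun z _ => hi y z]
  unfold crossEnergy
  refine Finset.sum_congr rfl fun y _ => ?_
  rw [integral_finsetSum _ fun z _ => hi y z]
  refine Finset.sum_congr rfl fun z _ => ?_
  rw [integral_const_mul, integral_const_mul]
  rfl

theorem crossEnergy_greenSq_self_nonneg (s : ι → ℝ) (x : ι → Plane) (Y : Finset ι) {μ : ℝ}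
    (hμ : 0 < μ) :
    0 ≤ crossEnergy (fun i j => s i * s j * greenSq μ (x i - x j)) Y Y := by
  rw [crossEnergy_greenSq s x Y Y hμ]
  refine setIntegral_nonneg measurableSet_Ioi fun t ht => ?_
  have ht' : 0 < t := ht
  have : 0 ≤ ∫ w, smearedCharge s x Y t w * smearedCharge s x Y t w :=
    integral_nonneg fun w => mul_self_nonneg _
  positivity

/-- Absolute values are taken only of whole smeared charges, so the cancellation inside a neutral
cluster is not lost. -/
theorem enorm_crossEnergy_greenSq_le (s : ι → ℝ) (x : ι → Plane) (Y Z : Finset ι) {μ : ℝ}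
    (hμ : 0 < μ) :
    ‖crossEnergy (fun i j => s i * s j * greenSq μ (x i - x j)) Y Z‖ₑ ≤
      ∫⁻ t in Set.Ioi (0 : ℝ), ENNReal.ofReal (t * Real.exp (-μ * t)) *
        ∫⁻ w, ‖smearedCharge s x Y t w‖ₑ * ‖smearedCharge s x Z t w‖ₑ := by
  rw [crossEnergy_greenSq s x Y Z hμ]
  refine (enorm_integral_le_lintegral_enorm _).trans (setLIntegral_mono' measurableSet_Ioi ?_)
  intro t ht
  have ht' : 0 < t := ht
  rw [enorm_mul, Real.enorm_eq_ofReal (by positivity)]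
  gcongr
  refine (enorm_integral_le_lintegral_enorm _).trans_eq ?_
  simp_rw [enorm_mul]

/-- Positivity of `greenSq` as a quadratic form gives stability. -/
theorem neg_le_pairEnergy_greenSq (s : ι → ℝ) (hs : ∀ i, s i ^ 2 = 1) (x : ι → Plane)
    (I : Finset ι) {μ : ℝ} (hμ : 0 < μ) :
    -(I.card / (8 * Real.pi * μ)) ≤
      pairEnergy (fun i j => s i * s j * greenSq μ (x i - x j)) I := by
  have h := crossEnergy_greenSq_self_nonneg s x I hμ
  unfold pairEnergy
  -- The full quadratic form is nonnegative, so the only loss is half of the removed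
  -- self-interactions.
  have h1 : ∀ i ∈ I, s i * s i * greenSq μ (x i - x i) = (4 * Real.pi * μ)⁻¹ := fun i _ => by
    rw [sub_self, greenSq_zero hμ, ← sq, hs, one_mul]
  rw [Finset.sum_congr rfl h1, Finset.sum_const, nsmul_eq_mul]
  have : (I.card : ℝ) / (8 * Real.pi * μ) = I.card * (4 * Real.pi * μ)⁻¹ / 2 := by
    field_simp
    ring
  rw [this]
  linarith

end Kernels

/-! ### Translates of the heat kernel in `L¹` and moments of `greenSq`. -/

section KernelBounds

/-- The `L¹` distance of two translates of the heat kernel, estimated through their Hellinger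
affinity. -/
theorem lintegral_heatKernel_sub_sub_le {t : ℝ} (ht : 0 < t) (x y : Plane) :
    ∫⁻ w, ‖heatKernel t (x - w) - heatKernel t (y - w)‖ₑ ≤
      ENNReal.ofReal (‖x - y‖ / Real.sqrt t) := by
  rcases eq_or_ne x y with rfl | hxy
  · simp
  have hd : 0 < ‖x - y‖ := norm_pos_iff.2 (sub_ne_zero.2 hxy)
  have hst : 0 < Real.sqrt t := Real.sqrt_pos.2 ht
  have hb : 0 < (4 * t)⁻¹ := by positivity
  set d := ‖x - y‖ with hddef
  -- The weight in `2ab ≤ ηa² + η⁻¹b²`. It equalises the two final contributions `η d² / (8t)` and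
  -- `2/η`, each then being `d / (2√t)`.
  set η := 4 * Real.sqrt t / d with hη
  have hηpos : 0 < η := by positivity
  set c := (2 * Real.pi * t)⁻¹ with hc
  have hcpos : 0 < c := by positivity
  -- Up to normalisation `e` is the square root of the heat kernel, so a difference of kernels
  -- factors as a difference times a sum.
  set e : Plane → Plane → ℝ := fun z w => Real.exp (-(4 * t)⁻¹ * ‖z - w‖ ^ 2) with he
  have hq : ∀ z w, heatKernel t (z - w) = c * (e z w * e z w) := fun z w => by
    simp only [he, hc, heatKernel, ← Real.exp_add]
    congr 2
    field_simp
    ring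
  have hi : ∀ z z', Integrable fun w => e z w * e z' w := fun z z' =>
    integrable_exp_mul_exp hb z z'
  have hI : ∀ z z', ∫ w, e z w * e z' w =
      c⁻¹ * Real.exp (-(8 * t)⁻¹ * ‖z - z'‖ ^ 2) := fun z z' => by
    rw [integral_exp_mul_exp hb z z', hc, inv_inv]
    congr 1
    · field_simp; norm_num
    · congr 2; field_simp; norm_num
  have hdiag : ∀ z, ∫ w, e z w * e z w = c⁻¹ := fun z => by simp [hI]
  set F : Plane → ℝ := fun w => c / 2 * ((η + η⁻¹) * (e x w * e x w) +
    (η + η⁻¹) * (e y w * e y w) + 2 * (η⁻¹ - η) * (e x w * e y w)) with hF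
  have hFi : Integrable F := ((((hi x x).const_mul _).add ((hi y y).const_mul _)).add
    ((hi x y).const_mul _)).const_mul _
  have hle : ∀ w, |heatKernel t (x - w) - heatKernel t (y - w)| ≤ F w := fun w => by
    rw [hq, hq, ← mul_sub, abs_mul, abs_of_pos hcpos, mul_self_sub_mul_self, abs_mul]
    have hpos : 0 < e x w + e y w := by positivity
    rw [abs_of_pos hpos]
    have hF' : F w = c * ((η * |e x w - e y w| ^ 2 + η⁻¹ * (e x w + e y w) ^ 2) / 2) := by
      rw [sq_abs, hF]; ring
    rw [hF']
    refine mul_le_mul_of_nonneg_left ?_ hcpos.le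
    have h1 := mul_nonneg hηpos.le (sq_nonneg (|e x w - e y w| - η⁻¹ * (e x w + e y w)))
    have h2 : η * (|e x w - e y w| - η⁻¹ * (e x w + e y w)) ^ 2 = η * |e x w - e y w| ^ 2 +
        η⁻¹ * (e x w + e y w) ^ 2 - 2 * ((e x w + e y w) * |e x w - e y w|) := by
      field_simp
      ring
    linarith
  calc ∫⁻ w, ‖heatKernel t (x - w) - heatKernel t (y - w)‖ₑ ≤ ∫⁻ w, ENNReal.ofReal (F w) := by
        refine lintegral_mono fun w => ?_
        rw [← ofReal_norm, Real.norm_eq_abs]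
        exact ENNReal.ofReal_le_ofReal (hle w)
    _ = ENNReal.ofReal (∫ w, F w) := (ofReal_integral_eq_lintegral_ofReal hFi
        (Eventually.of_forall fun w => (abs_nonneg _).trans (hle w))).symm
    _ ≤ _ := ENNReal.ofReal_le_ofReal ?_
  have hIF : ∫ w, F w = (η * (1 - Real.exp (-(8 * t)⁻¹ * d ^ 2)) +
      η⁻¹ * (1 + Real.exp (-(8 * t)⁻¹ * d ^ 2))) := by
    have hadd := integral_add (f := fun w => (η + η⁻¹) * (e x w * e x w) +
      (η + η⁻¹) * (e y w * e y w)) (((hi x x).const_mul _).add ((hi y y).const_mul _))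
      ((hi x y).const_mul (2 * (η⁻¹ - η)))
    rw [hF, integral_const_mul, hadd, integral_add ((hi x x).const_mul _) ((hi y y).const_mul _),
      integral_const_mul, integral_const_mul, integral_const_mul, hdiag, hdiag, hI]
    field_simp
    ring
  rw [hIF]
  have h1 : Real.exp (-(8 * t)⁻¹ * d ^ 2) ≤ 1 := Real.exp_le_one_iff.2 (by
    have : 0 ≤ (8 * t)⁻¹ * d ^ 2 := by positivity
    linarith)
  have h2 := Real.add_one_le_exp (-(8 * t)⁻¹ * d ^ 2)
  have h3 : η * (1 - Real.exp (-(8 * t)⁻¹ * d ^ 2)) ≤ η * ((8 * t)⁻¹ * d ^ 2) :=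
    mul_le_mul_of_nonneg_left (by linarith) hηpos.le
  have h4 : η⁻¹ * (1 + Real.exp (-(8 * t)⁻¹ * d ^ 2)) ≤ η⁻¹ * 2 :=
    mul_le_mul_of_nonneg_left (by linarith) (by positivity)
  refine (add_le_add h3 h4).trans_eq ?_
  have ht2 : t = Real.sqrt t ^ 2 := (Real.sq_sqrt ht.le).symm
  rw [hη]
  nth_rewrite 2 [ht2]
  field_simp
  norm_num

theorem integral_mul_exp_neg {μ : ℝ} (hμ : 0 < μ) (k : ℕ) :
    ∫ t in Set.Ioi (0 : ℝ), t ^ k * Real.exp (-μ * t) = k.factorial / μ ^ (k + 1) := by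
  have h := Real.integral_rpow_mul_exp_neg_mul_Ioi (a := (k : ℝ) + 1) (by positivity) hμ
  rw [Real.Gamma_nat_eq_factorial] at h
  have h2 : (1 / μ) ^ ((k : ℝ) + 1) = 1 / μ ^ (k + 1) := by
    rw [← Nat.cast_succ, Real.rpow_natCast, one_div_pow]
  rw [h2] at h
  simp only [add_sub_cancel_right, Real.rpow_natCast, ← neg_mul] at h
  rw [h]
  ring

theorem integrableOn_mul_exp_neg {μ : ℝ} (hμ : 0 < μ) (k : ℕ) :
    IntegrableOn (fun t => t ^ k * Real.exp (-μ * t)) (Set.Ioi 0) :=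
  Integrable.of_integral_ne_zero (by rw [integral_mul_exp_neg hμ]; positivity)

theorem lintegral_mul_exp_neg {μ : ℝ} (hμ : 0 < μ) (k : ℕ) :
    ∫⁻ t in Set.Ioi (0 : ℝ), ENNReal.ofReal (t ^ k * Real.exp (-μ * t)) =
      ENNReal.ofReal (k.factorial / μ ^ (k + 1)) := by
  rw [← integral_mul_exp_neg hμ, ofReal_integral_eq_lintegral_ofReal
    (integrableOn_mul_exp_neg hμ k)]
  filter_upwards [ae_restrict_mem measurableSet_Ioi] with t ht
  have : 0 < t := ht
  simp only [Pi.zero_apply]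
  positivity

/-- By Tonelli a moment of `greenSq` is a proper-time integral of Gaussian moments; growth `t ^ k`
of the latter leads to a Gamma integral. The factor `4π` in `hint` cancels the normalisation of the
kernel. -/
theorem lintegral_mul_greenSq {μ : ℝ} (hμ : 0 < μ) {f : Plane → ℝ} (hf : Measurable f)
    (hf0 : ∀ x, 0 ≤ f x) {C : ℝ} {k : ℕ} (hC : 0 < C)
    (hint : ∀ t, 0 < t → ∫ x : Plane, f x * Real.exp (-(4 * t)⁻¹ * ‖x‖ ^ 2) =
      4 * Real.pi * C * t ^ k) :
    ∫⁻ x, ENNReal.ofReal (f x * greenSq μ x) =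
      ENNReal.ofReal (C * (k.factorial / μ ^ (k + 1))) := by
  have h1 : ∀ x, ENNReal.ofReal (f x * greenSq μ x) = ∫⁻ t in Set.Ioi (0 : ℝ),
      ENNReal.ofReal ((4 * Real.pi)⁻¹ * Real.exp (-μ * t)) *
        ENNReal.ofReal (f x * Real.exp (-(4 * t)⁻¹ * ‖x‖ ^ 2)) := fun x => by
    rw [greenSq, ← mul_assoc, ← integral_const_mul, ofReal_integral_eq_lintegral_ofReal
      ((integrableOn_exp_neg_sub hμ (sq_nonneg _)).const_mul _)]
    · refine setLIntegral_congr_fun measurableSet_Ioi fun t ht => ?_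
      have ht' : 0 < t := ht
      rw [← ENNReal.ofReal_mul (by positivity), sub_eq_add_neg, Real.exp_add]
      have : -(‖x‖ ^ 2 / (4 * t)) = -(4 * t)⁻¹ * ‖x‖ ^ 2 := by field_simp
      rw [this]
      congr 1
      ring
    · refine Eventually.of_forall fun t => ?_
      have := hf0 x
      simp only [Pi.zero_apply]
      positivity
  simp_rw [h1]
  rw [lintegral_lintegral_swap]
  · rw [ENNReal.ofReal_mul hC.le, ← lintegral_mul_exp_neg hμ k, ← lintegral_const_mul _
      (by fun_prop)]
    refine setLIntegral_congr_fun measurableSet_Ioi fun t ht => ?_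
    have ht' : 0 < t := ht
    have hne : ∫ x : Plane, f x * Real.exp (-(4 * t)⁻¹ * ‖x‖ ^ 2) ≠ 0 := by
      rw [hint t ht']; positivity
    beta_reduce
    rw [lintegral_const_mul _ (by fun_prop), ← ofReal_integral_eq_lintegral_ofReal
      (Integrable.of_integral_ne_zero hne) (Eventually.of_forall fun x => by
        have := hf0 x
        simp only [Pi.zero_apply]
        positivity), hint t ht', ← ENNReal.ofReal_mul (by positivity),
      ← ENNReal.ofReal_mul (by positivity)]
    congr 1
    field_simp
  · apply Measurable.aemeasurable
    simp only [Function.uncurry_def]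
    fun_prop

theorem lintegral_greenSq {μ : ℝ} (hμ : 0 < μ) :
    ∫⁻ x, ENNReal.ofReal (greenSq μ x) = ENNReal.ofReal (μ ^ 2)⁻¹ := by
  have := lintegral_mul_greenSq hμ (f := fun _ => 1) (C := 1) (k := 1) measurable_const
    (fun _ => zero_le_one) one_pos fun t ht => by
      simp_rw [one_mul]
      rw [integral_exp_neg_mul_norm_sq (by positivity)]
      field_simp
  simpa using this

theorem integral_norm_sq_mul_exp {t : ℝ} (ht : 0 < t) :
    ∫ x : Plane, ‖x‖ ^ 2 * Real.exp (-(4 * t)⁻¹ * ‖x‖ ^ 2) = 4 * Real.pi * 4 * t ^ 2 := by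
  rw [integral_fun_norm_addHaar volume fun r => r ^ 2 * Real.exp (-(4 * t)⁻¹ * r ^ 2)]
  have h := integral_rpow_mul_exp_neg_mul_rpow (p := 2) (q := 3) (b := (4 * t)⁻¹) two_pos
    (by norm_num) (by positivity)
  have h3 : ∫ r in Set.Ioi (0 : ℝ), r ^ (Module.finrank ℝ Plane - 1) •
      (r ^ 2 * Real.exp (-(4 * t)⁻¹ * r ^ 2)) = 8 * t ^ 2 := by
    norm_num at h
    simp only [finrank_euclideanSpace, Fintype.card_fin, smul_eq_mul]
    norm_num
    calc _ = ∫ x in Set.Ioi (0 : ℝ), x ^ 3 * Real.exp (-(t⁻¹ * (1 / 4) * x ^ 2)) := by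
          refine setIntegral_congr_fun measurableSet_Ioi fun r _ => ?_
          ring_nf
      _ = _ := by
          rw [h]
          field_simp
          norm_num
  rw [h3]
  simp [Measure.real, EuclideanSpace.volume_ball_fin_two, Real.pi_nonneg]
  ring

theorem lintegral_norm_sq_mul_greenSq {μ : ℝ} (hμ : 0 < μ) :
    ∫⁻ x, ENNReal.ofReal (‖x‖ ^ 2 * greenSq μ x) = ENNReal.ofReal (8 * (μ ^ 3)⁻¹) := by
  rw [lintegral_mul_greenSq hμ (f := fun x => ‖x‖ ^ 2) (C := 4) (k := 2) (by fun_prop)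
    (fun _ => by positivity) (by norm_num) fun t ht => integral_norm_sq_mul_exp ht]
  congr 1
  norm_num [Nat.factorial]
  ring

end KernelBounds

/-! ### The cutoff potential as an integral over masses. -/

section Potential

/-- The difference `β (-Δ + m)⁻¹ - β (-Δ + M)⁻¹` of covariances, with its continuous value at the
origin. -/
def flowPotential (β M m : ℝ) (x : Plane) : ℝ := β * ∫ s in m..M, greenSq s x

theorem flowPotential_neg (β M m : ℝ) (x : Plane) :
    flowPotential β M m (-x) = flowPotential β M m x := by
  simp [flowPotential, greenSq_neg]

theorem flowPotential_self (β M : ℝ) (x : Plane) : flowPotential β M M x = 0 := by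
  simp [flowPotential]

theorem flowPotential_nonneg {β M m : ℝ} (hβ : 0 ≤ β) (hmM : m ≤ M) (x : Plane) :
    0 ≤ flowPotential β M m x :=
  mul_nonneg hβ (intervalIntegral.integral_nonneg_of_forall hmM fun _ => greenSq_nonneg _ _)

theorem intervalIntegrable_greenSq {a b : ℝ} (ha : 0 < a) (hb : 0 < b) (x : Plane) :
    IntervalIntegrable (fun s => greenSq s x) volume a b :=
  ((continuousOn_greenSq x).mono fun _ hs => lt_of_lt_of_le (lt_min ha hb) hs.1).intervalIntegrable

theorem hasDerivAt_flowPotential (β : ℝ) {M m : ℝ} (hM : 0 < M) (hm : 0 < m) (x : Plane) :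
    HasDerivAt (fun s => flowPotential β M s x) (-(β * greenSq m x)) m := by
  have h := intervalIntegral.integral_hasDerivAt_left (intervalIntegrable_greenSq hm hM x)
    ((continuousOn_greenSq x).stronglyMeasurableAtFilter isOpen_Ioi m hm)
    ((continuousOn_greenSq x).continuousAt (Ioi_mem_nhds hm))
  simpa [flowPotential] using h.const_mul β

/-- The mass is an endpoint of integration; indicator functions move it into the integrand, where
joint measurability is available. -/
theorem measurable_flowPotential (β M : ℝ) :
    Measurable fun p : ℝ × Plane => flowPotential β M p.1 p.2 := by
  have h : ∀ p : ℝ × Plane, flowPotential β M p.1 p.2 =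
      β * ((∫ s, ({q : (ℝ × Plane) × ℝ | q.1.1 < q.2 ∧ q.2 ≤ M}.indicator
        (fun q => greenSq q.2 q.1.2)) (p, s)) -
      ∫ s, ({q : (ℝ × Plane) × ℝ | M < q.2 ∧ q.2 ≤ q.1.1}.indicator
        (fun q => greenSq q.2 q.1.2)) (p, s)) := fun p => by
    rw [flowPotential, intervalIntegral, ← integral_indicator measurableSet_Ioc,
      ← integral_indicator measurableSet_Ioc]
    rfl
  simp_rw [h]
  have hg : Measurable fun q : (ℝ × Plane) × ℝ => greenSq q.2 q.1.2 :=
    measurable_greenSq.comp (measurable_snd.prodMk (measurable_snd.comp measurable_fst))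
  refine Measurable.const_mul (Measurable.sub ?_ ?_) _
  · refine (StronglyMeasurable.integral_prod_right (f := fun (p : ℝ × Plane) (s : ℝ) => _)
      (Measurable.stronglyMeasurable ?_)).measurable
    refine hg.indicator (MeasurableSet.inter (s₁ := {q : (ℝ × Plane) × ℝ | q.1.1 < q.2})
      (s₂ := {q | q.2 ≤ M}) ?_ ?_)
    exacts [measurableSet_lt (by fun_prop) (by fun_prop),
      measurableSet_le (by fun_prop) (by fun_prop)]
  · refine (StronglyMeasurable.integral_prod_right (f := fun (p : ℝ × Plane) (s : ℝ) => _)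
      (Measurable.stronglyMeasurable ?_)).measurable
    refine hg.indicator (MeasurableSet.inter (s₁ := {q : (ℝ × Plane) × ℝ | M < q.2})
      (s₂ := {q | q.2 ≤ q.1.1}) ?_ ?_)
    exacts [measurableSet_lt (by fun_prop) (by fun_prop),
      measurableSet_le (by fun_prop) (by fun_prop)]

/-- The proper time representation of the Bessel function `K₀`. -/
theorem integral_exp_div_eq_besselK0 {m r : ℝ} (hm : 0 < m) (hr : 0 < r) :
    ∫ t in Set.Ioi (0 : ℝ), Real.exp (-m * t - r ^ 2 / (4 * t)) / t =
      2 * besselK0 (Real.sqrt m * r) := by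
  have hsm : 0 < Real.sqrt m := Real.sqrt_pos.2 hm
  -- The substitution `t = c exp u` makes the exponent `-√m r cosh u`. The integral over all real
  -- `u` of this even function is twice the one defining `besselK0`.
  set c := r / (2 * Real.sqrt m) with hc
  have hcpos : 0 < c := by positivity
  have himage : (fun u => c * Real.exp u) '' Set.univ = Set.Ioi 0 := by
    ext t
    simp only [Set.image_univ, Set.mem_range, Set.mem_Ioi]
    constructor
    · rintro ⟨u, rfl⟩; positivity
    · intro ht
      refine ⟨Real.log (t / c), ?_⟩
      rw [Real.exp_log (by positivity)]
      field_simp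
  have hinj : Set.InjOn (fun u => c * Real.exp u) Set.univ := by
    intro u _ v _ h
    exact Real.exp_injective (mul_left_cancel₀ hcpos.ne' h)
  have h := integral_image_eq_integral_abs_deriv_smul MeasurableSet.univ
    (fun u _ => ((Real.hasDerivAt_exp u).const_mul c).hasDerivWithinAt) hinj
    (fun t => Real.exp (-m * t - r ^ 2 / (4 * t)) / t)
  rw [himage] at h
  rw [h, setIntegral_univ, besselK0, ← integral_comp_abs]
  refine integral_congr_ae (Eventually.of_forall fun u => ?_)
  simp only [smul_eq_mul]
  have hpos : 0 < c * Real.exp u := by positivity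
  rw [abs_of_pos hpos, mul_div_cancel₀ _ hpos.ne', Real.cosh_abs, Real.cosh_eq, Real.exp_neg]
  congr 1
  have hm2 : m = Real.sqrt m ^ 2 := (Real.sq_sqrt hm.le).symm
  rw [hc]
  nth_rewrite 1 [hm2]
  field_simp
  ring

/-- Near `t = 0` the factor `1/t` is absorbed through `exp (-a) ≤ 1/a` with `a = r² / (4t)`; this
needs `r ≠ 0`. -/
theorem integrableOn_exp_div {m r : ℝ} (hm : 0 < m) (hr : 0 < r) :
    IntegrableOn (fun t => Real.exp (-m * t - r ^ 2 / (4 * t)) / t) (Set.Ioi 0) := by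
  refine ((exp_neg_integrableOn_Ioi 0 hm).const_mul (4 / r ^ 2)).mono'
    (Measurable.aestronglyMeasurable (by fun_prop)) ?_
  filter_upwards [ae_restrict_mem measurableSet_Ioi] with t ht
  have ht' : 0 < t := ht
  rw [Real.norm_eq_abs, abs_div, Real.abs_exp, abs_of_pos ht', sub_eq_add_neg, Real.exp_add,
    mul_div_assoc, mul_comm (4 / r ^ 2)]
  refine mul_le_mul_of_nonneg_left ?_ (Real.exp_pos _).le
  have h1 : r ^ 2 / (4 * t) ≤ Real.exp (r ^ 2 / (4 * t)) := by
    have := Real.add_one_le_exp (r ^ 2 / (4 * t))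
    linarith
  rw [Real.exp_neg, div_le_div_iff₀ ht' (by positivity)]
  calc (Real.exp (r ^ 2 / (4 * t)))⁻¹ * r ^ 2 ≤ (r ^ 2 / (4 * t))⁻¹ * r ^ 2 := by gcongr
    _ = 4 * t := by field_simp

/-- Integrating `exp (-s t)` over the mass first leaves `(exp (-m t) - exp (-M t)) / t`, whose two
halves are Bessel functions. Away from the origin each half is integrable by itself. -/
theorem flowPotential_eq_covariance_sub (β : ℝ) {M m : ℝ} (hm : 0 < m) (hmM : m ≤ M) {x : Plane}
    (hx : x ≠ 0) : flowPotential β M m x = covariance β m x - covariance β M x := by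
  have hr : 0 < ‖x‖ := norm_pos_iff.2 hx
  have hM : 0 < M := hm.trans_le hmM
  have hswap : ∫ s in m..M, ∫ t in Set.Ioi (0 : ℝ), Real.exp (-s * t - ‖x‖ ^ 2 / (4 * t)) =
      ∫ t in Set.Ioi (0 : ℝ), ∫ s in m..M, Real.exp (-s * t - ‖x‖ ^ 2 / (4 * t)) := by
    simp_rw [intervalIntegral.integral_of_le hmM]
    refine integral_integral_swap ?_
    have hdom : Integrable (fun p : ℝ × ℝ => Real.exp (-m * p.2))
        ((volume.restrict (Set.Ioc m M)).prod (volume.restrict (Set.Ioi 0))) := by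
      have := (integrable_const (1 : ℝ) (μ := volume.restrict (Set.Ioc m M))).mul_prod
        (exp_neg_integrableOn_Ioi 0 hm)
      simpa using this
    refine hdom.mono' (Measurable.aestronglyMeasurable (by
      simp only [Function.uncurry_def]; fun_prop)) ?_
    rw [Measure.prod_restrict]
    filter_upwards [ae_restrict_mem (measurableSet_Ioc.prod measurableSet_Ioi)] with p hp
    have ht : 0 < p.2 := hp.2
    have hs : m < p.1 := hp.1.1
    simp only [Function.uncurry_def]
    rw [Real.norm_eq_abs, Real.abs_exp, Real.exp_le_exp]
    have : 0 ≤ ‖x‖ ^ 2 / (4 * p.2) := by positivity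
    nlinarith
  have hinner : ∀ t ∈ Set.Ioi (0 : ℝ), ∫ s in m..M, Real.exp (-s * t - ‖x‖ ^ 2 / (4 * t)) =
      Real.exp (-m * t - ‖x‖ ^ 2 / (4 * t)) / t - Real.exp (-M * t - ‖x‖ ^ 2 / (4 * t)) / t := by
    intro t ht
    have ht' : 0 < t := ht
    have hd : ∀ s ∈ Set.uIcc m M, HasDerivAt
        (fun s => -(Real.exp (-s * t - ‖x‖ ^ 2 / (4 * t)) / t))
        (Real.exp (-s * t - ‖x‖ ^ 2 / (4 * t))) s := fun s _ => by
      have := (((((hasDerivAt_id s).neg.mul_const t).sub_const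
        (‖x‖ ^ 2 / (4 * t))).exp).div_const t).neg
      refine this.congr_deriv ?_
      simp only [id, Pi.neg_apply]
      field_simp
    rw [intervalIntegral.integral_eq_sub_of_hasDerivAt hd
      (Continuous.intervalIntegrable (by fun_prop) _ _)]
    ring
  simp only [flowPotential, greenSq, covariance]
  rw [intervalIntegral.integral_const_mul, hswap,
    setIntegral_congr_fun measurableSet_Ioi hinner,
    integral_sub (integrableOn_exp_div hm hr) (integrableOn_exp_div hM hr),
    integral_exp_div_eq_besselK0 hm hr, integral_exp_div_eq_besselK0 hM hr]
  ring

/-- Coincidences of two particles fill a proper linear subspace. Hence potentials that may differ at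
the origin give the same partition function. -/
theorem ae_injective (n : ℕ) : ∀ᵐ x : Fin n → Plane, ∀ i j, i ≠ j → x i - x j ≠ 0 := by
  rw [ae_all_iff]
  intro i
  rw [ae_all_iff]
  intro j
  by_cases hij : i = j
  · simp [hij]
  let L : (Fin n → Plane) →ₗ[ℝ] Plane :=
    (LinearMap.proj i : (Fin n → Plane) →ₗ[ℝ] Plane) - LinearMap.proj j
  have hL : LinearMap.ker L ≠ ⊤ := by
    intro h
    rw [LinearMap.ker_eq_top] at h
    have h1 := LinearMap.congr_fun h (Pi.single i (EuclideanSpace.single 0 1))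
    simp [L, Ne.symm hij] at h1
  have h0 := Measure.addHaar_submodule volume (LinearMap.ker L) hL
  filter_upwards [measure_eq_zero_iff_ae_notMem.1 h0] with x hx _ h
  exact hx (by simpa [L] using h)

theorem energy_congr {v v' : Plane → ℝ} {n : ℕ} (σ : Fin n → ℤˣ) {x : Fin n → Plane}
    (h : ∀ i j, i ≠ j → v (x i - x j) = v' (x i - x j)) : energy v σ x = energy v' σ x := by
  unfold energy
  refine Finset.sum_congr rfl fun i _ => Finset.sum_congr rfl fun j hj => ?_
  rw [h i j (Finset.mem_Ioi.1 hj).ne]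

theorem partitionSeries_congr {v v' : Plane → ℝ} (h : ∀ x, x ≠ 0 → v x = v' x) (X : Set Plane) :
    partitionSeries v X = partitionSeries v' X := by
  unfold partitionSeries
  congr 1
  ext n
  congr 1
  refine integral_congr_ae (ae_restrict_of_ae ?_)
  filter_upwards [ae_injective n] with x hx
  simp only [energy_congr _ fun i j hij => h _ (hx i j hij)]

theorem densitySeries_cutoffPotential (β : ℝ) {κ : ℝ → ℝ} (hκ : IsScaleFunction κ) {t₀ : ℝ}
    (ht₀ : t₀ ≤ 0) (X : Set Plane) :
    densitySeries (cutoffPotential β κ t₀) X = densitySeries (flowPotential β (κ t₀) 1) X := by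
  unfold densitySeries pressureSeries
  rw [partitionSeries_congr (v' := flowPotential β (κ t₀) 1)]
  intro x hx
  have h1 : 1 ≤ κ t₀ := hκ.map_zero ▸ hκ.antitoneOn ht₀ (Set.mem_Iic.2 le_rfl) ht₀
  rw [cutoffPotential, hκ.map_zero, flowPotential_eq_covariance_sub β one_pos h1 hx]

end Potential

/-! ### Counting labelled trees. -/

section Trees

/-- This is the `N`-th finite difference at `0` of a monomial of degree less than `N`. -/
theorem sum_neg_one_pow_mul_choose_mul_pow {N k : ℕ} (hk : k < N) :
    ∑ j ∈ Finset.range (N + 1), (-1 : ℝ) ^ j * N.choose j * ((N - j : ℕ) : ℝ) ^ k = 0 := by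
  have h := congrFun (fwdDiff_iter_pow_eq_zero_of_lt (R := ℝ) hk) 0
  rw [fwdDiff_iter_eq_sum_shift, ← Finset.sum_range_reflect] at h
  rw [Pi.zero_apply] at h
  rw [← h]
  refine Finset.sum_congr rfl fun j hj => ?_
  have hj' : j ≤ N := Nat.lt_succ_iff.1 (Finset.mem_range.1 hj)
  have h1 : N + 1 - 1 - j = N - j := by omega
  rw [h1, Nat.choose_symm hj', Nat.sub_sub_self hj']
  simp

/-- A form of Abel's binomial identity. -/
theorem abel_identity (N : ℕ) (x : ℝ) :
    ∑ j ∈ Finset.range N, (N.choose j : ℝ) * (x + j) ^ j * ((N - j : ℕ) : ℝ) ^ (N - j - 1) =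
      N * (x + N) ^ (N - 1) := by
  induction N generalizing x with
  | zero => simp
  | succ N ih =>
  rcases Nat.eq_zero_or_pos N with rfl | hN
  · simp
  set P : ℝ → ℝ := fun x => ∑ j ∈ Finset.range (N + 1), ((N + 1).choose j : ℝ) * (x + j) ^ j *
    ((N + 1 - j : ℕ) : ℝ) ^ (N + 1 - j - 1) with hP
  set Q : ℝ → ℝ := fun x => (N + 1 : ℕ) * (x + (N + 1 : ℕ)) ^ N with hQ
  have hQ' : ∀ x, HasDerivAt Q ((N + 1 : ℕ) * (N * (x + (N + 1 : ℕ)) ^ (N - 1))) x := fun x => by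
    have := (((hasDerivAt_id x).add_const ((N + 1 : ℕ) : ℝ)).pow N).const_mul ((N + 1 : ℕ) : ℝ)
    simpa [hQ] using this
  have hP' : ∀ x, HasDerivAt P ((N + 1 : ℕ) * (N * (x + (N + 1 : ℕ)) ^ (N - 1))) x := fun x => by
    have h1 : HasDerivAt P (∑ j ∈ Finset.range (N + 1), ((N + 1).choose j : ℝ) *
        (j * (x + j) ^ (j - 1)) * ((N + 1 - j : ℕ) : ℝ) ^ (N + 1 - j - 1)) x := by
      refine HasDerivAt.fun_sum fun j _ => ?_
      have := ((((hasDerivAt_id x).add_const (j : ℝ)).pow j).const_mul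
        ((N + 1).choose j : ℝ)).mul_const (((N + 1 - j : ℕ) : ℝ) ^ (N + 1 - j - 1))
      simpa using this
    refine h1.congr_deriv ?_
    have h2 := ih (x + 1)
    have h3 : x + 1 + (N : ℝ) = x + (N + 1 : ℕ) := by push_cast; ring
    rw [h3] at h2
    rw [← h2, Finset.sum_range_succ', Finset.mul_sum]
    simp only [Nat.cast_zero, zero_mul, mul_zero, add_zero]
    refine Finset.sum_congr rfl fun j hj => ?_
    have h4 : ((N + 1).choose (j + 1) : ℝ) * (j + 1 : ℕ) = (N + 1 : ℕ) * N.choose j := by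
      exact_mod_cast (Nat.add_one_mul_choose_eq N j).symm
    have h5 : N + 1 - (j + 1) = N - j := by omega
    have h6 : x + ((j + 1 : ℕ) : ℝ) = x + 1 + j := by push_cast; ring
    rw [h5, Nat.add_sub_cancel, h6, ← mul_assoc, h4]
    ring
  -- Both sides have the same derivative, by the induction hypothesis at `x + 1`, so it is enough to
  -- compare them at one point.
  have hd : ∀ x, HasDerivAt (fun y => P y - Q y) 0 x := fun x => by
    exact ((hP' x).sub (hQ' x)).congr_deriv (sub_self _)
  have hconst := is_const_of_deriv_eq_zero (fun x => (hd x).differentiableAt)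
    fun x => (hd x).deriv
  -- At `x = -(N + 1)` the right side vanishes, and on the left the powers of `x + j` and `N + 1 -
  -- j` combine into `(-1)^j (N + 1 - j)^N`, a vanishing finite difference.
  have h0 : P (-(N + 1 : ℕ)) - Q (-(N + 1 : ℕ)) = 0 := by
    have hQ0 : Q (-(N + 1 : ℕ)) = 0 := by
      simp only [hQ, neg_add_cancel]
      rw [zero_pow hN.ne', mul_zero]
    rw [hQ0, sub_zero]
    have h1 := sum_neg_one_pow_mul_choose_mul_pow (Nat.lt_succ_self N)
    rw [Finset.sum_range_succ, Nat.sub_self, Nat.cast_zero, zero_pow hN.ne', mul_zero,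
      add_zero] at h1
    rw [← h1]
    refine Finset.sum_congr rfl fun j hj => ?_
    have hj' : j < N + 1 := Finset.mem_range.1 hj
    have h2 : (-((N + 1 : ℕ) : ℝ) + j) = -1 * ((N + 1 - j : ℕ) : ℝ) := by
      rw [Nat.cast_sub hj'.le]; ring
    have h3 : N = j + (N + 1 - j - 1) := by omega
    rw [h2, mul_pow]
    nth_rewrite 7 [h3]
    rw [pow_add]
    ring
  have := hconst x (-(N + 1 : ℕ))
  rw [h0, sub_eq_zero] at this
  exact this

theorem sum_powerset_mem_card {ι : Type*} [DecidableEq ι] {I : Finset ι} {i : ι} (hi : i ∈ I)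
    {N : ℕ} (hN : I.card = N + 1) (f : ℕ → ℝ) :
    ∑ Y ∈ I.powerset with i ∈ Y, f Y.card =
      ∑ j ∈ Finset.range (N + 1), (N.choose j : ℝ) * f (j + 1) := by
  have h1 : (I.erase i).card = N := by rw [Finset.card_erase_of_mem hi, hN, Nat.add_sub_cancel]
  have h2 := Finset.sum_powerset_apply_card (fun j => f (j + 1)) (x := I.erase i)
  rw [h1] at h2
  simp only [nsmul_eq_mul] at h2
  rw [← h2]
  refine Finset.sum_nbij' (fun Y => Y.erase i) (fun Y => insert i Y) ?_ ?_ ?_ ?_ ?_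
  · intro Y hY
    simp only [Finset.mem_filter, Finset.mem_powerset] at hY ⊢
    exact Finset.erase_subset_erase i hY.1
  · intro Y hY
    simp only [Finset.mem_filter, Finset.mem_powerset] at hY ⊢
    exact ⟨Finset.insert_subset hi (hY.trans (Finset.erase_subset _ _)),
      Finset.mem_insert_self _ _⟩
  · intro Y hY
    simp only [Finset.mem_filter, Finset.mem_powerset] at hY
    exact Finset.insert_erase hY.2
  · intro Y hY
    simp only [Finset.mem_powerset] at hY
    exact Finset.erase_insert fun h => (Finset.mem_erase.1 (hY h)).1 rfl
  · intro Y hY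
    simp only [Finset.mem_filter, Finset.mem_powerset] at hY
    rw [Finset.card_erase_add_one hY.2]

/-- The recursion for the number `n ^ (n - 2)` of labelled trees. -/
theorem sum_powerset_tree {ι : Type*} [DecidableEq ι] {I : Finset ι} {i : ι} (hi : i ∈ I) :
    ∑ Y ∈ I.powerset with i ∈ Y ∧ Y ≠ I, ((Y.card : ℝ) * (Y.card : ℝ) ^ (Y.card - 2)) *
      (((I \ Y).card : ℝ) * ((I \ Y).card : ℝ) ^ ((I \ Y).card - 2)) =
      ((I.card : ℝ) - 1) * (I.card : ℝ) ^ (I.card - 2) := by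
  obtain ⟨N, hN⟩ : ∃ N, I.card = N + 1 :=
    Nat.exists_eq_succ_of_ne_zero (Finset.card_pos.2 ⟨i, hi⟩).ne'
  -- For `k = 1` the exponent `k - 2` truncates to `0`, which still gives the one tree on one
  -- vertex.
  have hk : ∀ k : ℕ, 0 < k → (k : ℝ) * (k : ℝ) ^ (k - 2) = (k : ℝ) ^ (k - 1) := fun k hk => by
    rcases Nat.lt_or_ge k 2 with h | h
    · obtain rfl : k = 1 := by omega
      simp
    · rw [← pow_succ']
      congr 1
      omega
  have h := sum_powerset_mem_card hi hN fun k => if k = N + 1 then 0 else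
    (k : ℝ) ^ (k - 1) * ((N + 1 - k : ℕ) : ℝ) ^ (N + 1 - k - 1)
  rw [sum_powerset_mem_eq_add hi, if_pos hN, zero_add, Finset.sum_range_succ, if_pos rfl, mul_zero,
    add_zero] at h
  have hL : ∑ Y ∈ I.powerset with i ∈ Y ∧ Y ≠ I, ((Y.card : ℝ) * (Y.card : ℝ) ^ (Y.card - 2)) *
      (((I \ Y).card : ℝ) * ((I \ Y).card : ℝ) ^ ((I \ Y).card - 2)) =
      ∑ Y ∈ I.powerset with i ∈ Y ∧ Y ≠ I, (if Y.card = N + 1 then 0 else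
    (Y.card : ℝ) ^ (Y.card - 1) * ((N + 1 - Y.card : ℕ) : ℝ) ^ (N + 1 - Y.card - 1)) := by
    refine Finset.sum_congr rfl fun Y hY => ?_
    simp only [Finset.mem_filter, Finset.mem_powerset] at hY
    have h1 : Y.card < N + 1 := hN ▸ Finset.card_lt_card (hY.1.ssubset_of_ne hY.2.2)
    have h2 : 0 < Y.card := Finset.card_pos.2 ⟨i, hY.2.1⟩
    rw [if_neg h1.ne, Finset.card_sdiff_of_subset hY.1, hN, hk _ h2, hk _ (by omega)]
  rw [hL, h]
  have hab := abel_identity N 1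
  rw [hN]
  calc _ = ∑ j ∈ Finset.range N, (N.choose j : ℝ) * (1 + j) ^ j *
        ((N - j : ℕ) : ℝ) ^ (N - j - 1) := by
        refine Finset.sum_congr rfl fun j hj => ?_
        have hj' := Finset.mem_range.1 hj
        have e : N + 1 - (j + 1) = N - j := by omega
        rw [if_neg (by omega), e, Nat.add_sub_cancel]
        push_cast
        ring
    _ = _ := by
        rw [hab]
        have e : N + 1 - 2 = N - 1 := by omega
        rw [e]
        push_cast
        ring

end Trees

/-! ### The flow of the gas in the mass, and its integrated form. -/

section Flow

variable {ι : Type*} [DecidableEq ι]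

/-- Without interaction nothing is connected. This is the initial condition of the flow, at mass
`M`. -/
theorem ursell_of_eq_one {E : Finset ι → ℝ} (hE : ∀ J, E J = 1) {I : Finset ι}
    (hI : 2 ≤ I.card) : ursell E I = 0 := by
  induction I using Finset.strongInduction with
  | H I ih =>
  obtain ⟨i, hi⟩ : I.Nonempty := Finset.card_pos.1 (by omega)
  rw [ursell_eq_sub (hE ∅) hi, Finset.sum_eq_single {i}]
  · rw [ursell_singleton (hE ∅)]
    simp [hE]
  · intro J hJ hJi
    simp only [Finset.mem_filter, Finset.mem_powerset] at hJ
    have h1 : J.card ≠ 1 := fun h => by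
      obtain ⟨a, rfl⟩ := Finset.card_eq_one.1 h
      exact hJi (by rw [Finset.mem_singleton.1 hJ.2.1])
    have h2 : 0 < J.card := Finset.card_pos.2 ⟨i, hJ.2.1⟩
    rw [ih J (hJ.1.ssubset_of_ne hJ.2.2) (by omega), zero_mul]
  · intro h
    exfalso
    apply h
    simp only [Finset.mem_filter, Finset.mem_powerset, Finset.singleton_subset_iff,
      Finset.mem_singleton, true_and]
    refine ⟨hi, ?_⟩
    rintro rfl
    simp at hI

/-- The pair interaction of particles with charges `s i` at positions `x i`. -/
def pairPotential (v : Plane → ℝ) (s : ι → ℝ) (x : ι → Plane) (i j : ι) : ℝ :=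
  s i * s j * v (x i - x j)

/-- The Ursell function of the gas with pair potential `v`. -/
def gasUrsell (v : Plane → ℝ) (s : ι → ℝ) (x : ι → Plane) (I : Finset ι) : ℝ :=
  ursell (fun J => Real.exp (-pairEnergy (pairPotential v s x) J)) I

omit [DecidableEq ι] in
theorem pairPotential_comm {v : Plane → ℝ} (hv : ∀ x, v (-x) = v x) (s : ι → ℝ) (x : ι → Plane)
    (i j : ι) : pairPotential v s x i j = pairPotential v s x j i := by
  rw [pairPotential, pairPotential, mul_comm (s i), ← hv, neg_sub]

omit [DecidableEq ι] in
theorem crossEnergy_const_mul (c : ℝ) (v : Plane → ℝ) (s : ι → ℝ) (x : ι → Plane)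
    (Y Z : Finset ι) : crossEnergy (pairPotential (fun y => c * v y) s x) Y Z =
      c * crossEnergy (pairPotential v s x) Y Z := by
  simp only [crossEnergy, pairPotential, Finset.mul_sum]
  exact Finset.sum_congr rfl fun _ _ => Finset.sum_congr rfl fun _ _ => by ring

omit [DecidableEq ι] in
theorem pairEnergy_const_mul (c : ℝ) (v : Plane → ℝ) (s : ι → ℝ) (x : ι → Plane)
    (Y : Finset ι) : pairEnergy (pairPotential (fun y => c * v y) s x) Y =
      c * pairEnergy (pairPotential v s x) Y := by
  rw [pairEnergy, crossEnergy_const_mul, pairEnergy]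
  simp only [pairPotential]
  have : ∀ i, s i * s i * (c * v (x i - x i)) = c * (s i * s i * v (x i - x i)) := fun i => by ring
  simp only [this, ← Finset.mul_sum]
  ring

omit [DecidableEq ι] in
theorem hasDerivAt_pairEnergy_flowPotential (β : ℝ) {M m : ℝ} (hM : 0 < M) (hm : 0 < m)
    (s : ι → ℝ) (x : ι → Plane) (I : Finset ι) :
    HasDerivAt (fun μ => pairEnergy (pairPotential (flowPotential β M μ) s x) I)
      (-β * pairEnergy (pairPotential (greenSq m) s x) I) m := by
  rw [← pairEnergy_const_mul]
  have hu : ∀ i j, HasDerivAt (fun μ => pairPotential (flowPotential β M μ) s x i j)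
      (pairPotential (fun y => -β * greenSq m y) s x i j) m := fun i j =>
    ((hasDerivAt_flowPotential β hM hm (x i - x j)).const_mul (s i * s j)).congr_deriv (by
      rw [pairPotential]; ring)
  unfold pairEnergy crossEnergy
  exact ((HasDerivAt.fun_sum fun a _ => HasDerivAt.fun_sum fun b _ => hu a b).sub
    (HasDerivAt.fun_sum fun a _ => hu a a)).div_const 2

theorem hasDerivAt_gasUrsell (β : ℝ) {M m : ℝ} (hM : 0 < M) (hm : 0 < m) (s : ι → ℝ)
    (x : ι → Plane) (I : Finset ι) {i : ι} (hi : i ∈ I) :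
    HasDerivAt (fun μ => gasUrsell (flowPotential β M μ) s x I)
      (β * pairEnergy (pairPotential (greenSq m) s x) I * gasUrsell (flowPotential β M m) s x I +
        β * ∑ Y ∈ I.powerset with i ∈ Y ∧ Y ≠ I,
          crossEnergy (pairPotential (greenSq m) s x) Y (I \ Y) *
          gasUrsell (flowPotential β M m) s x Y *
          gasUrsell (flowPotential β M m) s x (I \ Y)) m := by
  have h := hasDerivAt_ursell (u := fun μ => pairPotential (flowPotential β M μ) s x)
    (u' := pairPotential (fun y => -β * greenSq m y) s x) (t := m)
    (fun i j => ((hasDerivAt_flowPotential β hM hm (x i - x j)).const_mul (s i * s j)).congr_deriv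
      (by rw [pairPotential]; ring))
    (pairPotential_comm (by simp [greenSq_neg]) s x) I hi
  refine h.congr_deriv ?_
  rw [sum_powerset_mem_eq_add hi, Finset.sdiff_self, crossEnergy_empty_right, pairEnergy_const_mul]
  simp only [crossEnergy_const_mul, gasUrsell, Finset.mul_sum]
  rw [zero_mul, zero_mul, zero_add, sub_eq_add_neg, ← Finset.sum_neg_distrib]
  congr 1
  · ring
  · exact Finset.sum_congr rfl fun _ _ => by ring

theorem gasUrsell_flowPotential_self (β M : ℝ) (s : ι → ℝ) (x : ι → Plane) {I : Finset ι}
    (hI : 2 ≤ I.card) : gasUrsell (flowPotential β M M) s x I = 0 := by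
  refine ursell_of_eq_one (fun J => ?_) hI
  simp [pairEnergy, crossEnergy, pairPotential, flowPotential_self]

omit [DecidableEq ι] in
/-- Stability of the interaction between the masses `m` and `μ`. -/
theorem exp_pairEnergy_sub_le {β M m μ : ℝ} (hβ : 0 ≤ β) (hM : 0 < M) (hm : 0 < m) (hmμ : m ≤ μ)
    {s : ι → ℝ} (hs : ∀ i, s i ^ 2 = 1) (x : ι → Plane) (I : Finset ι) :
    Real.exp (pairEnergy (pairPotential (flowPotential β M μ) s x) I -
      pairEnergy (pairPotential (flowPotential β M m) s x) I) ≤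
      (μ / m) ^ (I.card * β / (8 * Real.pi)) := by
  have hμ : 0 < μ := hm.trans_le hmμ
  set c := I.card * β / (8 * Real.pi) with hc
  -- Stability at mass `r` bounds the derivative of the energy by `c / r`, so the energy minus `c
  -- log r` is antitone.
  have hd : ∀ r ∈ Set.Ioi (0 : ℝ), HasDerivAt
      (fun r => pairEnergy (pairPotential (flowPotential β M r) s x) I - c * Real.log r)
      (-β * pairEnergy (pairPotential (greenSq r) s x) I - c * r⁻¹) r := fun r hr =>
    (hasDerivAt_pairEnergy_flowPotential β hM hr s x I).sub
      ((Real.hasDerivAt_log (ne_of_gt hr)).const_mul c)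
  have hanti := antitoneOn_of_deriv_nonpos (convex_Ioi (0 : ℝ))
    (fun r hr => (hd r hr).continuousAt.continuousWithinAt)
    (fun r hr => (hd r (interior_subset hr)).differentiableAt.differentiableWithinAt)
    (fun r hr => by
      have hr' : 0 < r := interior_subset hr
      rw [(hd r hr').deriv]
      have h1 := neg_le_pairEnergy_greenSq s hs x I hr'
      have h2 := mul_le_mul_of_nonneg_left h1 hβ
      have h3 : c * r⁻¹ = β * (I.card / (8 * Real.pi * r)) := by rw [hc]; field_simp
      rw [h3]
      unfold pairPotential
      linarith)
  have h := hanti (Set.mem_Ioi.2 hm) (Set.mem_Ioi.2 hμ) hmμ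
  rw [Real.rpow_def_of_pos (by positivity), Real.exp_le_exp, Real.log_div hμ.ne' hm.ne']
  linarith

/-- The integrated flow equation with the stability bound. -/
theorem enorm_gasUrsell_le {β M m : ℝ} (hβ : 0 ≤ β) (hm : 0 < m) (hmM : m ≤ M)
    {s : ι → ℝ} (hs : ∀ i, s i ^ 2 = 1) (x : ι → Plane) {I : Finset ι} (hI : 2 ≤ I.card)
    {i : ι} (hi : i ∈ I) :
    ‖gasUrsell (flowPotential β M m) s x I‖ₑ ≤ ∫⁻ μ in Set.Ioc m M,
      ENNReal.ofReal (β * (μ / m) ^ (I.card * β / (8 * Real.pi))) *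
        ∑ Y ∈ I.powerset with i ∈ Y ∧ Y ≠ I,
          ‖crossEnergy (pairPotential (greenSq μ) s x) Y (I \ Y)‖ₑ *
          (‖gasUrsell (flowPotential β M μ) s x Y‖ₑ *
          ‖gasUrsell (flowPotential β M μ) s x (I \ Y)‖ₑ) := by
  have hM : 0 < M := hm.trans_le hmM
  set φ : ℝ → Finset ι → ℝ := fun μ => gasUrsell (flowPotential β M μ) s x with hφ
  set U : ℝ → ℝ := fun μ => pairEnergy (pairPotential (flowPotential β M μ) s x) I with hU
  set S : ℝ → ℝ := fun μ => ∑ Y ∈ I.powerset with i ∈ Y ∧ Y ≠ I,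
    crossEnergy (pairPotential (greenSq μ) s x) Y (I \ Y) * φ μ Y * φ μ (I \ Y) with hS
  have hUd : ∀ μ, 0 < μ → HasDerivAt U _ μ := fun μ hμ =>
    hasDerivAt_pairEnergy_flowPotential β hM hμ s x I
  -- The exponential is an integrating factor: its derivative cancels the term of the flow equation
  -- linear in `φ μ I`. It equals `1` at `μ = m`, while `φ` vanishes at `μ = M`.
  have hd : ∀ μ ∈ Set.uIcc m M, HasDerivAt (fun μ => φ μ I * Real.exp (U μ - U m))
      (β * S μ * Real.exp (U μ - U m)) μ := fun μ hμ => by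
    rw [Set.uIcc_of_le hmM] at hμ
    have hμ0 : 0 < μ := hm.trans_le hμ.1
    have h1 := hasDerivAt_gasUrsell β hM hμ0 s x I hi
    refine (h1.mul ((hUd μ hμ0).sub_const (U m)).exp).congr_deriv ?_
    simp only [hS, hφ]
    ring
  have hcont : ContinuousOn (fun μ => β * S μ * Real.exp (U μ - U m)) (Set.uIcc m M) := by
    rw [Set.uIcc_of_le hmM]
    have hUc : ContinuousOn U (Set.Icc m M) := fun μ hμ =>
      (hUd μ (hm.trans_le hμ.1)).continuousAt.continuousWithinAt
    refine (continuousOn_const.mul (continuousOn_finsetSum _ fun Y hY => ?_)).mul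
      ((hUc.sub continuousOn_const).rexp)
    simp only [Finset.mem_filter, Finset.mem_powerset] at hY
    have hφc : ∀ (J : Finset ι), ContinuousOn (fun μ => φ μ J) (Set.Icc m M) := fun J μ hμ => by
      rcases J.eq_empty_or_nonempty with rfl | ⟨j, hj⟩
      · simp only [hφ, gasUrsell, ursell_empty]
        exact continuousWithinAt_const
      · exact (hasDerivAt_gasUrsell β hM (hm.trans_le hμ.1) s x J hj).continuousAt.continuousWithinAt
    refine (ContinuousOn.mul ?_ (hφc _)).mul (hφc _)
    unfold crossEnergy pairPotential
    exact continuousOn_finsetSum _ fun a _ => continuousOn_finsetSum _ fun b _ =>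
      continuousOn_const.mul ((continuousOn_greenSq _).mono fun μ hμ => hm.trans_le hμ.1)
  have hftc := intervalIntegral.integral_eq_sub_of_hasDerivAt hd hcont.intervalIntegrable
  have hφM : φ M I = 0 := gasUrsell_flowPotential_self β M s x hI
  rw [hφM, zero_mul, sub_self, Real.exp_zero, mul_one, zero_sub,
    intervalIntegral.integral_of_le hmM] at hftc
  change ‖φ m I‖ₑ ≤ _
  rw [← enorm_neg, ← hftc]
  refine (enorm_integral_le_lintegral_enorm _).trans (setLIntegral_mono' measurableSet_Ioc ?_)
  intro μ hμ
  rw [mul_right_comm, enorm_mul, Real.enorm_eq_ofReal (mul_nonneg hβ (Real.exp_pos _).le)]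
  gcongr
  · exact exp_pairEnergy_sub_le hβ hM hm hμ.1.le hs x I
  · refine (enorm_sum_le _ _).trans (Finset.sum_le_sum fun Y _ => ?_)
    rw [enorm_mul, enorm_mul, mul_assoc]

end Flow

/-! ### Integration over positions and decoupling of two interacting clusters. -/

section Marginals

variable {ι : Type*} [DecidableEq ι]

/-- The integral of `f` over the positions of the particles in `S`. -/
abbrev marginal (S : Finset ι) (f : (ι → Plane) → ENNReal) : (ι → Plane) → ENNReal :=
  lmarginal (fun _ => (volume : Measure Plane)) S f

theorem marginal_lintegral {α : Type*} [MeasurableSpace α] {ν : Measure α} [SFinite ν]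
    {f : (ι → Plane) → α → ENNReal} (hf : Measurable (Function.uncurry f)) (S : Finset ι)
    (x : ι → Plane) :
    marginal S (fun x => ∫⁻ a, f x a ∂ν) x = ∫⁻ a, marginal S (fun x => f x a) x ∂ν := by
  unfold marginal lmarginal
  refine lintegral_lintegral_swap (Measurable.aemeasurable ?_)
  exact hf.comp ((measurable_updateFinset.comp measurable_fst).prodMk measurable_snd)

theorem measurable_marginal_right {α : Type*} [MeasurableSpace α]
    {f : (ι → Plane) → α → ENNReal} (hf : Measurable (Function.uncurry f)) (S : Finset ι)
    (x : ι → Plane) : Measurable fun a => marginal S (fun x => f x a) x := by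
  unfold marginal lmarginal
  have h : Measurable fun p : α × (S → Plane) =>
      Function.uncurry f (Function.updateFinset x S p.2, p.1) :=
    hf.comp ((measurable_updateFinset.comp measurable_snd).prodMk measurable_fst)
  exact h.lintegral_prod_right'

theorem marginal_finset_sum {α : Type*} {f : α → (ι → Plane) → ENNReal}
    (hf : ∀ a, Measurable (f a)) (A : Finset α) (S : Finset ι) (x : ι → Plane) :
    marginal S (fun x => ∑ a ∈ A, f a x) x = ∑ a ∈ A, marginal S (f a) x := by
  unfold marginal lmarginal
  exact lintegral_finsetSum _ fun a _ => (hf a).comp measurable_updateFinset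

theorem marginal_const_mul (c : ENNReal) {f : (ι → Plane) → ENNReal} (hf : Measurable f)
    (S : Finset ι) (x : ι → Plane) :
    marginal S (fun x => c * f x) x = c * marginal S f x := by
  unfold marginal lmarginal
  exact lintegral_const_mul _ (hf.comp measurable_updateFinset)

theorem marginal_mul_const (c : ENNReal) {f : (ι → Plane) → ENNReal} (hf : Measurable f)
    (S : Finset ι) (x : ι → Plane) :
    marginal S (fun x => f x * c) x = marginal S f x * c := by
  unfold marginal lmarginal
  exact lintegral_mul_const _ (hf.comp measurable_updateFinset)

/-- A function that only depends on the positions of the particles in `Y`. -/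
def DependsOnCluster {α : Type*} (f : (ι → Plane) → α) (Y : Finset ι) : Prop :=
  ∀ x x', (∀ i ∈ Y, x i = x' i) → f x = f x'

omit [DecidableEq ι] in
theorem DependsOnCluster.mul {f g : (ι → Plane) → ENNReal} {Y : Finset ι}
    (hf : DependsOnCluster f Y) (hg : DependsOnCluster g Y) :
    DependsOnCluster (fun x => f x * g x) Y := fun x x' h => by
  simp only [hf x x' h, hg x x' h]

/-- The positions in `Z` are integrated first, since `f` does not see them; the bound on the inner
integral is uniform in the other positions and factors out. -/
theorem marginal_union_mul_le {S Y Z : Finset ι} (hSZ : Disjoint S Z) (hYZ : Disjoint Y Z)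
    {f g : (ι → Plane) → ENNReal} (hf : Measurable f) (hg : Measurable g)
    (hfY : DependsOnCluster f Y) {c : ENNReal} (hc : ∀ x, marginal Z g x ≤ c) (x : ι → Plane) :
    marginal (S ∪ Z) (fun x => f x * g x) x ≤ marginal S f x * c := by
  unfold marginal
  rw [lmarginal_union _ (fun x => f x * g x) (hf.mul hg) hSZ]
  change _ ≤ marginal S f x * c
  rw [← marginal_mul_const c hf]
  refine lmarginal_mono (fun x => ?_) x
  calc marginal Z (fun x => f x * g x) x = f x * marginal Z g x := by
        unfold marginal lmarginal
        refine (lintegral_congr fun y => ?_).trans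
          (lintegral_const_mul (f x) (hg.comp measurable_updateFinset))
        change f _ * g _ = f _ * g _
        congr 1
        refine hfY _ _ fun i hi => ?_
        rw [Function.updateFinset, dif_neg (Finset.disjoint_left.1 hYZ hi)]
    _ ≤ f x * c := by gcongr; exact hc x

theorem dependsOnCluster_gasUrsell (v : Plane → ℝ) (s : ι → ℝ) (Y : Finset ι) :
    DependsOnCluster (fun x => ‖gasUrsell v s x Y‖ₑ) Y := fun x x' h => by
  simp only [gasUrsell]
  congr 1
  refine ursell_congr fun J hJ => ?_
  congr 2
  unfold pairEnergy crossEnergy pairPotential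
  congr 1
  congr 1
  · exact Finset.sum_congr rfl fun a ha => Finset.sum_congr rfl fun b hb => by
      rw [h a (hJ ha), h b (hJ hb)]
  · exact Finset.sum_congr rfl fun a ha => by rw [h a (hJ ha)]

omit [DecidableEq ι] in
theorem dependsOnCluster_smearedCharge (s : ι → ℝ) (Y : Finset ι) (t : ℝ) (w : Plane) :
    DependsOnCluster (fun x => ‖smearedCharge s x Y t w‖ₑ) Y := fun x x' h => by
  unfold smearedCharge
  beta_reduce
  congr 1
  exact Finset.sum_congr rfl fun a ha => by rw [h a ha]

theorem measurable_gasUrsell (β M : ℝ) (s : ι → ℝ) (I : Finset ι) :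
    Measurable fun p : (ι → Plane) × ℝ => gasUrsell (flowPotential β M p.2) s p.1 I := by
  refine measurable_ursell (fun J => ?_) I
  refine (Measurable.neg ?_).exp
  have hV : ∀ i j, Measurable fun p : (ι → Plane) × ℝ =>
      pairPotential (flowPotential β M p.2) s p.1 i j := fun i j => by
    refine Measurable.const_mul ?_ _
    exact (measurable_flowPotential β M).comp (f := fun p : (ι → Plane) × ℝ =>
      (p.2, p.1 i - p.1 j)) (by fun_prop)
  unfold pairEnergy crossEnergy
  exact ((Finset.measurable_sum _ fun i _ => Finset.measurable_sum _ fun j _ => hV i j).sub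
    (Finset.measurable_sum _ fun i _ => hV i i)).div_const 2

theorem measurable_gasUrsell_right (β M μ : ℝ) (s : ι → ℝ) (I : Finset ι) :
    Measurable fun x : ι → Plane => gasUrsell (flowPotential β M μ) s x I :=
  (measurable_gasUrsell β M s I).comp (f := fun x : ι → Plane => (x, μ)) (by fun_prop)

omit [DecidableEq ι] in
theorem measurable_smearedCharge (s : ι → ℝ) (Y : Finset ι) :
    Measurable fun p : ((ι → Plane) × ℝ) × Plane => smearedCharge s p.1.1 Y p.1.2 p.2 := by
  unfold smearedCharge
  refine Finset.measurable_sum _ fun y _ => Measurable.const_mul ?_ _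
  exact measurable_heatKernel.comp (f := fun p : ((ι → Plane) × ℝ) × Plane =>
    (p.1.2, p.1.1 y - p.2)) (by fun_prop)

omit [DecidableEq ι] in
theorem measurable_crossEnergy_greenSq (s : ι → ℝ) (Y Z : Finset ι) :
    Measurable fun p : (ι → Plane) × ℝ => crossEnergy (pairPotential (greenSq p.2) s p.1) Y Z := by
  unfold crossEnergy pairPotential
  refine Finset.measurable_sum _ fun y _ => Finset.measurable_sum _ fun z _ =>
    Measurable.const_mul ?_ _
  exact measurable_greenSq.comp (f := fun p : (ι → Plane) × ℝ =>
    (p.2, p.1 y - p.1 z)) (by fun_prop)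

/-- The estimate of the joint integral of two interacting clusters by the product of integrals of
the clusters against their smeared charges. -/
theorem marginal_crossEnergy_mul_le {μ : ℝ} (hμ : 0 < μ) (s : ι → ℝ) {Y Z : Finset ι}
    (hYZ : Disjoint Y Z) {i : ι} (hi : i ∈ Y) {F G : (ι → Plane) → ENNReal} (hF : Measurable F)
    (hG : Measurable G) (hFY : DependsOnCluster F Y) {bY bZ : ℝ → ENNReal}
    (ha : ∀ t, 0 < t → ∀ x, ∫⁻ w, marginal (Y.erase i)
      (fun x => F x * ‖smearedCharge s x Y t w‖ₑ) x ≤ bY t)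
    (hb : ∀ t, 0 < t → ∀ w x, marginal Z (fun x => G x * ‖smearedCharge s x Z t w‖ₑ) x ≤ bZ t)
    (x : ι → Plane) :
    marginal ((Y ∪ Z).erase i) (fun x =>
      ‖crossEnergy (pairPotential (greenSq μ) s x) Y Z‖ₑ * (F x * G x)) x ≤
      ∫⁻ t in Set.Ioi (0 : ℝ), ENNReal.ofReal (t * Real.exp (-μ * t)) * (bY t * bZ t) := by
  have hiZ : i ∉ Z := Finset.disjoint_left.1 hYZ hi
  have hset : (Y ∪ Z).erase i = Y.erase i ∪ Z := by
    rw [Finset.erase_union_distrib, Finset.erase_eq_of_notMem hiZ]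
  have hA : ∀ W : Finset ι, Measurable fun p : ((ι → Plane) × ℝ) × Plane =>
      ‖smearedCharge s p.1.1 W p.1.2 p.2‖ₑ := fun W => (measurable_smearedCharge s W).enorm
  have hA' : ∀ (W : Finset ι) t w, Measurable fun x : ι → Plane => ‖smearedCharge s x W t w‖ₑ :=
    fun W t w => (hA W).comp (f := fun x : ι → Plane => ((x, t), w)) (by fun_prop)
  set H : (ι → Plane) → ℝ → Plane → ENNReal := fun x t w =>
    ENNReal.ofReal (t * Real.exp (-μ * t)) *
      ((F x * ‖smearedCharge s x Y t w‖ₑ) * (G x * ‖smearedCharge s x Z t w‖ₑ)) with hH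
  have hHm : Measurable fun p : ((ι → Plane) × ℝ) × Plane => H p.1.1 p.1.2 p.2 := by
    refine Measurable.mul (by fun_prop) (Measurable.mul (Measurable.mul ?_ (hA Y))
      (Measurable.mul ?_ (hA Z)))
    · exact hF.comp (measurable_fst.comp measurable_fst)
    · exact hG.comp (measurable_fst.comp measurable_fst)
  have hle : ∀ x, ‖crossEnergy (pairPotential (greenSq μ) s x) Y Z‖ₑ * (F x * G x) ≤
      ∫⁻ t in Set.Ioi (0 : ℝ), ∫⁻ w, H x t w := fun x => by
    calc _ ≤ (∫⁻ t in Set.Ioi (0 : ℝ), ENNReal.ofReal (t * Real.exp (-μ * t)) *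
          ∫⁻ w, ‖smearedCharge s x Y t w‖ₑ * ‖smearedCharge s x Z t w‖ₑ) * (F x * G x) := by
          gcongr
          exact enorm_crossEnergy_greenSq_le s x Y Z hμ
      _ = _ := by
          have hAx : ∀ W : Finset ι, Measurable fun p : ℝ × Plane =>
              ‖smearedCharge s x W p.1 p.2‖ₑ := fun W =>
            (hA W).comp (f := fun p : ℝ × Plane => ((x, p.1), p.2)) (by fun_prop)
          rw [← lintegral_mul_const]
          · refine lintegral_congr fun t => ?_
            have hAxt : ∀ W : Finset ι, Measurable fun w : Plane =>
                ‖smearedCharge s x W t w‖ₑ := fun W =>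
              (hAx W).comp (f := fun w : Plane => (t, w)) (by fun_prop)
            have hAA : Measurable fun w : Plane =>
                ‖smearedCharge s x Y t w‖ₑ * ‖smearedCharge s x Z t w‖ₑ := (hAxt Y).mul (hAxt Z)
            rw [← lintegral_const_mul _ hAA, ← lintegral_mul_const _ (hAA.const_mul _)]
            refine lintegral_congr fun w => ?_
            simp only [hH]
            ring
          · have hint : Measurable fun t : ℝ =>
                ∫⁻ w, ‖smearedCharge s x Y t w‖ₑ * ‖smearedCharge s x Z t w‖ₑ :=
              Measurable.lintegral_prod_right' (f := fun p : ℝ × Plane =>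
                ‖smearedCharge s x Y p.1 p.2‖ₑ * ‖smearedCharge s x Z p.1 p.2‖ₑ)
                ((hAx Y).mul (hAx Z))
            exact Measurable.mul (by fun_prop) hint
  calc _ ≤ marginal ((Y ∪ Z).erase i) (fun x => ∫⁻ t in Set.Ioi (0 : ℝ), ∫⁻ w, H x t w) x :=
        lmarginal_mono hle x
    _ = ∫⁻ t in Set.Ioi (0 : ℝ), ∫⁻ w, marginal ((Y ∪ Z).erase i) (fun x => H x t w) x := by
        have hHt : Measurable fun p : (ι → Plane) × ℝ => ∫⁻ w, H p.1 p.2 w :=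
          Measurable.lintegral_prod_right' (f := fun p : ((ι → Plane) × ℝ) × Plane =>
            H p.1.1 p.1.2 p.2) hHm
        rw [marginal_lintegral (f := fun x t => ∫⁻ w, H x t w) hHt]
        refine lintegral_congr fun t => ?_
        exact marginal_lintegral (f := fun x w => H x t w)
          (hHm.comp (f := fun p : (ι → Plane) × Plane => ((p.1, t), p.2)) (by fun_prop)) _ _
    _ ≤ _ := by
        refine setLIntegral_mono' measurableSet_Ioi fun t ht => ?_
        have hFA : ∀ w, Measurable fun x => F x * ‖smearedCharge s x Y t w‖ₑ := fun w =>
          hF.mul (hA' Y t w)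
        have hGA : ∀ w, Measurable fun x => G x * ‖smearedCharge s x Z t w‖ₑ := fun w =>
          hG.mul (hA' Z t w)
        -- At fixed `t` and `w` the clusters decouple. All of `Z` is integrated with `w` fixed;
        -- afterwards `w` is integrated together with `Y`, whose root `i` stays fixed.
        have h1 : ∀ w, marginal ((Y ∪ Z).erase i) (fun x => H x t w) x ≤
            ENNReal.ofReal (t * Real.exp (-μ * t)) * (marginal (Y.erase i)
              (fun x => F x * ‖smearedCharge s x Y t w‖ₑ) x * bZ t) := fun w => by
          simp only [hH]
          rw [marginal_const_mul _ (f := fun x => F x * ‖smearedCharge s x Y t w‖ₑ *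
            (G x * ‖smearedCharge s x Z t w‖ₑ)) ((hFA w).mul (hGA w)), hset]
          gcongr
          exact marginal_union_mul_le (hYZ.mono_left (Finset.erase_subset _ _)) hYZ (hFA w) (hGA w)
            (hFY.mul (dependsOnCluster_smearedCharge s Y t w)) (hb t ht w) x
        have hm : Measurable fun w => marginal (Y.erase i)
            (fun x => F x * ‖smearedCharge s x Y t w‖ₑ) x := by
          refine measurable_marginal_right (f := fun x w => F x * ‖smearedCharge s x Y t w‖ₑ)
            (Measurable.mul (hF.comp measurable_fst) ?_) _ _
          exact (hA Y).comp (f := fun p : (ι → Plane) × Plane => ((p.1, t), p.2)) (by fun_prop)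
        refine (lintegral_mono h1).trans ?_
        rw [lintegral_const_mul _ (hm.mul_const _), lintegral_mul_const _ hm]
        gcongr
        exact ha t ht x

/-! ### Bounds on a smeared charge without cancellation. -/

section SingleCluster

omit [DecidableEq ι] in
theorem enorm_smearedCharge_le {s : ι → ℝ} (hs : ∀ i, s i ^ 2 = 1) (x : ι → Plane) (Y : Finset ι)
    (t : ℝ) (w : Plane) :
    ‖smearedCharge s x Y t w‖ₑ ≤ ∑ y ∈ Y, ‖heatKernel t (x y - w)‖ₑ := by
  unfold smearedCharge
  refine (enorm_sum_le _ _).trans (Finset.sum_le_sum fun y _ => ?_)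
  rw [enorm_mul]
  have h : |s y| = 1 := by rw [← Real.sqrt_sq_eq_abs, hs, Real.sqrt_one]
  rw [← ofReal_norm, Real.norm_eq_abs, h, ENNReal.ofReal_one, one_mul]

theorem lintegral_heatKernel_sub {t : ℝ} (ht : 0 < t) (x : Plane) :
    ∫⁻ w, ‖heatKernel t (x - w)‖ₑ = 1 := by
  rw [lintegral_sub_left_eq_self (fun w => ‖heatKernel t w‖ₑ), lintegral_heatKernel ht]

theorem lintegral_heatKernel_sub_right {t : ℝ} (ht : 0 < t) (w : Plane) :
    ∫⁻ x, ‖heatKernel t (x - w)‖ₑ = 1 := by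
  rw [lintegral_sub_right_eq_self (fun w => ‖heatKernel t w‖ₑ), lintegral_heatKernel ht]

omit [DecidableEq ι] in
theorem measurable_heatKernel_sub (t : ℝ) (i : ι) :
    Measurable fun p : (ι → Plane) × Plane => ‖heatKernel t (p.1 i - p.2)‖ₑ :=
  (measurable_heatKernel.comp (f := fun p : (ι → Plane) × Plane => (t, p.1 i - p.2))
    (by fun_prop)).enorm

/-- The root is fixed and `w` is free: integrating over `w` first, every heat kernel contributes
`1`. -/
theorem lintegral_marginal_smearedCharge_le {s : ι → ℝ} (hs : ∀ i, s i ^ 2 = 1) {Y : Finset ι}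
    {i : ι} {F : (ι → Plane) → ENNReal} (hF : Measurable F) {N : ENNReal}
    (hN : ∀ x, marginal (Y.erase i) F x ≤ N) {t : ℝ} (ht : 0 < t) (x : ι → Plane) :
    ∫⁻ w, marginal (Y.erase i) (fun x => F x * ‖smearedCharge s x Y t w‖ₑ) x ≤ Y.card * N := by
  have hA : Measurable fun p : (ι → Plane) × Plane => ‖smearedCharge s p.1 Y t p.2‖ₑ :=
    ((measurable_smearedCharge s Y).comp (f := fun p : (ι → Plane) × Plane => ((p.1, t), p.2))
      (by fun_prop)).enorm
  rw [← marginal_lintegral (f := fun x w => F x * ‖smearedCharge s x Y t w‖ₑ)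
    ((hF.comp measurable_fst).mul hA)]
  calc _ ≤ marginal (Y.erase i) (fun x => F x * Y.card) x := by
        refine lmarginal_mono (fun x => ?_) x
        beta_reduce
        have hAx : Measurable fun w => ‖smearedCharge s x Y t w‖ₑ :=
          hA.comp (f := fun w : Plane => (x, w)) (by fun_prop)
        rw [lintegral_const_mul _ hAx]
        gcongr
        refine (lintegral_mono fun w => enorm_smearedCharge_le hs x Y t w).trans ?_
        have hqx : ∀ y, Measurable fun w => ‖heatKernel t (x y - w)‖ₑ := fun y =>
          (measurable_heatKernel_sub t y).comp (f := fun w : Plane => (x, w)) (by fun_prop)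
        rw [lintegral_finsetSum _ fun y _ => hqx y]
        simp [lintegral_heatKernel_sub ht]
    _ = marginal (Y.erase i) F x * Y.card := marginal_mul_const _ hF _ _
    _ ≤ _ := by
        rw [mul_comm]
        gcongr
        exact hN x

/-- Here `w` is fixed and no particle is. In the term of the particle `z`, the others are integrated
with `z` as root, and then the heat kernel is integrated over the position of `z`. -/
theorem marginal_smearedCharge_le {s : ι → ℝ} (hs : ∀ i, s i ^ 2 = 1) {Z : Finset ι}
    {F : (ι → Plane) → ENNReal} (hF : Measurable F) {N : ENNReal}
    (hN : ∀ z ∈ Z, ∀ x, marginal (Z.erase z) F x ≤ N) {t : ℝ} (ht : 0 < t) (w : Plane)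
    (x : ι → Plane) :
    marginal Z (fun x => F x * ‖smearedCharge s x Z t w‖ₑ) x ≤ Z.card * N := by
  have hq : ∀ z, Measurable fun x : ι → Plane => ‖heatKernel t (x z - w)‖ₑ := fun z =>
    (measurable_heatKernel_sub t z).comp (f := fun x : ι → Plane => (x, w)) (by fun_prop)
  calc _ ≤ marginal Z (fun x => ∑ z ∈ Z, ‖heatKernel t (x z - w)‖ₑ * F x) x := by
        refine lmarginal_mono (fun x => ?_) x
        beta_reduce
        rw [← Finset.sum_mul, mul_comm]
        gcongr
        exact enorm_smearedCharge_le hs x Z t w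
    _ = ∑ z ∈ Z, marginal Z (fun x => ‖heatKernel t (x z - w)‖ₑ * F x) x :=
        marginal_finset_sum (fun z => (hq z).mul hF) _ _ _
    _ ≤ ∑ z ∈ Z, N := by
        refine Finset.sum_le_sum fun z hz => ?_
        have hset : Z = {z} ∪ Z.erase z := by
          rw [← Finset.insert_eq, Finset.insert_erase hz]
        have hdis : Disjoint {z} (Z.erase z) := by simp
        have hdep : DependsOnCluster (fun x : ι → Plane => ‖heatKernel t (x z - w)‖ₑ) {z} :=
          fun x x' h => by simp only [h z (Finset.mem_singleton_self z)]
        have h1 := marginal_union_mul_le hdis hdis (hq z) hF hdep (hN z hz) x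
        rw [← hset] at h1
        refine h1.trans_eq ?_
        unfold marginal
        rw [lmarginal_singleton]
        simp [lintegral_heatKernel_sub_right ht]
    _ = _ := by simp

end SingleCluster

/-! ### Bounds on a smeared pair, keeping the cancellation of opposite charges. -/

section Pair

variable {Ψ D : Plane → ENNReal} {t : ℝ} {s : ι → ℝ}

omit [DecidableEq ι] in
theorem enorm_smearedCharge_pair [DecidableEq ι] (hs : ∀ i, s i ^ 2 = 1) {j k : ι} (hjk : j ≠ k)
    (x : ι → Plane) (t : ℝ) (w : Plane) :
    ‖smearedCharge s x {j, k} t w‖ₑ =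
      ‖heatKernel t (x j - w) + s j * s k * heatKernel t (x k - w)‖ₑ := by
  unfold smearedCharge
  rw [Finset.sum_pair hjk]
  have h1 : s j * heatKernel t (x j - w) + s k * heatKernel t (x k - w) =
      s j * (heatKernel t (x j - w) + s j * s k * heatKernel t (x k - w)) := by
    linear_combination (-s k * heatKernel t (x k - w)) * hs j
  have h : |s j| = 1 := by rw [← Real.sqrt_sq_eq_abs, hs, Real.sqrt_one]
  rw [h1, enorm_mul, ← ofReal_norm (s j), Real.norm_eq_abs, h, ENNReal.ofReal_one, one_mul]

theorem lintegral_marginal_pair_le (hs : ∀ i, s i ^ 2 = 1) {j k : ι} (hjk : j ≠ k)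
    (hΨ : Measurable Ψ) (hD : ∀ x y, ∫⁻ w, ‖heatKernel t (x - w) +
      s j * s k * heatKernel t (y - w)‖ₑ ≤ D (x - y)) (x : ι → Plane) :
    ∫⁻ w, marginal (({j, k} : Finset ι).erase j)
      (fun x => Ψ (x j - x k) * ‖smearedCharge s x {j, k} t w‖ₑ) x ≤ ∫⁻ r, Ψ r * D r := by
  have he : ({j, k} : Finset ι).erase j = {k} := by
    rw [Finset.erase_insert]
    simpa using hjk
  rw [he]
  unfold marginal
  simp_rw [lmarginal_singleton, enorm_smearedCharge_pair hs hjk, Function.update_self,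
    Function.update_of_ne hjk]
  have hq : Measurable fun p : Plane × Plane =>
      ‖heatKernel t (x j - p.2) + s j * s k * heatKernel t (p.1 - p.2)‖ₑ := by
    refine Measurable.enorm (Measurable.add ?_ (Measurable.const_mul ?_ _))
    · exact measurable_heatKernel.comp (f := fun p : Plane × Plane => (t, x j - p.2))
        (by fun_prop)
    · exact measurable_heatKernel.comp (f := fun p : Plane × Plane => (t, p.1 - p.2))
        (by fun_prop)
  rw [lintegral_lintegral_swap]
  · rw [← lintegral_sub_left_eq_self (fun r => Ψ r * D r) (x j)]
    refine lintegral_mono fun y => ?_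
    have hqy : Measurable fun w =>
        ‖heatKernel t (x j - w) + s j * s k * heatKernel t (y - w)‖ₑ :=
      hq.comp (f := fun w : Plane => (y, w)) (by fun_prop)
    rw [lintegral_const_mul _ hqy]
    gcongr
    exact hD _ _
  · have h1 : Measurable fun p : Plane × Plane => Ψ (x j - p.2) := hΨ.comp (by fun_prop)
    have h2 : Measurable fun p : Plane × Plane =>
        ‖heatKernel t (x j - p.1) + s j * s k * heatKernel t (p.2 - p.1)‖ₑ :=
      hq.comp (f := fun p : Plane × Plane => (p.2, p.1)) (by fun_prop)
    exact (h1.mul h2).aemeasurable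

/-- At fixed separation, moving the pair past `w` is the same as moving `w` past the pair, because
the heat kernel is even. The reflection reverses the separation, hence the evenness of `D`. -/
theorem marginal_pair_le (hs : ∀ i, s i ^ 2 = 1) {j k : ι} (hjk : j ≠ k)
    (hΨ : Measurable Ψ) (hDeven : ∀ r, D (-r) = D r) (hD : ∀ x y, ∫⁻ w, ‖heatKernel t (x - w) +
      s j * s k * heatKernel t (y - w)‖ₑ ≤ D (x - y)) (w : Plane) (x : ι → Plane) :
    marginal {j, k} (fun x => Ψ (x j - x k) * ‖smearedCharge s x {j, k} t w‖ₑ) x ≤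
      ∫⁻ r, Ψ r * D r := by
  have hq : Measurable fun p : Plane × Plane =>
      ‖heatKernel t (p.1 - w) + s j * s k * heatKernel t (p.2 - w)‖ₑ := by
    refine Measurable.enorm (Measurable.add ?_ (Measurable.const_mul ?_ _))
    · exact measurable_heatKernel.comp (f := fun p : Plane × Plane => (t, p.1 - w))
        (by fun_prop)
    · exact measurable_heatKernel.comp (f := fun p : Plane × Plane => (t, p.2 - w))
        (by fun_prop)
  simp_rw [enorm_smearedCharge_pair hs hjk]
  have hm : Measurable fun x : ι → Plane => Ψ (x j - x k) *
      ‖heatKernel t (x j - w) + s j * s k * heatKernel t (x k - w)‖ₑ := by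
    refine Measurable.mul (hΨ.comp (f := fun x : ι → Plane => x j - x k) (by fun_prop)) ?_
    exact hq.comp (f := fun x : ι → Plane => (x j, x k)) (by fun_prop)
  unfold marginal
  rw [lmarginal_insert _ hm (by simpa using hjk)]
  simp_rw [lmarginal_singleton, Function.update_self, Function.update_of_ne hjk,
    Function.update_self]
  calc _ = ∫⁻ a, ∫⁻ r, Ψ r *
        ‖heatKernel t (a - w) + s j * s k * heatKernel t (a - r - w)‖ₑ := by
        refine lintegral_congr fun a => ?_
        rw [← lintegral_sub_left_eq_self (fun r => Ψ r *
          ‖heatKernel t (a - w) + s j * s k * heatKernel t (a - r - w)‖ₑ) a]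
        simp_rw [sub_sub_cancel]
    _ = ∫⁻ r, ∫⁻ a, Ψ r *
        ‖heatKernel t (a - w) + s j * s k * heatKernel t (a - r - w)‖ₑ := by
        refine lintegral_lintegral_swap (Measurable.aemeasurable (Measurable.mul ?_ ?_))
        · exact hΨ.comp measurable_snd
        · exact hq.comp (f := fun p : Plane × Plane => (p.1, p.1 - p.2)) (by fun_prop)
    _ ≤ _ := by
        refine lintegral_mono fun r => ?_
        beta_reduce
        have hqr : Measurable fun a =>
            ‖heatKernel t (a - w) + s j * s k * heatKernel t (a - r - w)‖ₑ :=
          hq.comp (f := fun a : Plane => (a, a - r)) (by fun_prop)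
        rw [lintegral_const_mul _ hqr]
        gcongr
        have h := hD w (w + r)
        rw [sub_add_cancel_left, hDeven] at h
        refine le_trans (le_of_eq (lintegral_congr fun a => ?_)) h
        rw [← heatKernel_neg t (a - w), ← heatKernel_neg t (a - r - w), neg_sub, neg_sub,
          sub_sub_eq_add_sub]

end Pair

end Marginals

/-! ### Integrals of the two-particle Ursell functions. -/

section PairBounds

theorem sum_powerset_pair {ι : Type*} [DecidableEq ι] {M : Type*} [AddCommMonoid M] {i j : ι}
    (hij : i ≠ j) (f : Finset ι → M) :
    ∑ Y ∈ ({i, j} : Finset ι).powerset with i ∈ Y ∧ Y ≠ {i, j}, f Y = f {i} := by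
  have : ({i, j} : Finset ι).powerset.filter (fun Y => i ∈ Y ∧ Y ≠ {i, j}) = {{i}} := by
    ext Y
    simp only [Finset.mem_filter, Finset.mem_powerset, Finset.mem_singleton]
    constructor
    · rintro ⟨h1, h2, h3⟩
      by_cases hj : j ∈ Y
      · exact absurd (h1.antisymm (by simp [Finset.insert_subset_iff, h2, hj])) h3
      · refine Finset.eq_singleton_iff_unique_mem.2 ⟨h2, fun k hk => ?_⟩
        have := h1 hk
        simp only [Finset.mem_insert, Finset.mem_singleton] at this
        rcases this with rfl | rfl
        exacts [rfl, absurd hk hj]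
    · rintro rfl
      refine ⟨by simp, by simp, fun h => hij ?_⟩
      have : j ∈ ({i} : Finset ι) := h ▸ by simp
      exact (Finset.mem_singleton.1 this).symm
  rw [this, Finset.sum_singleton]

theorem pair_sdiff_singleton {ι : Type*} [DecidableEq ι] {i j : ι} (hij : i ≠ j) :
    ({i, j} : Finset ι) \ {i} = {j} := by
  ext k
  simp only [Finset.mem_sdiff, Finset.mem_insert, Finset.mem_singleton]
  constructor
  · rintro ⟨h | h, h'⟩ <;> tauto
  · rintro rfl
    exact ⟨Or.inr rfl, hij.symm⟩

theorem gasUrsell_singleton {ι : Type*} [DecidableEq ι] (v : Plane → ℝ) (s : ι → ℝ)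
    (x : ι → Plane) (i : ι) : gasUrsell v s x {i} = 1 := by
  rw [gasUrsell, ursell_singleton (by simp [pairEnergy_empty]), pairEnergy_singleton]
  simp

theorem gasUrsell_pair {ι : Type*} [DecidableEq ι] {v : Plane → ℝ} (hv : ∀ x, v (-x) = v x)
    (s : ι → ℝ) (x : ι → Plane) {i j : ι} (hij : i ≠ j) :
    gasUrsell v s x {i, j} = Real.exp (-(s i * s j * v (x i - x j))) - 1 := by
  rw [gasUrsell, ursell_pair (by simp [pairEnergy_empty]) hij,
    pairEnergy_pair (pairPotential_comm hv s x) hij]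
  simp [pairEnergy_singleton, pairPotential]

/-- Extending the integral to infinity removes `M` from the bound; uniformity in the cutoff
originates here. -/
theorem lintegral_Ioc_rpow_le {m M p : ℝ} (hm : 0 < m) (hp : p + 1 < 0) :
    ∫⁻ s in Set.Ioc m M, ENNReal.ofReal (s ^ p) ≤ ENNReal.ofReal (m ^ (p + 1) / -(p + 1)) := by
  calc _ ≤ ∫⁻ s in Set.Ioi m, ENNReal.ofReal (s ^ p) :=
        lintegral_mono_set fun s hs => hs.1
    _ = ENNReal.ofReal (∫ s in Set.Ioi m, s ^ p) := by
        refine (ofReal_integral_eq_lintegral_ofReal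
          (integrableOn_Ioi_rpow_of_lt (by linarith) hm) ?_).symm
        filter_upwards [ae_restrict_mem measurableSet_Ioi] with s hs
        exact Real.rpow_nonneg (hm.trans hs).le _
    _ = _ := by
        rw [integral_Ioi_rpow_of_lt (by linarith) hm, neg_div, div_neg]

theorem measurable_greenSq_right (μ : ℝ) : Measurable (greenSq μ) :=
  measurable_greenSq.comp (f := fun x : Plane => (μ, x)) (by fun_prop)

theorem ofReal_flowPotential {β M m : ℝ} (hβ : 0 ≤ β) (hm : 0 < m) (hmM : m ≤ M) (x : Plane) :
    ENNReal.ofReal (flowPotential β M m x) =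
      ENNReal.ofReal β * ∫⁻ s in Set.Ioc m M, ENNReal.ofReal (greenSq s x) := by
  rw [flowPotential, ENNReal.ofReal_mul hβ, intervalIntegral.integral_of_le hmM,
    ofReal_integral_eq_lintegral_ofReal]
  · exact ((intervalIntegrable_iff_integrableOn_Ioc_of_le hmM).1
      (intervalIntegrable_greenSq hm (hm.trans_le hmM) x))
  · exact Eventually.of_forall fun s => greenSq_nonneg s x

theorem lintegral_flowPotential_le {β M m : ℝ} (hβ : 0 ≤ β) (hm : 0 < m) (hmM : m ≤ M) :
    ∫⁻ x, ENNReal.ofReal (flowPotential β M m x) ≤ ENNReal.ofReal (β / m) := by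
  simp_rw [ofReal_flowPotential hβ hm hmM]
  have hG : Measurable fun p : Plane × ℝ => ENNReal.ofReal (greenSq p.2 p.1) :=
    (measurable_greenSq.comp measurable_swap).ennreal_ofReal
  rw [lintegral_const_mul _ hG.lintegral_prod_right', lintegral_lintegral_swap hG.aemeasurable,
    div_eq_mul_inv, ENNReal.ofReal_mul hβ]
  gcongr
  calc _ = ∫⁻ s in Set.Ioc m M, ENNReal.ofReal (s ^ (-2 : ℝ)) := by
        refine setLIntegral_congr_fun measurableSet_Ioc fun s hs => ?_
        have hs' : 0 < s := hm.trans hs.1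
        beta_reduce
        rw [lintegral_greenSq hs', Real.rpow_neg hs'.le, Real.rpow_two]
    _ ≤ _ := (lintegral_Ioc_rpow_le hm (by norm_num)).trans_eq (by
        norm_num [Real.rpow_neg_one])

theorem lintegral_norm_mul_greenSq_le {μ : ℝ} (hμ : 0 < μ) :
    ∫⁻ x, ENNReal.ofReal (‖x‖ * greenSq μ x) ≤ ENNReal.ofReal (3 * μ ^ (-(5 / 2) : ℝ)) := by
  have hsq : 0 < Real.sqrt μ := Real.sqrt_pos.2 hμ
  -- Since `a b = 1/4`, the norm is at most `a‖x‖² + b`. With the moments `8 μ⁻³` and `μ⁻²` the two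
  -- terms give `2 μ^(-5/2)` and `μ^(-5/2)`.
  set a := Real.sqrt μ / 4 with ha
  set b := (Real.sqrt μ)⁻¹ with hb
  have hapos : 0 < a := by positivity
  have hbpos : 0 < b := by positivity
  have hab : a * b = 1 / 4 := by rw [ha, hb]; field_simp
  have hle : ∀ x : Plane, ENNReal.ofReal (‖x‖ * greenSq μ x) ≤
      ENNReal.ofReal a * ENNReal.ofReal (‖x‖ ^ 2 * greenSq μ x) +
        ENNReal.ofReal b * ENNReal.ofReal (greenSq μ x) := fun x => by
    have hg := greenSq_nonneg μ x
    rw [← ENNReal.ofReal_mul hapos.le, ← ENNReal.ofReal_mul hbpos.le,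
      ← ENNReal.ofReal_add (by positivity) (by positivity)]
    apply ENNReal.ofReal_le_ofReal
    have h1 : ‖x‖ ≤ a * ‖x‖ ^ 2 + b := by
      have h2 : a * ‖x‖ ^ 2 + b - ‖x‖ = a * (‖x‖ - 2 * b) ^ 2 := by
        have h3 : b * (a * b) = b / 4 := by rw [hab]; ring
        linear_combination (4 * ‖x‖) * hab - 4 * h3
      have h4 : 0 ≤ a * (‖x‖ - 2 * b) ^ 2 := by positivity
      linarith
    calc ‖x‖ * greenSq μ x ≤ (a * ‖x‖ ^ 2 + b) * greenSq μ x := by gcongr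
      _ = _ := by ring
  refine (lintegral_mono hle).trans ?_
  have hg := measurable_greenSq_right μ
  rw [lintegral_add_left (by fun_prop), lintegral_const_mul _ (by fun_prop),
    lintegral_const_mul _ (by fun_prop), lintegral_norm_sq_mul_greenSq hμ, lintegral_greenSq hμ,
    ← ENNReal.ofReal_mul hapos.le, ← ENNReal.ofReal_mul hbpos.le,
    ← ENNReal.ofReal_add (by positivity) (by positivity)]
  apply ENNReal.ofReal_le_ofReal
  have h5 : μ ^ (-(5 / 2) : ℝ) = (Real.sqrt μ ^ 5)⁻¹ := by
    rw [Real.rpow_neg hμ.le, Real.sqrt_eq_rpow, ← Real.rpow_natCast, ← Real.rpow_mul hμ.le]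
    norm_num
  have h6 : μ = Real.sqrt μ ^ 2 := (Real.sq_sqrt hμ.le).symm
  rw [h5, ha, hb]
  have h7 : (μ ^ 3)⁻¹ = (Real.sqrt μ ^ 6)⁻¹ := by rw [h6]; simp [← pow_mul]
  have h8 : (μ ^ 2)⁻¹ = (Real.sqrt μ ^ 4)⁻¹ := by rw [h6]; simp [← pow_mul]
  rw [h7, h8]
  apply le_of_eq
  field_simp
  norm_num

/-- The growth rate of the cluster integrals. -/
def treeRate (β : ℝ) : ℝ := β / (1 - 3 * β / (16 * Real.pi))

theorem one_sub_pos {β : ℝ} (hβ : β < 16 * Real.pi / 3) : 0 < 1 - 3 * β / (16 * Real.pi) := by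
  have hpi := Real.pi_pos
  rw [sub_pos, div_lt_one (by positivity)]
  linarith

theorem treeRate_pos {β : ℝ} (hβ0 : 0 < β) (hβ : β < 16 * Real.pi / 3) : 0 < treeRate β :=
  div_pos hβ0 (one_sub_pos hβ)

theorem le_treeRate {β : ℝ} (hβ0 : 0 < β) (hβ : β < 16 * Real.pi / 3) : β ≤ treeRate β := by
  have hpi := Real.pi_pos
  rw [treeRate, le_div_iff₀ (one_sub_pos hβ)]
  have : 0 ≤ β * (3 * β / (16 * Real.pi)) := by positivity
  linarith

variable {ι : Type*} [DecidableEq ι]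

/-- The left side is the Ursell function of a neutral pair, so this is the integrated flow equation
for two particles, realised on `Bool` with charges `1` and `-1`. -/
theorem enorm_exp_flowPotential_sub_one_le {β M m : ℝ} (hβ : 0 ≤ β) (hm : 0 < m) (hmM : m ≤ M)
    (r : Plane) :
    ‖Real.exp (flowPotential β M m r) - 1‖ₑ ≤ ∫⁻ μ in Set.Ioc m M,
      ENNReal.ofReal (β * (μ / m) ^ (β / (4 * Real.pi))) * ENNReal.ofReal (greenSq μ r) := by
  set s : Bool → ℝ := fun b => if b then 1 else -1 with hs
  set x : Bool → Plane := fun b => if b then r else 0 with hx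
  have hI : (({true, false} : Finset Bool)).card = 2 := rfl
  have h := enorm_gasUrsell_le hβ hm hmM (s := s) (fun b => by cases b <;> simp [hs]) x
    (I := {true, false}) (by rw [hI]) (i := true) (by simp)
  have hne : true ≠ false := by decide
  simp only [sum_powerset_pair hne, pair_sdiff_singleton hne, gasUrsell_singleton, hI] at h
  rw [gasUrsell_pair (flowPotential_neg β M m) s x hne] at h
  simp only [crossEnergy, pairPotential, Finset.sum_singleton, hs, hx] at h
  simp only [if_true, Bool.false_eq_true, if_false, one_mul, neg_mul, neg_neg, sub_zero,
    enorm_one, mul_one, enorm_neg] at h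
  refine h.trans_eq (lintegral_congr fun μ => ?_)
  rw [Real.enorm_eq_ofReal (greenSq_nonneg μ r)]
  congr 4
  push_cast
  field_simp
  ring

theorem measurable_flowPotential_right (β M m : ℝ) : Measurable (flowPotential β M m) :=
  (measurable_flowPotential β M).comp (f := fun x : Plane => (m, x)) (by fun_prop)

/-- The dipole moment of the Ursell function of a neutral pair. -/
theorem lintegral_neutral_pair_le {β M m t : ℝ} (hβ0 : 0 < β) (hβ : β < 16 * Real.pi / 3)
    (hm : 0 < m) (hmM : m ≤ M) (ht : 0 < t) :
    ∫⁻ r : Plane, ‖Real.exp (flowPotential β M m r) - 1‖ₑ *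
      ENNReal.ofReal (‖r‖ / Real.sqrt t) ≤
      ENNReal.ofReal (2 * (treeRate β / m)) * ENNReal.ofReal (1 / Real.sqrt (m * t)) := by
  have hpi := Real.pi_pos
  have hst : 0 < Real.sqrt t := Real.sqrt_pos.2 ht
  set q := β / (4 * Real.pi) with hq
  have hG : Measurable fun p : Plane × ℝ => ENNReal.ofReal (greenSq p.2 p.1) :=
    (measurable_greenSq.comp measurable_swap).ennreal_ofReal
  have hc : Measurable fun μ : ℝ => ENNReal.ofReal (β * (μ / m) ^ q) := by fun_prop
  -- The first moment of `greenSq` makes the integrand a multiple of `μ^(q - 5/2)`. Convergence at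
  -- large mass then needs only `β < 6π`; without the dipole factor it would need `q < 1`.
  have hq1 : q < 3 / 2 := by
    rw [hq, div_lt_iff₀ (by positivity)]
    linarith
  calc _ ≤ ∫⁻ r : Plane, ∫⁻ μ in Set.Ioc m M, ENNReal.ofReal (β * (μ / m) ^ q) *
        ENNReal.ofReal (greenSq μ r) * ENNReal.ofReal (‖r‖ / Real.sqrt t) := by
        refine lintegral_mono fun r => ?_
        have hGr : Measurable fun μ : ℝ => ENNReal.ofReal (greenSq μ r) :=
          hG.comp (f := fun μ : ℝ => (r, μ)) (by fun_prop)
        beta_reduce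
        have hcG : Measurable fun μ : ℝ =>
            ENNReal.ofReal (β * (μ / m) ^ q) * ENNReal.ofReal (greenSq μ r) := hc.mul hGr
        rw [lintegral_mul_const _ hcG]
        gcongr
        exact enorm_exp_flowPotential_sub_one_le hβ0.le hm hmM r
    _ = ∫⁻ μ in Set.Ioc m M, ∫⁻ r : Plane, ENNReal.ofReal (β * (μ / m) ^ q) *
        ENNReal.ofReal (greenSq μ r) * ENNReal.ofReal (‖r‖ / Real.sqrt t) := by
        refine lintegral_lintegral_swap (Measurable.aemeasurable ?_)
        exact ((hc.comp measurable_snd).mul hG).mul (by fun_prop)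
    _ ≤ ∫⁻ μ in Set.Ioc m M, ENNReal.ofReal (β * 3 / Real.sqrt t * m ^ (-q)) *
        ENNReal.ofReal (μ ^ (q - 5 / 2)) := by
        refine setLIntegral_mono' measurableSet_Ioc fun μ hμ => ?_
        have hμ0 : 0 < μ := hm.trans hμ.1
        have h1 : ∀ r : Plane, ENNReal.ofReal (β * (μ / m) ^ q) *
            ENNReal.ofReal (greenSq μ r) * ENNReal.ofReal (‖r‖ / Real.sqrt t) =
            ENNReal.ofReal (β * (μ / m) ^ q / Real.sqrt t) *
              ENNReal.ofReal (‖r‖ * greenSq μ r) := fun r => by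
          rw [← ENNReal.ofReal_mul (by positivity),
            ← ENNReal.ofReal_mul (mul_nonneg (by positivity) (greenSq_nonneg _ _)),
            ← ENNReal.ofReal_mul (by positivity)]
          congr 1
          field_simp
        simp_rw [h1]
        have := measurable_greenSq_right μ
        rw [lintegral_const_mul _ (by fun_prop)]
        refine (mul_le_mul_right (lintegral_norm_mul_greenSq_le hμ0) _).trans_eq ?_
        rw [← ENNReal.ofReal_mul (by positivity), ← ENNReal.ofReal_mul (by positivity)]
        congr 1
        rw [Real.div_rpow hμ0.le hm.le, Real.rpow_neg hm.le, sub_eq_add_neg, Real.rpow_add hμ0]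
        field_simp
    _ ≤ ENNReal.ofReal (β * 3 / Real.sqrt t * m ^ (-q)) *
        ENNReal.ofReal (m ^ (q - 5 / 2 + 1) / -(q - 5 / 2 + 1)) := by
        rw [lintegral_const_mul _ (by fun_prop)]
        gcongr
        exact lintegral_Ioc_rpow_le hm (by linarith)
    _ ≤ _ := by
        rw [← ENNReal.ofReal_mul (by positivity),
          ← ENNReal.ofReal_mul (mul_nonneg zero_le_two (div_pos (treeRate_pos hβ0 hβ) hm).le)]
        apply ENNReal.ofReal_le_ofReal
        have h1 : m ^ (-q) * m ^ (q - 5 / 2 + 1) = m⁻¹ * (Real.sqrt m)⁻¹ := by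
          rw [← Real.rpow_add hm, Real.sqrt_eq_rpow, ← Real.rpow_neg_one, ← Real.rpow_neg hm.le,
            ← Real.rpow_add hm]
          congr 1
          ring
        have h2 : -(q - 5 / 2 + 1) = 3 / 2 * (1 - β / (6 * Real.pi)) := by
          rw [hq]; field_simp; ring
        have h3 : 0 < 1 - 3 * β / (16 * Real.pi) := one_sub_pos hβ
        have h4 : 1 - 3 * β / (16 * Real.pi) ≤ 1 - β / (6 * Real.pi) := by
          rw [sub_le_sub_iff_left, div_le_div_iff₀ (by positivity) (by positivity)]
          nlinarith [mul_pos hβ0 hpi]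
        have h5 : β / (1 - β / (6 * Real.pi)) ≤ treeRate β :=
          div_le_div_of_nonneg_left hβ0.le h3 h4
        have h6 : 0 < 1 - β / (6 * Real.pi) := h3.trans_le h4
        rw [Real.sqrt_mul hm.le]
        have hsm : 0 < Real.sqrt m := Real.sqrt_pos.2 hm
        calc _ = β * 3 / Real.sqrt t * (m ^ (-q) * m ^ (q - 5 / 2 + 1)) /
              -(q - 5 / 2 + 1) := by ring
          _ = 2 * (β / (1 - β / (6 * Real.pi)) / m) * (1 / (Real.sqrt m * Real.sqrt t)) := by
              rw [h1, h2]
              field_simp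
          _ ≤ _ := by gcongr

end PairBounds

/-! ### The induction over clusters. -/

section ClusterBounds

variable {ι : Type*} [DecidableEq ι]

/-- The bound on the integral of the Ursell function of `n` particles at mass `μ`. -/
def treeConst (β μ : ℝ) (n : ℕ) : ℝ := (n : ℝ) ^ (n - 2) * (treeRate β / μ) ^ (n - 1)

theorem treeConst_nonneg {β μ : ℝ} (hβ0 : 0 < β) (hβ : β < 16 * Real.pi / 3) (hμ : 0 < μ)
    (n : ℕ) : 0 ≤ treeConst β μ n := by
  have := treeRate_pos hβ0 hβ
  unfold treeConst
  positivity

/-- The additional weight of neutral pairs at proper time `t`. -/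
def dipoleWeight (s : ι → ℝ) (Y : Finset ι) (μ t : ℝ) : ENNReal :=
  if Y.card = 2 ∧ ∑ y ∈ Y, s y = 0 then ENNReal.ofReal (1 / Real.sqrt (μ * t)) else 1

/-- Bounds on the integrals of a function of a cluster against its smeared charge. -/
def ClusterBound (F : (ι → Plane) → ENNReal) (s : ι → ℝ) (Y : Finset ι) (b : ℝ → ENNReal) :
    Prop :=
  ∀ t, 0 < t →
    (∀ i ∈ Y, ∀ x, ∫⁻ w, marginal (Y.erase i) (fun x => F x * ‖smearedCharge s x Y t w‖ₑ) x ≤ b t) ∧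
    ∀ w x, marginal Y (fun x => F x * ‖smearedCharge s x Y t w‖ₑ) x ≤ b t

theorem clusterBound_of_marginal_le {s : ι → ℝ} (hs : ∀ i, s i ^ 2 = 1) {Y : Finset ι}
    {F : (ι → Plane) → ENNReal} (hF : Measurable F) {N : ENNReal}
    (hN : ∀ i ∈ Y, ∀ x, marginal (Y.erase i) F x ≤ N) :
    ClusterBound F s Y fun _ => Y.card * N := fun _ ht =>
  ⟨fun i hi x => lintegral_marginal_smearedCharge_le hs hF (hN i hi) ht x,
    fun w x => marginal_smearedCharge_le hs hF hN ht w x⟩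

/-- `D` bounds the `L¹` norm of the smeared pair. For equal charges the constant `2` suffices, since
`|exp (-V) - 1| ≤ V` is integrable uniformly in `M`. For opposite charges `‖r‖ / √t` controls the
growth of `exp V - 1` near the origin as `M` increases. -/
theorem exists_pair_bound {β M m : ℝ} (hβ0 : 0 < β) (hβ : β < 16 * Real.pi / 3) (hm : 0 < m)
    (hmM : m ≤ M) {s : ι → ℝ} (hs : ∀ i, s i ^ 2 = 1) {j k : ι} (hjk : j ≠ k) {t : ℝ}
    (ht : 0 < t) :
    ∃ D : Plane → ENNReal, (∀ r, D (-r) = D r) ∧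
      (∀ x y, ∫⁻ w, ‖heatKernel t (x - w) + s j * s k * heatKernel t (y - w)‖ₑ ≤ D (x - y)) ∧
      ∫⁻ r, ‖Real.exp (-(s j * s k * flowPotential β M m r)) - 1‖ₑ * D r ≤
        ENNReal.ofReal (2 * (treeRate β / m)) * dipoleWeight s {j, k} m t := by
  have hε : s j * s k = 1 ∨ s j * s k = -1 := by
    rw [← mul_self_eq_one_iff]
    linear_combination hs j * s k ^ 2 + hs k
  rcases hε with hε | hε
  · have hw : dipoleWeight s {j, k} m t = 1 := by
      rw [dipoleWeight, if_neg]
      rintro ⟨-, h⟩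
      rw [Finset.sum_pair hjk] at h
      have h1 : s j * s k = -s j ^ 2 := by rw [eq_neg_of_add_eq_zero_right h]; ring
      rw [hε, hs] at h1
      norm_num at h1
    refine ⟨fun _ => 2, fun _ => rfl, fun x y => ?_, ?_⟩
    · have hq : ∀ z, Measurable fun w => ‖heatKernel t (z - w)‖ₑ := fun z =>
        (measurable_heatKernel.comp (f := fun w : Plane => (t, z - w)) (by fun_prop)).enorm
      rw [hε]
      simp_rw [one_mul]
      refine (lintegral_mono fun w => enorm_add_le _ _).trans ?_
      rw [lintegral_add_left (hq x), lintegral_heatKernel_sub ht, lintegral_heatKernel_sub ht]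
      norm_num
    · rw [hw, mul_one, hε]
      simp_rw [one_mul]
      have hV := measurable_flowPotential_right β M m
      rw [lintegral_mul_const _ (by fun_prop), ENNReal.ofReal_mul zero_le_two, mul_comm]
      have h2 : ENNReal.ofReal 2 = 2 := by norm_num
      rw [h2]
      gcongr
      refine (lintegral_mono fun r => ?_).trans ((lintegral_flowPotential_le hβ0.le hm hmM).trans
        (ENNReal.ofReal_le_ofReal (div_le_div_of_nonneg_right (le_treeRate hβ0 hβ) hm.le)))
      rw [← ofReal_norm, Real.norm_eq_abs]
      apply ENNReal.ofReal_le_ofReal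
      have h0 := flowPotential_nonneg hβ0.le hmM r
      have h1 := Real.add_one_le_exp (-flowPotential β M m r)
      have h3 : Real.exp (-flowPotential β M m r) ≤ 1 := Real.exp_le_one_iff.2 (by linarith)
      rw [abs_le]
      constructor <;> linarith
  · have hw : dipoleWeight s {j, k} m t = ENNReal.ofReal (1 / Real.sqrt (m * t)) := by
      rw [dipoleWeight, if_pos]
      refine ⟨Finset.card_pair hjk, ?_⟩
      rw [Finset.sum_pair hjk]
      linear_combination (-s k) * hs j + s j * hε
    refine ⟨fun r => ENNReal.ofReal (‖r‖ / Real.sqrt t), fun r => by simp,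
      fun x y => ?_, ?_⟩
    · rw [hε]
      simp_rw [neg_one_mul, ← sub_eq_add_neg]
      exact lintegral_heatKernel_sub_sub_le ht x y
    · rw [hw, hε]
      simp_rw [neg_one_mul, neg_neg]
      exact lintegral_neutral_pair_le hβ0 hβ hm hmM ht

theorem clusterBound_pair {β M m : ℝ} (hβ0 : 0 < β) (hβ : β < 16 * Real.pi / 3) (hm : 0 < m)
    (hmM : m ≤ M) {s : ι → ℝ} (hs : ∀ i, s i ^ 2 = 1) {Y : Finset ι} (hY : Y.card = 2) :
    ClusterBound (fun x => ‖gasUrsell (flowPotential β M m) s x Y‖ₑ) s Y fun t =>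
      ENNReal.ofReal (2 * (treeRate β / m)) * dipoleWeight s Y m t := by
  have hΨ : ∀ j k, Measurable fun r =>
      ‖Real.exp (-(s j * s k * flowPotential β M m r)) - 1‖ₑ := fun j k => by
    have := measurable_flowPotential_right β M m
    fun_prop
  have key : ∀ j k, j ≠ k → Y = {j, k} → ∀ t, 0 < t →
      (∀ x, ∫⁻ w, marginal (Y.erase j)
        (fun x => ‖gasUrsell (flowPotential β M m) s x Y‖ₑ * ‖smearedCharge s x Y t w‖ₑ) x ≤
        ENNReal.ofReal (2 * (treeRate β / m)) * dipoleWeight s Y m t) ∧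
      ∀ w x, marginal Y
        (fun x => ‖gasUrsell (flowPotential β M m) s x Y‖ₑ * ‖smearedCharge s x Y t w‖ₑ) x ≤
        ENNReal.ofReal (2 * (treeRate β / m)) * dipoleWeight s Y m t := by
    rintro j k hjk rfl t ht
    obtain ⟨D, hDeven, hD, hint⟩ := exists_pair_bound hβ0 hβ hm hmM hs hjk ht
    simp_rw [gasUrsell_pair (flowPotential_neg β M m) s _ hjk]
    exact ⟨fun x => (lintegral_marginal_pair_le hs hjk (hΨ j k) hD x).trans hint,
      fun w x => (marginal_pair_le hs hjk (hΨ j k) hDeven hD w x).trans hint⟩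
  obtain ⟨j, k, hjk, rfl⟩ := Finset.card_eq_two.1 hY
  intro t ht
  refine ⟨fun i hi x => ?_, (key j k hjk rfl t ht).2⟩
  simp only [Finset.mem_insert, Finset.mem_singleton] at hi
  rcases hi with rfl | rfl
  · exact (key _ _ hjk rfl t ht).1 x
  · exact (key _ _ hjk.symm (Finset.pair_comm _ _) t ht).1 x

/-- Neutral pairs cost no more than other clusters: two weights multiply to `1 / (μt)`, a single one
is handled by `√(t/μ) ≤ (t + 1/μ) / 2`, and each case gives at most `μ⁻²`. -/
theorem lintegral_dipoleWeight_le {μ : ℝ} (hμ : 0 < μ) (s : ι → ℝ) (Y Z : Finset ι) :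
    ∫⁻ t in Set.Ioi (0 : ℝ), ENNReal.ofReal (t * Real.exp (-μ * t)) *
      (dipoleWeight s Y μ t * dipoleWeight s Z μ t) ≤ ENNReal.ofReal (μ ^ 2)⁻¹ := by
  have h0 : ∫⁻ t in Set.Ioi (0 : ℝ), ENNReal.ofReal (Real.exp (-μ * t)) = ENNReal.ofReal μ⁻¹ := by
    simpa using lintegral_mul_exp_neg hμ 0
  have h1 : ∫⁻ t in Set.Ioi (0 : ℝ), ENNReal.ofReal (t * Real.exp (-μ * t)) =
      ENNReal.ofReal (μ ^ 2)⁻¹ := by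
    simpa using lintegral_mul_exp_neg hμ 1
  have hone : ∫⁻ t in Set.Ioi (0 : ℝ), ENNReal.ofReal (t * Real.exp (-μ * t)) *
      ENNReal.ofReal (1 / Real.sqrt (μ * t)) ≤ ENNReal.ofReal (μ ^ 2)⁻¹ := by
    calc _ ≤ ∫⁻ t in Set.Ioi (0 : ℝ), (ENNReal.ofReal (1 / 2) *
          ENNReal.ofReal (t * Real.exp (-μ * t)) +
          ENNReal.ofReal (1 / 2 * μ⁻¹) * ENNReal.ofReal (Real.exp (-μ * t))) := by
          refine setLIntegral_mono' measurableSet_Ioi fun t ht => ?_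
          have ht' : 0 < t := ht
          rw [← ENNReal.ofReal_mul (by positivity), ← ENNReal.ofReal_mul (by positivity),
            ← ENNReal.ofReal_mul (by positivity), ← ENNReal.ofReal_add (by positivity)
            (by positivity)]
          apply ENNReal.ofReal_le_ofReal
          have hsm : 0 < Real.sqrt μ := Real.sqrt_pos.2 hμ
          have hst : 0 < Real.sqrt t := Real.sqrt_pos.2 ht'
          have hm2 : μ = Real.sqrt μ ^ 2 := (Real.sq_sqrt hμ.le).symm
          have ht2 : t = Real.sqrt t ^ 2 := (Real.sq_sqrt ht'.le).symm
          have h2 : t * (1 / Real.sqrt (μ * t)) ≤ 1 / 2 * t + 1 / 2 * μ⁻¹ := by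
            have h3 : t * (1 / Real.sqrt (μ * t)) = Real.sqrt t * (Real.sqrt μ)⁻¹ := by
              rw [Real.sqrt_mul hμ.le]
              nth_rewrite 1 [ht2]
              field_simp
            have h4 : μ⁻¹ = (Real.sqrt μ)⁻¹ ^ 2 := by
              rw [inv_pow, Real.sq_sqrt hμ.le]
            rw [h3, h4]
            nth_rewrite 2 [ht2]
            nlinarith [sq_nonneg (Real.sqrt t - (Real.sqrt μ)⁻¹)]
          calc t * Real.exp (-μ * t) * (1 / Real.sqrt (μ * t)) =
                t * (1 / Real.sqrt (μ * t)) * Real.exp (-μ * t) := by ring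
            _ ≤ (1 / 2 * t + 1 / 2 * μ⁻¹) * Real.exp (-μ * t) := by gcongr
            _ = _ := by ring
      _ = _ := by
          rw [lintegral_add_left (by fun_prop), lintegral_const_mul _ (by fun_prop),
            lintegral_const_mul _ (by fun_prop), h0, h1, ← ENNReal.ofReal_mul (by positivity),
            ← ENNReal.ofReal_mul (by positivity), ← ENNReal.ofReal_add (by positivity)
            (by positivity)]
          congr 1
          field_simp
          norm_num
  unfold dipoleWeight
  split_ifs
  · calc _ ≤ ∫⁻ t in Set.Ioi (0 : ℝ), ENNReal.ofReal μ⁻¹ *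
          ENNReal.ofReal (Real.exp (-μ * t)) := by
          refine setLIntegral_mono' measurableSet_Ioi fun t ht => ?_
          have ht' : 0 < t := ht
          rw [← ENNReal.ofReal_mul (by positivity), ← ENNReal.ofReal_mul (by positivity),
            ← ENNReal.ofReal_mul (by positivity)]
          apply ENNReal.ofReal_le_ofReal
          rw [div_mul_div_comm, Real.mul_self_sqrt (by positivity)]
          apply le_of_eq
          field_simp
      _ = _ := by
          rw [lintegral_const_mul _ (by fun_prop), h0, ← ENNReal.ofReal_mul (by positivity)]
          congr 1
          field_simp
  · simpa using hone
  · simpa using hone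
  · simpa using h1.le

/-- The mass integral closes the induction: it contributes the denominator `(n - 1)(1 - 3β/16π)`,
which cancels the `n - 1` of the tree recursion and, together with `β`, yields the missing power of
`treeRate β`. -/
theorem lintegral_flow_le {β M m : ℝ} (hβ0 : 0 < β) (hβ : β < 16 * Real.pi / 3) (hm : 0 < m)
    {n : ℕ} (hn : 3 ≤ n) :
    ∫⁻ μ in Set.Ioc m M, ENNReal.ofReal (β * (μ / m) ^ (n * β / (8 * Real.pi))) *
      ENNReal.ofReal (((n : ℝ) - 1) * (n : ℝ) ^ (n - 2) * (treeRate β) ^ (n - 2) * (μ ^ n)⁻¹) ≤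
      ENNReal.ofReal (treeConst β m n) := by
  have hpi := Real.pi_pos
  have hlam := treeRate_pos hβ0 hβ
  have hn3 : (3 : ℝ) ≤ n := by exact_mod_cast hn
  have hn1 : (0 : ℝ) < n - 1 := by linarith
  set q := n * β / (8 * Real.pi) with hq
  set C := ((n : ℝ) - 1) * (n : ℝ) ^ (n - 2) * (treeRate β) ^ (n - 2) with hC
  have hCpos : 0 < C := by positivity
  have h3 : 0 < 1 - 3 * β / (16 * Real.pi) := one_sub_pos hβ
  -- This is `2n ≤ 3(n - 1)`, true for `n ≥ 3` with equality at `n = 3`; the threshold `16π/3` comes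
  -- from here.
  have hexp : ((n : ℝ) - 1) * (1 - 3 * β / (16 * Real.pi)) ≤ -(q - n + 1) := by
    have h4 : q ≤ ((n : ℝ) - 1) * (3 * β / (16 * Real.pi)) := by
      rw [hq, ← mul_div_assoc, div_le_div_iff₀ (by positivity) (by positivity)]
      have h5 : 0 < β * Real.pi := by positivity
      nlinarith
    linarith
  have hneg : q - n + 1 < 0 := by
    have := mul_pos hn1 h3
    linarith
  calc _ = ∫⁻ μ in Set.Ioc m M, ENNReal.ofReal (β * C * m ^ (-q)) *
        ENNReal.ofReal (μ ^ (q - n)) := by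
        refine setLIntegral_congr_fun measurableSet_Ioc fun μ hμ => ?_
        have hμ0 : 0 < μ := hm.trans hμ.1
        rw [← ENNReal.ofReal_mul (by positivity), ← ENNReal.ofReal_mul (by positivity)]
        congr 1
        rw [Real.div_rpow hμ0.le hm.le, Real.rpow_neg hm.le, Real.rpow_sub hμ0, Real.rpow_natCast]
        field_simp
    _ ≤ ENNReal.ofReal (β * C * m ^ (-q)) *
        ENNReal.ofReal (m ^ (q - n + 1) / -(q - n + 1)) := by
        rw [lintegral_const_mul _ (by fun_prop)]
        gcongr
        exact lintegral_Ioc_rpow_le hm hneg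
    _ ≤ _ := by
        rw [← ENNReal.ofReal_mul (by positivity)]
        apply ENNReal.ofReal_le_ofReal
        have h6 : m ^ (-q) * m ^ (q - n + 1) = (m ^ (n - 1))⁻¹ := by
          rw [← Real.rpow_add hm, ← Real.rpow_natCast, ← Real.rpow_neg hm.le]
          congr 1
          rw [Nat.cast_sub (by omega)]
          push_cast
          ring
        calc _ = β * C * (m ^ (-q) * m ^ (q - n + 1)) / -(q - n + 1) := by ring
          _ ≤ β * C * (m ^ (-q) * m ^ (q - n + 1)) /
              (((n : ℝ) - 1) * (1 - 3 * β / (16 * Real.pi))) := by gcongr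
          _ = _ := by
              have h7 : treeRate β ^ (n - 1) = treeRate β ^ (n - 2) * treeRate β := by
                rw [← pow_succ]; congr 1; omega
              have h8 : treeRate β = β / (1 - 3 * β / (16 * Real.pi)) := rfl
              rw [h6, treeConst, div_pow, h7, hC]
              nth_rewrite 3 [h8]
              field_simp

/-- The Ursell functions at fixed charges, integrated over all positions but one, are bounded
uniformly in the cutoff `M`, except for pairs. -/
theorem marginal_gasUrsell_le {β M : ℝ} (hβ0 : 0 < β) (hβ : β < 16 * Real.pi / 3)
    {s : ι → ℝ} (hs : ∀ i, s i ^ 2 = 1) (I : Finset ι) (hI : I.card ≠ 2) {m : ℝ} (hm : 0 < m)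
    (hmM : m ≤ M) {i : ι} (hi : i ∈ I) (x : ι → Plane) :
    marginal (I.erase i) (fun x => ‖gasUrsell (flowPotential β M m) s x I‖ₑ) x ≤
      ENNReal.ofReal (treeConst β m I.card) := by
  induction I using Finset.strongInduction generalizing m i x with
  | H I ih =>
  have hlam := treeRate_pos hβ0 hβ
  have hpos : 0 < I.card := Finset.card_pos.2 ⟨i, hi⟩
  rcases Nat.lt_or_ge I.card 2 with hlt | hge
  · obtain ⟨j, rfl⟩ := Finset.card_eq_one.1 (show I.card = 1 by omega)
    obtain rfl := Finset.mem_singleton.1 hi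
    simp [gasUrsell_singleton, treeConst, marginal]
  have hn : 3 ≤ I.card := by omega
  -- The induction hypothesis excludes pairs, which get the dipole bound instead. The constant has
  -- the same form in both cases, as `treeConst β μ 2` is `treeRate β / μ`.
  have hcluster : ∀ Y ⊂ I, ∀ μ, 0 < μ → μ ≤ M →
      ClusterBound (fun x => ‖gasUrsell (flowPotential β M μ) s x Y‖ₑ) s Y fun t =>
        ENNReal.ofReal (Y.card * treeConst β μ Y.card) * dipoleWeight s Y μ t := by
    intro Y hY μ hμ hμM
    by_cases h2 : Y.card = 2
    · have := clusterBound_pair hβ0 hβ hμ hμM hs h2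
      rw [h2]
      convert this using 4
      norm_num [treeConst]
    · have h1 := clusterBound_of_marginal_le hs
        (measurable_gasUrsell_right β M μ s Y).enorm (N := ENNReal.ofReal (treeConst β μ Y.card))
        fun j hj x => ih Y hY h2 hμ hμM hj x
      convert h1 using 2
      rw [dipoleWeight, if_neg (fun h => h2 h.1), mul_one, ENNReal.ofReal_mul (by positivity)]
      simp
  set P := I.powerset.filter fun Y => i ∈ Y ∧ Y ≠ I with hP
  set Φ : (ι → Plane) → ℝ → Finset ι → ENNReal := fun x μ Y =>
    ‖gasUrsell (flowPotential β M μ) s x Y‖ₑ with hΦ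
  set W : (ι → Plane) → ℝ → Finset ι → ENNReal := fun x μ Y =>
    ‖crossEnergy (pairPotential (greenSq μ) s x) Y (I \ Y)‖ₑ with hW
  have hterm : ∀ Y, Measurable fun p : (ι → Plane) × ℝ =>
      W p.1 p.2 Y * (Φ p.1 p.2 Y * Φ p.1 p.2 (I \ Y)) := fun Y =>
    (measurable_crossEnergy_greenSq s Y (I \ Y)).enorm.mul
      ((measurable_gasUrsell β M s Y).enorm.mul (measurable_gasUrsell β M s (I \ Y)).enorm)
  have hterm' : ∀ μ Y, Measurable fun x : ι → Plane =>
      W x μ Y * (Φ x μ Y * Φ x μ (I \ Y)) := fun μ Y =>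
    (hterm Y).comp (f := fun x : ι → Plane => (x, μ)) (by fun_prop)
  have hsum : ∀ μ, Measurable fun x : ι → Plane =>
      ∑ Y ∈ P, W x μ Y * (Φ x μ Y * Φ x μ (I \ Y)) := fun μ =>
    Finset.measurable_sum _ fun Y _ => hterm' μ Y
  have hall : Measurable fun p : (ι → Plane) × ℝ =>
      ENNReal.ofReal (β * (p.2 / m) ^ (I.card * β / (8 * Real.pi))) *
        ∑ Y ∈ P, W p.1 p.2 Y * (Φ p.1 p.2 Y * Φ p.1 p.2 (I \ Y)) :=
    Measurable.mul (by fun_prop) (Finset.measurable_sum _ fun Y _ => hterm Y)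
  calc _ ≤ marginal (I.erase i) (fun x => ∫⁻ μ in Set.Ioc m M,
        ENNReal.ofReal (β * (μ / m) ^ (I.card * β / (8 * Real.pi))) *
          ∑ Y ∈ P, W x μ Y * (Φ x μ Y * Φ x μ (I \ Y))) x :=
        lmarginal_mono (fun x => enorm_gasUrsell_le hβ0.le hm hmM hs x hge hi) x
    _ = ∫⁻ μ in Set.Ioc m M, ENNReal.ofReal (β * (μ / m) ^ (I.card * β / (8 * Real.pi))) *
          ∑ Y ∈ P, marginal (I.erase i) (fun x => W x μ Y * (Φ x μ Y * Φ x μ (I \ Y))) x := by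
        rw [marginal_lintegral (f := fun x μ =>
          ENNReal.ofReal (β * (μ / m) ^ (I.card * β / (8 * Real.pi))) *
          ∑ Y ∈ P, W x μ Y * (Φ x μ Y * Φ x μ (I \ Y))) hall]
        refine lintegral_congr fun μ => ?_
        rw [marginal_const_mul _ (hsum μ), marginal_finset_sum fun Y => hterm' μ Y]
    _ ≤ ∫⁻ μ in Set.Ioc m M, ENNReal.ofReal (β * (μ / m) ^ (I.card * β / (8 * Real.pi))) *
        ENNReal.ofReal (((I.card : ℝ) - 1) * (I.card : ℝ) ^ (I.card - 2) *
          (treeRate β) ^ (I.card - 2) * (μ ^ I.card)⁻¹) := by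
        refine setLIntegral_mono' measurableSet_Ioc fun μ hμ => ?_
        have hμ0 : 0 < μ := hm.trans hμ.1
        gcongr
        -- The tree recursion distributes the target constant over the splittings of `I`, so the
        -- comparison can be made term by term.
        rw [← sum_powerset_tree hi, mul_assoc, Finset.sum_mul,
          ENNReal.ofReal_sum_of_nonneg fun Y _ => by positivity]
        refine Finset.sum_le_sum fun Y hY => ?_
        simp only [hP, Finset.mem_filter, Finset.mem_powerset] at hY
        have hYI : Y ⊂ I := hY.1.ssubset_of_ne hY.2.2
        have hZI : I \ Y ⊂ I := Finset.sdiff_ssubset hY.1 ⟨i, hY.2.1⟩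
        have hbY := hcluster Y hYI μ hμ0 hμ.2
        have hbZ := hcluster (I \ Y) hZI μ hμ0 hμ.2
        have h1 := marginal_crossEnergy_mul_le hμ0 s Finset.disjoint_sdiff hY.2.1
          (measurable_gasUrsell_right β M μ s Y).enorm
          (measurable_gasUrsell_right β M μ s (I \ Y)).enorm
          (dependsOnCluster_gasUrsell _ s Y) (fun t ht => (hbY t ht).1 i hY.2.1)
          (fun t ht => (hbZ t ht).2) x
        rw [Finset.union_sdiff_of_subset hY.1] at h1
        refine h1.trans ?_
        have hYc := treeConst_nonneg hβ0 hβ hμ0 Y.card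
        have hZc := treeConst_nonneg hβ0 hβ hμ0 (I \ Y).card
        calc _ = ∫⁻ t in Set.Ioi (0 : ℝ), ENNReal.ofReal (Y.card * treeConst β μ Y.card *
              ((I \ Y).card * treeConst β μ (I \ Y).card)) *
              (ENNReal.ofReal (t * Real.exp (-μ * t)) *
                (dipoleWeight s Y μ t * dipoleWeight s (I \ Y) μ t)) := by
              refine lintegral_congr fun t => ?_
              rw [ENNReal.ofReal_mul (p := Y.card * treeConst β μ Y.card) (by positivity)]
              ring
          _ ≤ ENNReal.ofReal (Y.card * treeConst β μ Y.card *
              ((I \ Y).card * treeConst β μ (I \ Y).card)) * ENNReal.ofReal (μ ^ 2)⁻¹ := by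
              rw [lintegral_const_mul']
              · gcongr
                exact lintegral_dipoleWeight_le hμ0 s Y (I \ Y)
              · exact ENNReal.ofReal_ne_top
          _ = _ := by
              rw [← ENNReal.ofReal_mul (by positivity)]
              congr 1
              have hc1 : 0 < Y.card := Finset.card_pos.2 ⟨i, hY.2.1⟩
              have hc2 : 0 < (I \ Y).card := Finset.card_pos.2
                (Finset.sdiff_nonempty.2 fun h => hY.2.2 (hY.1.antisymm h))
              have hc3 : I.card = Y.card + (I \ Y).card := by
                rw [Finset.card_sdiff_of_subset hY.1]
                have := Finset.card_le_card hY.1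
                omega
              obtain ⟨a, ha⟩ := Nat.exists_eq_succ_of_ne_zero hc1.ne'
              obtain ⟨b, hb⟩ := Nat.exists_eq_succ_of_ne_zero hc2.ne'
              have hc4 : I.card - 2 = a + b := by omega
              have hc5 : I.card = a + b + 2 := by omega
              rw [hc4, hc5]
              unfold treeConst
              have ha1 : Y.card - 1 = a := by omega
              have hb1 : (I \ Y).card - 1 = b := by omega
              rw [ha1, hb1, pow_add, pow_add, div_pow, div_pow, pow_add]
              simp only [div_eq_mul_inv, mul_inv]
              ring
    _ ≤ _ := lintegral_flow_le hβ0 hβ hm hn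

end ClusterBounds

/-! ### Van Hove limits of averages of translation invariant functions. -/

section ThermodynamicLimit

/-- The configuration with first particle at `a` and the others at relative positions `y`. -/
def relativeConfig {m : ℕ} (p : Plane × (Fin m → Plane)) : Fin (m + 1) → Plane :=
  Fin.cons p.1 fun j => p.2 j + p.1

theorem measurePreserving_relativeConfig (m : ℕ) :
    MeasurePreserving (relativeConfig (m := m)) (volume.prod volume) volume := by
  have h1 := (volume_preserving_piFinSuccAbove (fun _ : Fin (m + 1) => Plane) 0).symm
  have h2 : MeasurePreserving (fun p : Plane × (Fin m → Plane) =>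
      (id p.1, (fun (a : Plane) (y : Fin m → Plane) => y + fun _ => a) p.1 p.2))
      (volume.prod volume) (volume.prod volume) := by
    refine MeasurePreserving.skew_product (g := fun (a : Plane) (y : Fin m → Plane) =>
      y + fun _ => a) (MeasurePreserving.id _) ?_ ?_
    · simp only [Function.uncurry_def]
      fun_prop
    · exact Eventually.of_forall fun a => map_add_right_eq_self _ _
  have h3 := h1.comp h2
  have h4 : relativeConfig (m := m) = (MeasurableEquiv.piFinSuccAbove
      (fun _ : Fin (m + 1) => Plane) 0).symm ∘ fun p : Plane × (Fin m → Plane) =>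
      (id p.1, (fun (a : Plane) (y : Fin m → Plane) => y + fun _ => a) p.1 p.2) := by
    ext1 p
    simp only [Function.comp, relativeConfig, MeasurableEquiv.piFinSuccAbove_symm_apply, id,
      Fin.insertNthEquiv, Equiv.coe_fn_mk, Fin.insertNth_zero']
    rfl
  rw [h4]
  exact h3

/-- Translation invariance of a function of a configuration. -/
def TranslationInvariant {ι α : Type*} (F : (ι → Plane) → α) : Prop :=
  ∀ (a : Plane) (x : ι → Plane), F (fun i => x i + a) = F x

theorem TranslationInvariant.relativeConfig {α : Type*} {m : ℕ} {F : (Fin (m + 1) → Plane) → α}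
    (hF : TranslationInvariant F) (p : Plane × (Fin m → Plane)) :
    F (relativeConfig p) = F (relativeConfig (0, p.2)) := by
  rw [← hF p.1 (YukawaGas.relativeConfig (0, p.2))]
  congr 1
  ext1 i
  refine Fin.cases ?_ (fun j => ?_) i <;> simp [YukawaGas.relativeConfig]

theorem measurable_relativeConfig (m : ℕ) : Measurable (relativeConfig (m := m)) :=
  (measurePreserving_relativeConfig m).measurable

/-- By translation invariance the first particle may be averaged over a ball instead of sitting at
the origin, which makes the bound on `marginal` applicable; the volume of the ball cancels. -/
theorem lintegral_relativeConfig_le {m : ℕ} {F : (Fin (m + 1) → Plane) → ENNReal}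
    (hFm : Measurable F) (hF : TranslationInvariant F) {C : ENNReal}
    (hC : ∀ x, marginal (Finset.univ.erase 0) F x ≤ C) :
    ∫⁻ y : Fin m → Plane, F (relativeConfig (0, y)) ≤ C := by
  set Q : Set Plane := Metric.ball 0 1 with hQ
  have hQ0 : volume Q ≠ 0 := (Metric.measure_ball_pos volume 0 one_pos).ne'
  have hQt : volume Q ≠ ⊤ := measure_ball_lt_top.ne
  have hQm : MeasurableSet Q := measurableSet_ball
  set q : Plane → ENNReal := Q.indicator 1 with hq
  have hqm : Measurable q := measurable_one.indicator hQm
  have hqint : ∫⁻ a, q a = volume Q := lintegral_indicator_one hQm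
  have hq0 : Measurable fun x : Fin (m + 1) → Plane => q (x 0) := hqm.comp (measurable_pi_apply 0)
  have h1 : ∫⁻ x : Fin (m + 1) → Plane, q (x 0) * F x =
      volume Q * ∫⁻ y : Fin m → Plane, F (relativeConfig (0, y)) := by
    rw [← (measurePreserving_relativeConfig m).lintegral_comp
      (f := fun x : Fin (m + 1) → Plane => q (x 0) * F x) (hq0.mul hFm)]
    have h2 : ∀ p : Plane × (Fin m → Plane),
        q (relativeConfig p 0) * F (relativeConfig p) =
          q p.1 * F (relativeConfig (0, p.2)) := fun p => by
      rw [hF.relativeConfig p]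
      rfl
    simp_rw [h2]
    have hFr : Measurable fun y : Fin m → Plane => F (relativeConfig (0, y)) :=
      hFm.comp ((measurable_relativeConfig m).comp (by fun_prop))
    rw [lintegral_prod_mul hqm.aemeasurable hFr.aemeasurable, hqint]
  have h2 : ∫⁻ x : Fin (m + 1) → Plane, q (x 0) * F x ≤ volume Q * C := by
    have hset : (Finset.univ : Finset (Fin (m + 1))) = {0} ∪ Finset.univ.erase 0 := by
      rw [← Finset.insert_eq, Finset.insert_erase (Finset.mem_univ _)]
    have hdis : Disjoint {(0 : Fin (m + 1))} (Finset.univ.erase 0) := by simp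
    have h3 := marginal_union_mul_le hdis hdis hq0 hFm (fun x x' h => by
      simp only [h 0 (Finset.mem_singleton_self 0)]) hC (fun _ => 0)
    rw [← hset] at h3
    unfold marginal at h3
    rw [lmarginal_univ, lmarginal_singleton] at h3
    simpa [hqint, volume_pi] using h3
  rw [h1] at h2
  exact (ENNReal.mul_le_mul_iff_right hQ0 hQt).1 h2

/-- The positions in `X` of the first particle for which all particles are in `X`. -/
def admissible {m : ℕ} (X : Set Plane) (y : Fin m → Plane) : Set Plane :=
  {a | a ∈ X ∧ ∀ k, y k + a ∈ X}

theorem measurableSet_admissible {m : ℕ} {X : Set Plane} (hX : IsCompact X) :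
    MeasurableSet {p : Plane × (Fin m → Plane) | p.1 ∈ admissible X p.2} := by
  have hXm : MeasurableSet X := hX.isClosed.measurableSet
  have h : {p : Plane × (Fin m → Plane) | p.1 ∈ admissible X p.2} =
      Prod.fst ⁻¹' X ∩ ⋂ k, (fun p : Plane × (Fin m → Plane) => p.2 k + p.1) ⁻¹' X := by
    ext p
    simp [admissible]
  rw [h]
  exact (measurable_fst hXm).inter (MeasurableSet.iInter fun k =>
    (show Measurable fun p : Plane × (Fin m → Plane) => p.2 k + p.1 by fun_prop) hXm)

/-- At fixed relative positions the integrand is constant in the first particle, whose integration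
contributes only the volume of its allowed positions. -/
theorem setIntegral_eq_integral_admissible {m : ℕ} {F : (Fin (m + 1) → Plane) → ℝ}
    (hFm : Measurable F) (hF : TranslationInvariant F)
    (hint : Integrable fun y : Fin m → Plane => F (relativeConfig (0, y)))
    {X : Set Plane} (hX : IsCompact X) :
    ∫ x in {x : Fin (m + 1) → Plane | ∀ i, x i ∈ X}, F x =
      ∫ y : Fin m → Plane, volume.real (admissible X y) * F (relativeConfig (0, y)) := by
  have hXm : MeasurableSet X := hX.isClosed.measurableSet
  have hS : MeasurableSet {x : Fin (m + 1) → Plane | ∀ i, x i ∈ X} := by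
    simp only [Set.ofPred_forall]
    exact MeasurableSet.iInter fun i => (measurable_pi_apply i) hXm
  have hA := measurableSet_admissible (m := m) hX
  have hAy : ∀ y : Fin m → Plane, MeasurableSet (admissible X y) := fun y =>
    (show Measurable fun a : Plane => (a, y) by fun_prop) hA
  rw [← integral_indicator hS, ← (measurePreserving_relativeConfig m).map_eq,
    integral_map (measurable_relativeConfig m).aemeasurable
      (hFm.indicator hS).aestronglyMeasurable]
  have h1 : ∀ p : Plane × (Fin m → Plane),
      ({x : Fin (m + 1) → Plane | ∀ i, x i ∈ X}.indicator F) (relativeConfig p) =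
        {p : Plane × (Fin m → Plane) | p.1 ∈ admissible X p.2}.indicator
          (fun p => F (relativeConfig (0, p.2))) p := fun p => by
    have hiff : relativeConfig p ∈ {x : Fin (m + 1) → Plane | ∀ i, x i ∈ X} ↔
        p ∈ {p : Plane × (Fin m → Plane) | p.1 ∈ admissible X p.2} := by
      simp only [Set.mem_ofPred_eq, admissible, Fin.forall_fin_succ, relativeConfig, Fin.cons_zero,
        Fin.cons_succ]
    by_cases hp : p ∈ {p : Plane × (Fin m → Plane) | p.1 ∈ admissible X p.2}
    · rw [Set.indicator_of_mem hp, Set.indicator_of_mem (hiff.2 hp), hF.relativeConfig p]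
    · rw [Set.indicator_of_notMem hp, Set.indicator_of_notMem fun h => hp (hiff.1 h)]
  simp_rw [h1]
  rw [integral_prod_symm]
  · refine integral_congr_ae (Eventually.of_forall fun y => ?_)
    have h2 : (fun a => {p : Plane × (Fin m → Plane) | p.1 ∈ admissible X p.2}.indicator
        (fun p => F (relativeConfig (0, p.2))) (a, y)) =
        (admissible X y).indicator fun _ => F (relativeConfig (0, y)) := rfl
    simp only [h2]
    rw [integral_indicator (hAy y), setIntegral_const, smul_eq_mul]
  · have hdom : Integrable (fun p : Plane × (Fin m → Plane) => X.indicator (fun _ => (1 : ℝ)) p.1 *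
        ‖F (relativeConfig (0, p.2))‖) (volume.prod volume) :=
      Integrable.mul_prod ((integrable_indicator_iff hXm).2
        (integrableOn_const hX.measure_lt_top.ne)) hint.norm
    refine hdom.mono' (Measurable.aestronglyMeasurable (Measurable.indicator ?_ hA)) ?_
    · exact hFm.comp ((measurable_relativeConfig m).comp (by fun_prop))
    · refine Eventually.of_forall fun p => ?_
      by_cases hp : p ∈ {p : Plane × (Fin m → Plane) | p.1 ∈ admissible X p.2}
      · rw [Set.indicator_of_mem hp, Set.indicator_of_mem hp.1, one_mul]
      · rw [Set.indicator_of_notMem hp, norm_zero]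
        exact mul_nonneg (Set.indicator_nonneg (fun _ _ => zero_le_one) _) (norm_nonneg _)

/-- The segment from `a` to `y + a` is connected and leaves `X`, so it meets the frontier. The added
`1` makes the distance bound strict. -/
theorem mem_thickening_frontier {X : Set Plane} {a y : Plane} (ha : a ∈ X) (hy : y + a ∉ X) :
    a ∈ Metric.thickening (‖y‖ + 1) (frontier X) := by
  obtain ⟨p, hp, hpX⟩ : (segment ℝ a (y + a) ∩ frontier X).Nonempty := by
    by_contra h
    rw [Set.not_nonempty_iff_eq_empty, ← Set.disjoint_iff_inter_eq_empty] at h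
    have hpre : IsPreconnected (segment ℝ a (y + a)) := (convex_segment _ _).isPreconnected
    have := hpre.subset_or_subset isOpen_interior (isClosed_closure (s := X)).isOpen_compl
      (Set.disjoint_left.2 fun z hz hz' => hz' (subset_closure (interior_subset hz)))
      (fun z hz => by
        by_cases h1 : z ∈ interior X
        · exact Or.inl h1
        · exact Or.inr fun h2 => Set.disjoint_left.1 h hz ⟨h2, h1⟩)
    rcases this with h1 | h1
    · exact hy (interior_subset (h1 (right_mem_segment ℝ _ _)))
    · exact h1 (left_mem_segment ℝ _ _) (subset_closure ha)
  rw [Metric.mem_thickening_iff]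
  refine ⟨p, hpX, ?_⟩
  have hball : segment ℝ a (y + a) ⊆ Metric.closedBall a ‖y‖ :=
    (convex_closedBall a ‖y‖).segment_subset (Metric.mem_closedBall_self (norm_nonneg _))
      (by simp)
  have := hball hp
  rw [Metric.mem_closedBall, dist_comm] at this
  linarith

/-- Excluded positions lie in boundary layers of fixed width, a vanishing fraction of the volume. -/
theorem tendsto_admissible {m : ℕ} {X : ℕ → Set Plane} (hX : IsVanHove X) (y : Fin m → Plane) :
    Tendsto (fun j => volume.real (admissible (X j) y) / volume.real (X j)) atTop (𝓝 1) := by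
  have h0 : Tendsto (fun j => 1 - ∑ k, volume.real (Metric.thickening (‖y k‖ + 1)
      (frontier (X j))) / volume.real (X j)) atTop (𝓝 1) := by
    have h1 := (tendsto_finsetSum (Finset.univ : Finset (Fin m)) fun k _ =>
      hX.boundary (‖y k‖ + 1) (by positivity)).const_sub 1
    simpa using h1
  refine tendsto_of_tendsto_of_tendsto_of_le_of_le h0 tendsto_const_nhds (fun j => ?_) fun j => ?_
  · have hpos := hX.volume_pos j
    have hfin : volume (X j) ≠ ⊤ := (hX.isCompact j).measure_lt_top.ne
    have hsub : admissible (X j) y ⊆ X j := fun a ha => ha.1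
    have hb : ∀ k, Bornology.IsBounded (Metric.thickening (‖y k‖ + 1) (frontier (X j))) := fun k =>
      ((hX.isCompact j).isBounded.closure.subset frontier_subset_closure).thickening
    have hcover : X j ⊆ admissible (X j) y ∪ ⋃ k ∈ (Finset.univ : Finset (Fin m)),
        Metric.thickening (‖y k‖ + 1) (frontier (X j)) := fun a ha => by
      by_cases h : ∀ k, y k + a ∈ X j
      · exact Or.inl ⟨ha, h⟩
      · push Not at h
        obtain ⟨k, hk⟩ := h
        exact Or.inr (Set.mem_biUnion (Finset.mem_coe.2 (Finset.mem_univ k))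
          (mem_thickening_frontier ha hk))
    have hle : volume.real (X j) ≤ volume.real (admissible (X j) y) +
        ∑ k, volume.real (Metric.thickening (‖y k‖ + 1) (frontier (X j))) := by
      refine (measureReal_mono hcover ?_).trans ((measureReal_union_le _ _).trans ?_)
      · refine (measure_union_lt_top ((measure_mono hsub).trans_lt hfin.lt_top) ?_).ne
        refine (measure_biUnion_finset_le _ _).trans_lt (ENNReal.sum_lt_top.2 fun k _ => ?_)
        exact (hb k).measure_lt_top
      · gcongr
        exact measureReal_biUnion_finset_le _ _
    rw [← Finset.sum_div, sub_le_iff_le_add, ← add_div, le_div_iff₀ hpos, one_mul]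
    exact hle
  · refine div_le_one_of_le₀ (measureReal_mono (fun a ha => ha.1)
      (hX.isCompact j).measure_lt_top.ne) measureReal_nonneg

/-- Dominated convergence: the fraction of admissible positions is at most `1` and tends to `1`. -/
theorem tendsto_average_integral {m : ℕ} {F : (Fin (m + 1) → Plane) → ℝ}
    (hFm : Measurable F) (hF : TranslationInvariant F)
    (hint : Integrable fun y : Fin m → Plane => F (relativeConfig (0, y)))
    {X : ℕ → Set Plane} (hX : IsVanHove X) :
    Tendsto (fun j => (volume.real (X j))⁻¹ * ∫ x in {x : Fin (m + 1) → Plane | ∀ i, x i ∈ X j}, F x)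
      atTop (𝓝 (∫ y : Fin m → Plane, F (relativeConfig (0, y)))) := by
  have h1 : ∀ j, (volume.real (X j))⁻¹ * ∫ x in {x : Fin (m + 1) → Plane | ∀ i, x i ∈ X j}, F x =
      ∫ y : Fin m → Plane, volume.real (admissible (X j) y) / volume.real (X j) *
        F (relativeConfig (0, y)) := fun j => by
    rw [setIntegral_eq_integral_admissible hFm hF hint (hX.isCompact j), ← integral_const_mul]
    refine integral_congr_ae (Eventually.of_forall fun y => ?_)
    ring
  simp_rw [h1]
  have hFr : Measurable fun y : Fin m → Plane => F (relativeConfig (0, y)) :=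
    hFm.comp ((measurable_relativeConfig m).comp (by fun_prop))
  refine tendsto_integral_of_dominated_convergence (fun y => ‖F (relativeConfig (0, y))‖)
    (fun j => ?_) hint.norm (fun j => Eventually.of_forall fun y => ?_)
    (Eventually.of_forall fun y => ?_)
  · refine (Measurable.mul (Measurable.div_const ?_ _) hFr).aestronglyMeasurable
    have hA : MeasurableSet {p : (Fin m → Plane) × Plane | p.2 ∈ admissible (X j) p.1} :=
      measurable_swap (measurableSet_admissible (m := m) (hX.isCompact j))
    exact (measurable_measure_prodMk_left hA).ennreal_toReal
  · rw [norm_mul]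
    refine mul_le_of_le_one_left (norm_nonneg _) ?_
    rw [Real.norm_of_nonneg (by positivity)]
    exact div_le_one_of_le₀ (measureReal_mono (fun a ha => ha.1)
      (hX.isCompact j).measure_lt_top.ne) measureReal_nonneg
  · simpa using (tendsto_admissible hX y).mul_const (F (relativeConfig (0, y)))

end ThermodynamicLimit

/-! ### The logarithmic derivative of a formal power series. -/

section LogDerivative

/-- Uniqueness of the logarithmic derivative of a power series with constant coefficient `1`. -/
theorem derivative_logOf_eq {A D : ℝ⟦X⟧} (hA : PowerSeries.constantCoeff A = 1)
    (hD : D * A = PowerSeries.derivative ℝ A) :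
    PowerSeries.derivative ℝ (PowerSeries.logOf A) = D := by
  have hs : HasSubst (A - 1) := HasSubst.of_constantCoeff_zero' (by simp [hA])
  set G : ℝ⟦X⟧ := PowerSeries.derivative ℝ (PowerSeries.log ℝ) with hG
  have h1 : G * (1 + X) = 1 := by
    rw [hG, deriv_log]
    ext n
    rcases n with _ | n
    · simp [mul_add]
    · simp [mul_add, coeff_succ_mul_X, pow_succ, coeff_one]
  have h2 : G.subst (A - 1) * A = 1 := by
    have h3 := congrArg (PowerSeries.subst (A - 1)) h1
    have h4 : PowerSeries.subst (A - 1) (1 : ℝ⟦X⟧) = 1 := by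
      rw [← coe_substAlgHom hs, map_one]
    rw [subst_mul hs, subst_add hs, subst_X hs, h4, add_sub_cancel] at h3
    exact h3
  have h5 : PowerSeries.derivative ℝ (A - 1) = PowerSeries.derivative ℝ A := by simp
  rw [logOf_eq, derivative_subst hs, h5, ← hD, mul_left_comm, ← hG, h2, mul_one]

end LogDerivative

/-! ### Moments and cumulants of Boltzmann factors of independent particles. -/

section Cumulants

/-- The Boltzmann factor of the particles in `J` for the pair interaction `w`. -/
def boltzmann {P ι : Type*} (w : P → P → ℝ) (ξ : ι → P) (J : Finset ι) : ℝ :=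
  Real.exp (-pairEnergy (fun i j => w (ξ i) (ξ j)) J)

theorem boltzmann_empty {P ι : Type*} (w : P → P → ℝ) (ξ : ι → P) : boltzmann w ξ ∅ = 1 := by
  simp [boltzmann, pairEnergy, crossEnergy]

theorem boltzmann_map {P ι κ : Type*} (w : P → P → ℝ) (e : κ ↪ ι) (ξ : ι → P) (K : Finset κ) :
    boltzmann w ξ (K.map e) = boltzmann w (ξ ∘ e) K := by
  simp [boltzmann, pairEnergy, crossEnergy, Finset.sum_map]

theorem boltzmann_congr {P ι : Type*} {w : P → P → ℝ} {ξ ξ' : ι → P} {J : Finset ι} (h : ∀ i ∈ J, ξ i = ξ' i) :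
    boltzmann w ξ J = boltzmann w ξ' J := by
  unfold boltzmann pairEnergy crossEnergy
  congr 4
  · exact Finset.sum_congr rfl fun i hi => Finset.sum_congr rfl fun j hj => by simp only [h i hi, h j hj]
  · exact Finset.sum_congr rfl fun i hi => by simp only [h i hi]

theorem exists_boltzmann_eq {P ι : Type*} (w : P → P → ℝ) (J : Finset ι) :
    ∃ e : Fin J.card ↪ ι, Finset.univ.map e = J ∧
      ∀ ξ : ι → P, boltzmann w ξ J = boltzmann w (ξ ∘ e) Finset.univ := by
  let e : Fin J.card ↪ ι := J.equivFin.symm.toEmbedding.trans (Function.Embedding.subtype _)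
  have he : Finset.univ.map e = J := by
    rw [← Finset.map_map, Finset.map_univ_equiv, Finset.univ_eq_attach, Finset.attach_map_val]
  refine ⟨e, he, fun ξ => ?_⟩
  rw [← boltzmann_map, he]

variable {P : Type*} [MeasurableSpace P]

/-- The law of the particles picked by `e` among independent particles. -/
theorem measurePreserving_comp_embedding {ι κ : Type*} [Fintype ι] [Fintype κ] (π : Measure P)
    [IsProbabilityMeasure π] (e : κ ↪ ι) :
    MeasurePreserving (fun ξ : ι → P => ξ ∘ e) (Measure.pi fun _ => π)
      (Measure.pi fun _ => π) := by
  have h : ProbabilityTheory.iIndepFun (fun (i : ι) (ξ : ι → P) => ξ i)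
      (Measure.pi fun _ => π) :=
    ProbabilityTheory.iIndepFun_pi (X := fun _ => id) fun _ => aemeasurable_id
  have h2 := (h.precomp e.injective).map_fun_eq_pi_map
    fun i => (measurable_pi_apply (e i)).aemeasurable
  refine ⟨measurable_pi_lambda _ fun i => measurable_pi_apply (e i), ?_⟩
  have h3 : ∀ i : κ, (Measure.pi fun _ : ι => π).map ((fun (i : ι) (ξ : ι → P) => ξ i) (e i)) = π :=
    fun i => (measurePreserving_eval (fun _ : ι => π) (e i)).map_eq
  simp only [h3] at h2
  exact h2

variable {w : P → P → ℝ}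

theorem measurable_boltzmann (hw : Measurable fun p : P × P => w p.1 p.2) {ι : Type*}
    (J : Finset ι) : Measurable fun ξ : ι → P => boltzmann w ξ J := by
  have h : ∀ i j : ι, Measurable fun ξ : ι → P => w (ξ i) (ξ j) := fun i j =>
    hw.comp (f := fun ξ : ι → P => (ξ i, ξ j))
      ((measurable_pi_apply i).prodMk (measurable_pi_apply j))
  unfold boltzmann pairEnergy crossEnergy
  exact Real.measurable_exp.comp (((Finset.measurable_sum _ fun i _ => Finset.measurable_sum _
    fun j _ => h i j).sub (Finset.measurable_sum _ fun i _ => h i i)).div_const 2).neg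

/-- Stability: the Boltzmann factor of `n` particles is bounded. -/
def IsStable (w : P → P → ℝ) : Prop :=
  ∀ n, ∃ C, ∀ ξ : Fin n → P, boltzmann w ξ Finset.univ ≤ C

theorem IsStable.abs_le (hs : IsStable w) {ι : Type*} (J : Finset ι) :
    ∃ C, ∀ ξ : ι → P, |boltzmann w ξ J| ≤ C := by
  obtain ⟨e, -, h⟩ := exists_boltzmann_eq w J
  obtain ⟨C, hC⟩ := hs J.card
  refine ⟨C, fun ξ => ?_⟩
  rw [h, boltzmann, abs_of_nonneg (Real.exp_pos _).le]
  exact hC _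

/-- Boundedness passes down the recursion. On a probability space this gives integrability with no
decay estimate. -/
theorem exists_abs_ursell_le {α ι : Type*} [DecidableEq ι] {E : α → Finset ι → ℝ}
    (hE0 : ∀ a, E a ∅ = 1) (hE : ∀ J, ∃ C, ∀ a, |E a J| ≤ C) (I : Finset ι) :
    ∃ C, ∀ a, |ursell (E a) I| ≤ C := by
  induction I using Finset.strongInduction with
  | H I ih =>
  rcases I.eq_empty_or_nonempty with rfl | ⟨i, hi⟩
  · exact ⟨0, fun a => by simp [ursell_empty]⟩
  choose C hC using hE
  have ih' : ∀ J : Finset ι, ∃ D, J ∈ I.powerset.filter (fun J => i ∈ J ∧ J ≠ I) →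
      ∀ a, |ursell (E a) J| ≤ D := fun J => by
    by_cases hJ : J ∈ I.powerset.filter fun J => i ∈ J ∧ J ≠ I
    · have h := hJ
      simp only [Finset.mem_filter, Finset.mem_powerset] at h
      obtain ⟨D, hD⟩ := ih J (h.1.ssubset_of_ne h.2.2)
      exact ⟨D, fun _ => hD⟩
    · exact ⟨0, fun h => absurd h hJ⟩
  choose D hD using ih'
  refine ⟨C I + ∑ J ∈ I.powerset with i ∈ J ∧ J ≠ I, D J * C (I \ J), fun a => ?_⟩
  rw [ursell_eq_sub (hE0 a) hi]
  refine (abs_sub _ _).trans (add_le_add (hC I a) ((Finset.abs_sum_le_sum_abs _ _).trans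
    (Finset.sum_le_sum fun J hJ => ?_)))
  rw [abs_mul]
  exact mul_le_mul (hD J hJ a) (hC _ a) (abs_nonneg _) ((abs_nonneg _).trans (hD J hJ a))

section Factorization

variable {ι : Type*} [DecidableEq ι]

theorem measurable_ursell_boltzmann (hw : Measurable fun p : P × P => w p.1 p.2) (J : Finset ι) :
    Measurable fun ξ : ι → P => ursell (boltzmann w ξ) J :=
  measurable_ursell (measurable_boltzmann hw) J

theorem exists_abs_ursell_boltzmann_le (hs : IsStable w) (J : Finset ι) :
    ∃ C, ∀ ξ : ι → P, |ursell (boltzmann w ξ) J| ≤ C :=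
  exists_abs_ursell_le (boltzmann_empty w) (fun J => hs.abs_le J) J

theorem integrable_ursell_mul_boltzmann [Fintype ι] (π : Measure P) [IsProbabilityMeasure π]
    (hw : Measurable fun p : P × P => w p.1 p.2) (hs : IsStable w) (J K : Finset ι) :
    Integrable (fun ξ : ι → P => ursell (boltzmann w ξ) J * boltzmann w ξ K)
      (Measure.pi fun _ => π) := by
  obtain ⟨C, hC⟩ := hs.abs_le K
  obtain ⟨D, hD⟩ := exists_abs_ursell_boltzmann_le (w := w) hs J
  refine Integrable.of_bound ((measurable_ursell_boltzmann hw J).mul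
    (measurable_boltzmann hw K)).aestronglyMeasurable (D * C) (Eventually.of_forall fun ξ => ?_)
  rw [norm_mul]
  exact mul_le_mul (hD ξ) (hC ξ) (norm_nonneg _) ((abs_nonneg _).trans (hD ξ))

/-- Functions of disjoint sets of independent particles have independent values. -/
theorem integral_mul_of_disjoint [Fintype ι] [Nonempty P] (π : Measure P) [IsProbabilityMeasure π]
    {J K : Finset ι} (hJK : Disjoint J K) {f g : (ι → P) → ℝ} (hf : Measurable f)
    (hg : Measurable g) (hfJ : ∀ ξ ξ', (∀ i ∈ J, ξ i = ξ' i) → f ξ = f ξ')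
    (hgK : ∀ ξ ξ', (∀ i ∈ K, ξ i = ξ' i) → g ξ = g ξ') :
    ∫ ξ, f ξ * g ξ ∂(Measure.pi fun _ => π) =
      (∫ ξ, f ξ ∂(Measure.pi fun _ => π)) * ∫ ξ, g ξ ∂(Measure.pi fun _ => π) := by
  have h : ProbabilityTheory.iIndepFun (fun (i : ι) (ξ : ι → P) => ξ i)
      (Measure.pi fun _ => π) :=
    ProbabilityTheory.iIndepFun_pi (X := fun _ => id) fun _ => aemeasurable_id
  have h2 := h.indepFun_finset J K hJK fun i => measurable_pi_apply i
  let o : ι → P := fun _ => Classical.arbitrary P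
  have hf' : ∀ ξ : ι → P, f ξ = f (Function.updateFinset o J fun i => ξ i) := fun ξ =>
    hfJ _ _ fun i hi => by simp [Function.updateFinset, hi]
  have hg' : ∀ ξ : ι → P, g ξ = g (Function.updateFinset o K fun i => ξ i) := fun ξ =>
    hgK _ _ fun i hi => by simp [Function.updateFinset, hi]
  have h3 := h2.comp (hf.comp (measurable_updateFinset (x := o)))
    (hg.comp (measurable_updateFinset (x := o)))
  have h4 := h3.integral_fun_mul_eq_mul_integral
    (((hf.comp measurable_updateFinset).comp (by fun_prop)).aestronglyMeasurable)
    (((hg.comp measurable_updateFinset).comp (by fun_prop)).aestronglyMeasurable)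
  simp only [Function.comp_apply, ← hf', ← hg'] at h4
  exact h4

end Factorization

/-- The expectation of the Boltzmann factor of `n` independent particles. -/
def boltzmannMoment (π : Measure P) (w : P → P → ℝ) (n : ℕ) : ℝ :=
  ∫ ξ : Fin n → P, boltzmann w ξ Finset.univ ∂(Measure.pi fun _ => π)

/-- The expectation of the Ursell function of `n` independent particles. -/
def boltzmannCumulant (π : Measure P) (w : P → P → ℝ) (n : ℕ) : ℝ :=
  ∫ ξ : Fin n → P, ursell (boltzmann w ξ) Finset.univ ∂(Measure.pi fun _ => π)

theorem integral_boltzmann (π : Measure P) [IsProbabilityMeasure π]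
    (hw : Measurable fun p : P × P => w p.1 p.2) {ι : Type*} [Fintype ι] (J : Finset ι) :
    ∫ ξ : ι → P, boltzmann w ξ J ∂(Measure.pi fun _ => π) = boltzmannMoment π w J.card := by
  obtain ⟨e, -, h⟩ := exists_boltzmann_eq w J
  have hm := measurePreserving_comp_embedding π e
  rw [boltzmannMoment, ← hm.map_eq, integral_map hm.measurable.aemeasurable
    (measurable_boltzmann hw _).aestronglyMeasurable]
  simp only [h]

theorem sum_integral_ursell_mul [Nonempty P] (π : Measure P) [IsProbabilityMeasure π]
    (hw : Measurable fun p : P × P => w p.1 p.2) (hs : IsStable w) {ι : Type*} [Fintype ι]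
    [DecidableEq ι] (I : Finset ι) {i : ι} (hi : i ∈ I) :
    ∑ J ∈ I.powerset with i ∈ J, (∫ ξ : ι → P, ursell (boltzmann w ξ) J ∂(Measure.pi fun _ => π)) *
      boltzmannMoment π w (I \ J).card = boltzmannMoment π w I.card := by
  rw [← integral_boltzmann π hw I]
  have h : ∀ ξ : ι → P, boltzmann w ξ I =
      ∑ J ∈ I.powerset with i ∈ J, ursell (boltzmann w ξ) J * boltzmann w ξ (I \ J) := fun ξ =>
    (sum_ursell_mul (boltzmann_empty w ξ) I hi).symm
  simp_rw [h]
  rw [integral_finsetSum _ fun J _ => integrable_ursell_mul_boltzmann π hw hs J (I \ J)]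
  refine Finset.sum_congr rfl fun J _ => ?_
  rw [integral_mul_of_disjoint π Finset.disjoint_sdiff (measurable_ursell_boltzmann hw J)
    (measurable_boltzmann hw _) (fun ξ ξ' h => ursell_congr fun K hK =>
      boltzmann_congr fun i hi => h i (hK hi)) fun ξ ξ' h => boltzmann_congr h,
    integral_boltzmann π hw]

theorem boltzmannMoment_zero (π : Measure P) [IsProbabilityMeasure π] (w : P → P → ℝ) :
    boltzmannMoment π w 0 = 1 := by
  simp [boltzmannMoment, boltzmann_empty]

/-- Integrated over independent particles, the recursion involves only cardinalities, so by strong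
induction the integral depends on `J` only through its size and not on the ambient number of
particles. -/
theorem integral_ursell_boltzmann [Nonempty P] (π : Measure P) [IsProbabilityMeasure π]
    (hw : Measurable fun p : P × P => w p.1 p.2) (hs : IsStable w) (n : ℕ) :
    ∀ (k : ℕ) (J : Finset (Fin k)), J.card = n →
      ∫ ξ : Fin k → P, ursell (boltzmann w ξ) J ∂(Measure.pi fun _ => π) =
        boltzmannCumulant π w n := by
  induction n using Nat.strong_induction_on with
  | _ n ih =>
  intro k J hJ
  rcases Nat.eq_zero_or_pos n with rfl | hn
  · rw [Finset.card_eq_zero] at hJ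
    simp [hJ, boltzmannCumulant, ursell_empty]
  have key : ∀ (k : ℕ) (J : Finset (Fin k)) (i : Fin k), i ∈ J → J.card = n →
      ∫ ξ : Fin k → P, ursell (boltzmann w ξ) J ∂(Measure.pi fun _ => π) =
        boltzmannMoment π w n + boltzmannCumulant π w n -
          ∑ j ∈ Finset.range n, ((n - 1).choose j : ℝ) *
            (boltzmannCumulant π w (j + 1) * boltzmannMoment π w (n - (j + 1))) := by
    intro k J i hi hJ
    have h1 := sum_integral_ursell_mul π hw hs J hi
    have h2 := sum_powerset_mem_card hi (N := n - 1) (by omega)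
      fun m => boltzmannCumulant π w m * boltzmannMoment π w (n - m)
    rw [sum_powerset_mem_eq_add hi, Finset.sdiff_self, Finset.card_empty,
      boltzmannMoment_zero, mul_one] at h1
    rw [sum_powerset_mem_eq_add hi, hJ, Nat.sub_self, boltzmannMoment_zero, mul_one,
      Nat.sub_add_cancel hn] at h2
    rw [← h2, ← hJ, ← h1, hJ]
    have h3 : ∑ Y ∈ J.powerset with i ∈ Y ∧ Y ≠ J,
        (∫ ξ : Fin k → P, ursell (boltzmann w ξ) Y ∂(Measure.pi fun _ => π)) *
          boltzmannMoment π w (J \ Y).card =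
        ∑ Y ∈ J.powerset with i ∈ Y ∧ Y ≠ J,
          boltzmannCumulant π w Y.card * boltzmannMoment π w (n - Y.card) := by
      refine Finset.sum_congr rfl fun Y hY => ?_
      simp only [Finset.mem_filter, Finset.mem_powerset] at hY
      rw [ih Y.card (hJ ▸ Finset.card_lt_card (hY.1.ssubset_of_ne hY.2.2)) k Y rfl,
        Finset.card_sdiff_of_subset hY.1, hJ]
    rw [h3]
    ring
  obtain ⟨i, hi⟩ := Finset.card_pos.1 (hJ ▸ hn)
  have hF := key n Finset.univ ⟨0, hn⟩ (Finset.mem_univ _) (by simp)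
  rw [key k J i hi hJ, ← hF]
  rfl

/-- The moment-cumulant recursion. -/
theorem sum_choose_cumulant_mul_moment [Nonempty P] (π : Measure P) [IsProbabilityMeasure π]
    (hw : Measurable fun p : P × P => w p.1 p.2) (hs : IsStable w) (n : ℕ) :
    ∑ j ∈ Finset.range (n + 1), (n.choose j : ℝ) *
        (boltzmannCumulant π w (j + 1) * boltzmannMoment π w (n - j)) =
      boltzmannMoment π w (n + 1) := by
  have h1 := sum_integral_ursell_mul π hw hs (Finset.univ : Finset (Fin (n + 1)))
    (Finset.mem_univ 0)
  have h2 := sum_powerset_mem_card (Finset.mem_univ (0 : Fin (n + 1))) (N := n) (by simp)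
    fun m => boltzmannCumulant π w m * boltzmannMoment π w (n + 1 - m)
  simp only [Nat.add_sub_add_right] at h2
  rw [← h2]
  rw [Finset.card_univ, Fintype.card_fin] at h1
  rw [← h1]
  refine Finset.sum_congr rfl fun Y hY => ?_
  simp only [Finset.mem_filter, Finset.mem_powerset] at hY
  rw [integral_ursell_boltzmann π hw hs _ _ Y rfl, Finset.card_sdiff_of_subset hY.1,
    Finset.card_univ, Fintype.card_fin]

/-- The logarithmic derivative of the exponential generating function of the moments. -/
theorem derivative_logOf_moment [Nonempty P] (π : Measure P) [IsProbabilityMeasure π]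
    (hw : Measurable fun p : P × P => w p.1 p.2) (hs : IsStable w) (V : ℝ) :
    PowerSeries.derivative ℝ (PowerSeries.logOf (PowerSeries.mk fun n =>
        (1 / (n.factorial : ℝ)) * (V ^ n * boltzmannMoment π w n))) =
      PowerSeries.mk fun n =>
        (1 / (n.factorial : ℝ)) * (V ^ (n + 1) * boltzmannCumulant π w (n + 1)) := by
  refine derivative_logOf_eq (by simp [boltzmannMoment_zero]) ?_
  ext n
  rw [coeff_mul, coeff_derivative, coeff_mk, ← sum_choose_cumulant_mul_moment π hw hs n,
    Finset.Nat.sum_antidiagonal_eq_sum_range_succ_mk, Finset.mul_sum, Finset.mul_sum,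
    Finset.sum_mul]
  refine Finset.sum_congr rfl fun j hj => ?_
  have hjn : j ≤ n := Nat.lt_succ_iff.1 (Finset.mem_range.1 hj)
  rw [coeff_mk, coeff_mk, Nat.cast_choose ℝ hjn, Nat.factorial_succ, Nat.cast_mul]
  have hV : V ^ (n + 1) = V ^ (j + 1) * V ^ (n - j) := by
    rw [← pow_add]
    congr 1
    omega
  rw [hV]
  have h1 : (n.factorial : ℝ) ≠ 0 := by positivity
  have h2 : (j.factorial : ℝ) ≠ 0 := by positivity
  have h3 : ((n - j).factorial : ℝ) ≠ 0 := by positivity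
  have h4 : ((n + 1 : ℕ) : ℝ) ≠ 0 := by positivity
  push_cast at h4 ⊢
  field_simp

end Cumulants

/-! ### Mayer coefficients in finite volume. -/

section MayerCoefficients

instance : MeasurableSingletonClass ℤˣ where
  measurableSet_singleton u := by
    refine ⟨{(u : ℤ)}, measurableSet_singleton _, ?_⟩
    ext a
    simp [Units.ext_iff]

/-- The uniform distribution of a charged particle in `X`. -/
def gasMeasure (X : Set Plane) : Measure (Plane × ℤˣ) :=
  ENNReal.ofReal (2 * volume.real X)⁻¹ • (volume.restrict X).prod Measure.count

theorem pi_const_smul {P ι : Type*} [MeasurableSpace P] [Fintype ι] (μ : Measure P)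
    [IsFiniteMeasure μ] (c : ℝ) :
    Measure.pi (fun _ : ι => ENNReal.ofReal c • μ) =
      ENNReal.ofReal c ^ Fintype.card ι • Measure.pi fun _ => μ := by
  have : IsFiniteMeasure (ENNReal.ofReal c • μ) := Measure.smul_finite μ ENNReal.ofReal_ne_top
  refine Measure.pi_eq fun s _ => ?_
  simp [Measure.pi_pi, Finset.prod_mul_distrib]

variable {X : Set Plane}

theorem isProbabilityMeasure_gasMeasure (hX : IsCompact X) (hV : 0 < volume.real X) :
    IsProbabilityMeasure (gasMeasure X) := by
  constructor
  have h : (volume X) = ENNReal.ofReal (volume.real X) :=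
    (ENNReal.ofReal_toReal hX.measure_lt_top.ne).symm
  rw [gasMeasure, Measure.smul_apply, ← Set.univ_prod_univ, Measure.prod_prod,
    Measure.restrict_apply_univ, h, Measure.count_apply_finite _ Set.finite_univ, smul_eq_mul]
  simp only [Set.Finite.toFinset_univ, Finset.card_univ, Fintype.card_units_int]
  rw [show ((2 : ℕ) : ENNReal) = ENNReal.ofReal 2 by simp, ← ENNReal.ofReal_mul (by positivity),
    ← ENNReal.ofReal_mul (by positivity), ← ENNReal.ofReal_one]
  congr 1
  field_simp

/-- The normalisation of the particle law is `(2|X|)⁻¹`; the powers of `|X|` cancel and the powers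
of `2` remain as the uniform weight of the charges. -/
theorem integral_pi_gasMeasure (hX : IsCompact X) (hV : 0 < volume.real X) {n : ℕ}
    {F : (Fin n → Plane × ℤˣ) → ℝ} (hF : Measurable F) (hb : ∃ C, ∀ ξ, |F ξ| ≤ C) :
    volume.real X ^ n * ∫ ξ, F ξ ∂(Measure.pi fun _ => gasMeasure X) =
      1 / 2 ^ n * ∑ σ : Fin n → ℤˣ, ∫ x in {x : Fin n → Plane | ∀ i, x i ∈ X},
        F fun i => (x i, σ i) := by
  have : IsFiniteMeasure (volume.restrict X) := ⟨by simpa using hX.measure_lt_top⟩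
  obtain ⟨C, hC⟩ := hb
  have hset : {x : Fin n → Plane | ∀ i, x i ∈ X} = Set.univ.pi fun _ => X := by
    ext x
    simp
  unfold gasMeasure
  rw [pi_const_smul, integral_smul_measure, Fintype.card_fin, smul_eq_mul, ENNReal.toReal_pow,
    ENNReal.toReal_ofReal (by positivity), ← mul_assoc, ← mul_pow]
  have h1 : volume.real X * (2 * volume.real X)⁻¹ = 1 / 2 := by field_simp
  rw [h1, one_div_pow]
  congr 1
  rw [← ((measurePreserving_arrowProdEquivProdArrow Plane ℤˣ (Fin n) (fun _ => volume.restrict X)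
    fun _ => Measure.count).symm _).integral_comp', hset, volume_pi, Measure.restrict_pi_pi]
  have hFe : Measurable fun p : (Fin n → Plane) × (Fin n → ℤˣ) => F fun i => (p.1 i, p.2 i) :=
    hF.comp (by fun_prop)
  have hint : Integrable (fun p : (Fin n → Plane) × (Fin n → ℤˣ) => F fun i => (p.1 i, p.2 i))
      ((Measure.pi fun _ => volume.restrict X).prod (Measure.pi fun _ => Measure.count)) :=
    Integrable.of_bound hFe.aestronglyMeasurable C (Eventually.of_forall fun p => hC _)
  have h2 := integral_prod_symm _ hint
  refine h2.trans ?_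
  rw [integral_fintype (Integrable.of_finite)]
  refine Finset.sum_congr rfl fun σ _ => ?_
  have h3 : (Measure.pi fun _ : Fin n => (Measure.count : Measure ℤˣ)).real {σ} = 1 := by
    simp [Measure.real, Measure.pi_singleton]
  rw [h3, one_smul]

/-- The interaction of two charged particles. -/
def chargedInteraction (v : Plane → ℝ) (p q : Plane × ℤˣ) : ℝ :=
  ((p.2 : ℤ) : ℝ) * ((q.2 : ℤ) : ℝ) * v (p.1 - q.1)

variable {v : Plane → ℝ}

theorem measurable_chargedInteraction (hv : Measurable v) :
    Measurable fun p : (Plane × ℤˣ) × (Plane × ℤˣ) => chargedInteraction v p.1 p.2 := by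
  have h : Measurable fun u : ℤˣ => ((u : ℤ) : ℝ) := measurable_of_countable _
  unfold chargedInteraction
  fun_prop

theorem energy_eq_pairEnergy (hv : ∀ x, v (-x) = v x) {n : ℕ} (σ : Fin n → ℤˣ)
    (x : Fin n → Plane) :
    energy v σ x = pairEnergy (pairPotential v (fun i => ((σ i : ℤ) : ℝ)) x) Finset.univ := by
  set u := pairPotential v (fun i => ((σ i : ℤ) : ℝ)) x with hu
  have hsymm : ∀ i j, u i j = u j i := fun i j => pairPotential_comm hv _ _ i j
  have h1 : ∀ i : Fin n, (Finset.univ : Finset (Fin n)) =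
      insert i (Finset.Ioi i ∪ Finset.Iio i) := fun i => by
    ext j
    simp only [Finset.mem_univ, Finset.mem_insert, Finset.mem_union, Finset.mem_Ioi,
      Finset.mem_Iio, true_iff]
    exact (lt_trichotomy i j).elim (fun h => Or.inr (Or.inl h))
      fun h => h.elim (fun h => Or.inl h.symm) fun h => Or.inr (Or.inr h)
  have h2 : ∀ i : Fin n, ∑ j, u i j = u i i + (∑ j ∈ Finset.Ioi i, u i j +
      ∑ j ∈ Finset.Iio i, u i j) := fun i => by
    conv_lhs => rw [h1 i]
    rw [Finset.sum_insert (by simp), Finset.sum_union]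
    exact Finset.disjoint_left.2 fun j hj hj' =>
      lt_asymm (Finset.mem_Ioi.1 hj) (Finset.mem_Iio.1 hj')
  have h3 : ∑ i, ∑ j ∈ Finset.Iio i, u i j = ∑ i, ∑ j ∈ Finset.Ioi i, u i j := by
    rw [Finset.sum_comm' (s' := fun j => Finset.Ioi j) (t' := Finset.univ) (by simp)]
    exact Finset.sum_congr rfl fun i _ => Finset.sum_congr rfl fun j _ => hsymm j i
  have h4 : energy v σ x = ∑ i, ∑ j ∈ Finset.Ioi i, u i j := rfl
  rw [h4, pairEnergy, crossEnergy]
  simp only [h2, Finset.sum_add_distrib, h3]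
  ring

theorem boltzmann_chargedInteraction {n : ℕ} (σ : Fin n → ℤˣ) (x : Fin n → Plane) :
    boltzmann (chargedInteraction v) (fun i => (x i, σ i)) =
      fun J => Real.exp (-pairEnergy (pairPotential v (fun i => ((σ i : ℤ) : ℝ)) x) J) := rfl

theorem partitionSeries_eq (hX : IsCompact X) (hV : 0 < volume.real X)
    (hvm : Measurable v) (hv : ∀ x, v (-x) = v x) (hs : IsStable (chargedInteraction v)) :
    partitionSeries v X = PowerSeries.mk fun n => (1 / (n.factorial : ℝ)) *
      (volume.real X ^ n * boltzmannMoment (gasMeasure X) (chargedInteraction v) n) := by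
  unfold partitionSeries
  congr 1
  ext n
  congr 1
  have hw := measurable_chargedInteraction hvm
  have hm := measurable_boltzmann hw (Finset.univ : Finset (Fin n))
  obtain ⟨C, hC⟩ := hs.abs_le (Finset.univ : Finset (Fin n))
  rw [boltzmannMoment, integral_pi_gasMeasure hX hV hm ⟨C, hC⟩, integral_const_mul,
    integral_finsetSum]
  · simp only [boltzmann_chargedInteraction, energy_eq_pairEnergy hv]
  · intro σ _
    have hfin : volume {x : Fin n → Plane | ∀ i, x i ∈ X} ≠ ⊤ := by
      have hset : {x : Fin n → Plane | ∀ i, x i ∈ X} = Set.univ.pi fun _ => X := by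
        ext x
        simp
      rw [hset]
      exact (isCompact_univ_pi fun _ => hX).measure_lt_top.ne
    have : IsFiniteMeasure (volume.restrict {x : Fin n → Plane | ∀ i, x i ∈ X}) :=
      ⟨by simpa using hfin.lt_top⟩
    have hm' : Measurable fun x : Fin n → Plane => Real.exp (-energy v σ x) := by
      simp only [energy_eq_pairEnergy hv]
      exact hm.comp (g := fun ξ => boltzmann (chargedInteraction v) ξ Finset.univ)
        (f := fun (x : Fin n → Plane) i => (x i, σ i)) (by fun_prop)
    refine Integrable.of_bound hm'.aestronglyMeasurable C (Eventually.of_forall fun x => ?_)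
    rw [energy_eq_pairEnergy hv]
    exact hC fun i => (x i, σ i)

/-- The Mayer coefficients in finite volume as averages of integrals of Ursell functions. -/
theorem coeff_densitySeries (hX : IsCompact X) (hV : 0 < volume.real X)
    (hvm : Measurable v) (hv : ∀ x, v (-x) = v x) (hs : IsStable (chargedInteraction v)) (m : ℕ) :
    PowerSeries.coeff m (densitySeries v X) =
      (1 / (m.factorial : ℝ)) * (1 / 2 ^ (m + 1)) * ∑ σ : Fin (m + 1) → ℤˣ,
        ((volume.real X)⁻¹ * ∫ x in {x : Fin (m + 1) → Plane | ∀ i, x i ∈ X},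
          gasUrsell v (fun i => ((σ i : ℤ) : ℝ)) x Finset.univ) := by
  have := isProbabilityMeasure_gasMeasure hX hV
  have hw := measurable_chargedInteraction hvm
  rw [densitySeries, pressureSeries, partitionSeries_eq hX hV hvm hv hs, Derivation.map_smul,
    derivative_logOf_moment _ hw hs, coeff_smul, coeff_mk, boltzmannCumulant,
    integral_pi_gasMeasure hX hV (measurable_ursell_boltzmann hw _)
      (exists_abs_ursell_boltzmann_le hs _), ← Finset.mul_sum]
  simp only [boltzmann_chargedInteraction, gasUrsell, smul_eq_mul]
  ring

/-- Stability between the masses `m` and `M`, using that the energy vanishes at mass `M`. -/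
theorem isStable_flowPotential {β M m : ℝ} (hβ : 0 ≤ β) (hm : 0 < m) (hmM : m ≤ M) :
    IsStable (chargedInteraction (flowPotential β M m)) := by
  intro n
  refine ⟨(M / m) ^ (n * β / (8 * Real.pi)), fun ξ => ?_⟩
  have h := exp_pairEnergy_sub_le hβ (hm.trans_le hmM) hm hmM
    (s := fun i : Fin n => (((ξ i).2 : ℤ) : ℝ)) (fun i => by
      rcases Int.units_eq_one_or (ξ i).2 with h | h <;> simp [h]) (fun i => (ξ i).1) Finset.univ
  have h0 : pairEnergy (pairPotential (flowPotential β M M)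
      (fun i : Fin n => (((ξ i).2 : ℤ) : ℝ)) fun i => (ξ i).1) Finset.univ = 0 := by
    simp [pairEnergy, crossEnergy, pairPotential, flowPotential_self]
  rw [h0, zero_sub, Finset.card_univ, Fintype.card_fin] at h
  exact h

end MayerCoefficients

/-! ### Integrability of the Ursell functions at a fixed cutoff. -/

section Integrability

/-- The bound depends on `M` through `B` and the length of the mass interval. Finiteness at a fixed
cutoff is all that the existence of the limit of `b₂` requires. -/
theorem lintegral_enorm_exp_flowPotential_lt_top {β M m : ℝ} (hβ : 0 ≤ β) (hm : 0 < m)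
    (hmM : m ≤ M) : ∫⁻ r : Plane, ‖Real.exp (flowPotential β M m r) - 1‖ₑ < ⊤ := by
  have hq : 0 ≤ β / (4 * Real.pi) := by positivity
  set B := β * (M / m) ^ (β / (4 * Real.pi)) with hB
  calc ∫⁻ r : Plane, ‖Real.exp (flowPotential β M m r) - 1‖ₑ
      ≤ ∫⁻ r : Plane, ∫⁻ μ in Set.Ioc m M, ENNReal.ofReal (β * (μ / m) ^ (β / (4 * Real.pi))) *
          ENNReal.ofReal (greenSq μ r) :=
        lintegral_mono fun r => enorm_exp_flowPotential_sub_one_le hβ hm hmM r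
    _ ≤ ∫⁻ r : Plane, ∫⁻ μ in Set.Ioc m M, ENNReal.ofReal B * ENNReal.ofReal (greenSq μ r) := by
        refine lintegral_mono fun r => setLIntegral_mono' measurableSet_Ioc fun μ hμ => ?_
        gcongr ENNReal.ofReal ?_ * _
        have := hm.trans hμ.1
        have h2 := hμ.2
        rw [hB]
        gcongr
    _ = ∫⁻ μ in Set.Ioc m M, ∫⁻ r : Plane, ENNReal.ofReal B * ENNReal.ofReal (greenSq μ r) := by
        refine lintegral_lintegral_swap ?_
        refine (Measurable.const_mul ?_ _).aemeasurable
        exact (measurable_greenSq.comp measurable_swap).ennreal_ofReal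
    _ ≤ ∫⁻ _ in Set.Ioc m M, ENNReal.ofReal B * ENNReal.ofReal (m ^ 2)⁻¹ := by
        refine setLIntegral_mono' measurableSet_Ioc fun μ hμ => ?_
        have hμ0 := hm.trans hμ.1
        rw [lintegral_const_mul _ (measurable_greenSq_right μ).ennreal_ofReal,
          lintegral_greenSq hμ0]
        gcongr
        exact hμ.1.le
    _ < ⊤ := by
        rw [setLIntegral_const, Real.volume_Ioc]
        exact ENNReal.mul_lt_top (ENNReal.mul_lt_top ENNReal.ofReal_lt_top ENNReal.ofReal_lt_top)
          ENNReal.ofReal_lt_top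

theorem lintegral_enorm_exp_neg_flowPotential_lt_top {β M m : ℝ} (hβ : 0 ≤ β) (hm : 0 < m)
    (hmM : m ≤ M) : ∫⁻ r : Plane, ‖Real.exp (-flowPotential β M m r) - 1‖ₑ < ⊤ := by
  refine (lintegral_mono fun r => ?_).trans_lt
    ((lintegral_flowPotential_le hβ hm hmM).trans_lt ENNReal.ofReal_lt_top)
  have h0 := flowPotential_nonneg hβ hmM r
  rw [Real.enorm_eq_ofReal_abs]
  refine ENNReal.ofReal_le_ofReal ?_
  rw [abs_sub_comm, abs_of_nonneg (by simpa using h0)]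
  linarith [Real.add_one_le_exp (-flowPotential β M m r)]

theorem marginal_gasUrsell_pair_lt_top {ι : Type*} [DecidableEq ι] {β M m : ℝ} (hβ : 0 ≤ β)
    (hm : 0 < m) (hmM : m ≤ M) {s : ι → ℝ} (hs : ∀ i, s i ^ 2 = 1) {j k : ι} (hjk : j ≠ k) :
    ∃ C < (⊤ : ENNReal), ∀ x, marginal {k}
      (fun x => ‖gasUrsell (flowPotential β M m) s x {j, k}‖ₑ) x ≤ C := by
  have key : ∀ Ψ : Plane → ENNReal, Measurable Ψ → ∀ x : ι → Plane,
      marginal {k} (fun x => Ψ (x j - x k)) x = ∫⁻ r, Ψ r := fun Ψ hΨ x => by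
    unfold marginal
    rw [lmarginal_singleton]
    simp only [Function.update_self, Function.update_of_ne hjk]
    exact lintegral_sub_left_eq_self Ψ (x j)
  have hV := measurable_flowPotential_right β M m
  have hsjk : s j * s k = 1 ∨ s j * s k = -1 :=
    sq_eq_one_iff.1 (by rw [mul_pow, hs, hs, one_mul])
  simp_rw [gasUrsell_pair (flowPotential_neg β M m) s _ hjk]
  rcases hsjk with h | h
  · refine ⟨_, lintegral_enorm_exp_neg_flowPotential_lt_top hβ hm hmM, fun x => ?_⟩
    simp only [h, one_mul]
    exact (key (fun r => ‖Real.exp (-flowPotential β M m r) - 1‖ₑ)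
      ((Real.measurable_exp.comp hV.neg).sub_const 1).enorm x).le
  · refine ⟨_, lintegral_enorm_exp_flowPotential_lt_top hβ hm hmM, fun x => ?_⟩
    simp only [h, neg_one_mul, neg_neg]
    exact (key (fun r => ‖Real.exp (flowPotential β M m r) - 1‖ₑ)
      ((Real.measurable_exp.comp hV).sub_const 1).enorm x).le

variable {β M m : ℝ}

theorem translationInvariant_gasUrsell {ι : Type*} [DecidableEq ι] (v : Plane → ℝ) (s : ι → ℝ)
    (I : Finset ι) : TranslationInvariant fun x => gasUrsell v s x I := by
  intro a x
  have h : pairPotential v s (fun i => x i + a) = pairPotential v s x := by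
    ext i j
    simp [pairPotential]
  simp only [gasUrsell, h]

theorem lintegral_gasUrsell_relativeConfig_lt_top (hβ0 : 0 < β) (hβ : β < 16 * Real.pi / 3)
    (hm : 0 < m) (hmM : m ≤ M) {n : ℕ} {s : Fin (n + 1) → ℝ} (hs : ∀ i, s i ^ 2 = 1) :
    ∫⁻ y : Fin n → Plane,
      ‖gasUrsell (flowPotential β M m) s (relativeConfig (0, y)) Finset.univ‖ₑ < ⊤ := by
  have hmeas := (measurable_gasUrsell_right β M m s (Finset.univ : Finset (Fin (n + 1)))).enorm
  have hinv : TranslationInvariant fun x =>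
      ‖gasUrsell (flowPotential β M m) s x (Finset.univ : Finset (Fin (n + 1)))‖ₑ := fun a x =>
    congrArg enorm (translationInvariant_gasUrsell _ s Finset.univ a x)
  by_cases hn : n = 1
  -- Here `n` counts relative positions, so `n = 1` is the cluster of two particles.
  · subst hn
    obtain ⟨C, hC, h⟩ := marginal_gasUrsell_pair_lt_top hβ0.le hm hmM hs
      (show (0 : Fin 2) ≠ 1 by decide)
    exact (lintegral_relativeConfig_le hmeas hinv h).trans_lt hC
  · exact (lintegral_relativeConfig_le hmeas hinv fun x => marginal_gasUrsell_le hβ0 hβ hs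
      Finset.univ (by simpa using hn) hm hmM (Finset.mem_univ 0) x).trans_lt ENNReal.ofReal_lt_top

theorem integrable_gasUrsell_relativeConfig (hβ0 : 0 < β) (hβ : β < 16 * Real.pi / 3)
    (hm : 0 < m) (hmM : m ≤ M) {n : ℕ} {s : Fin (n + 1) → ℝ} (hs : ∀ i, s i ^ 2 = 1) :
    Integrable fun y : Fin n → Plane =>
      gasUrsell (flowPotential β M m) s (relativeConfig (0, y)) Finset.univ :=
  ⟨((measurable_gasUrsell_right β M m s Finset.univ).comp
    ((measurable_relativeConfig n).comp (by fun_prop))).aestronglyMeasurable,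
    lintegral_gasUrsell_relativeConfig_lt_top hβ0 hβ hm hmM hs⟩

theorem abs_integral_gasUrsell_le (hβ0 : 0 < β) (hβ : β < 16 * Real.pi / 3)
    (hm : 0 < m) (hmM : m ≤ M) {n : ℕ} (hn : n ≠ 1) {s : Fin (n + 1) → ℝ}
    (hs : ∀ i, s i ^ 2 = 1) :
    |∫ y : Fin n → Plane, gasUrsell (flowPotential β M m) s (relativeConfig (0, y)) Finset.univ| ≤
      treeConst β m (n + 1) := by
  have hmeas := (measurable_gasUrsell_right β M m s (Finset.univ : Finset (Fin (n + 1)))).enorm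
  have hinv : TranslationInvariant fun x =>
      ‖gasUrsell (flowPotential β M m) s x (Finset.univ : Finset (Fin (n + 1)))‖ₑ := fun a x =>
    congrArg enorm (translationInvariant_gasUrsell _ s Finset.univ a x)
  have h := lintegral_relativeConfig_le hmeas hinv fun x => marginal_gasUrsell_le hβ0 hβ hs
      Finset.univ (by simpa using hn) hm hmM (Finset.mem_univ 0) x
  have h2 := (enorm_integral_le_lintegral_enorm _).trans h
  rw [Real.enorm_eq_ofReal_abs, Finset.card_univ, Fintype.card_fin] at h2
  exact (ENNReal.ofReal_le_ofReal_iff (treeConst_nonneg hβ0 hβ hm _)).1 h2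

end Integrability

/-! ### The infinite-volume density series and its radius. -/

section Density

/-- The coefficient of `z ^ m` of the density in infinite volume, `m + 1` times the Mayer
coefficient `b_{m+1}`, for the potential between the masses `1` and `M`. -/
def densityCoeff (β M : ℝ) (m : ℕ) : ℝ :=
  (1 / (m.factorial : ℝ)) * (1 / 2 ^ (m + 1)) * ∑ σ : Fin (m + 1) → ℤˣ,
    ∫ y : Fin m → Plane, gasUrsell (flowPotential β M 1) (fun i => ((σ i : ℤ) : ℝ))
      (relativeConfig (0, y)) Finset.univ

theorem units_int_sq_eq_one {ι : Type*} (σ : ι → ℤˣ) (i : ι) : ((σ i : ℤ) : ℝ) ^ 2 = 1 := by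
  rcases Int.units_eq_one_or (σ i) with h | h <;> simp [h]

variable {β M : ℝ}

theorem tendsto_coeff_densitySeries (hβ0 : 0 < β) (hβ : β < 16 * Real.pi / 3) (hM : 1 ≤ M)
    {X : ℕ → Set Plane} (hX : IsVanHove X) (m : ℕ) :
    Tendsto (fun j => PowerSeries.coeff m (densitySeries (flowPotential β M 1) (X j))) atTop
      (𝓝 (densityCoeff β M m)) := by
  have h : ∀ j, PowerSeries.coeff m (densitySeries (flowPotential β M 1) (X j)) = _ := fun j =>
    coeff_densitySeries (hX.isCompact j) (hX.volume_pos j) (measurable_flowPotential_right β M 1)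
      (flowPotential_neg β M 1) (isStable_flowPotential hβ0.le one_pos hM) m
  simp_rw [h]
  exact (tendsto_finsetSum _ fun σ _ => tendsto_average_integral
    (measurable_gasUrsell_right β M 1 _ Finset.univ) (translationInvariant_gasUrsell _ _ _)
    (integrable_gasUrsell_relativeConfig hβ0 hβ one_pos hM (units_int_sq_eq_one σ)) hX).const_mul _

theorem abs_densityCoeff_le (hβ0 : 0 < β) (hβ : β < 16 * Real.pi / 3) (hM : 1 ≤ M) {m : ℕ}
    (hm : m ≠ 1) : |densityCoeff β M m| ≤ Real.exp 1 * (Real.exp 1 * treeRate β) ^ m := by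
  have hrate := treeRate_pos hβ0 hβ
  have h1 : |densityCoeff β M m| ≤ (1 / (m.factorial : ℝ)) * treeConst β 1 (m + 1) := by
    rw [densityCoeff, abs_mul, abs_of_nonneg (by positivity), mul_assoc]
    gcongr
    calc 1 / 2 ^ (m + 1) * |∑ σ : Fin (m + 1) → ℤˣ, ∫ y : Fin m → Plane,
          gasUrsell (flowPotential β M 1) (fun i => ((σ i : ℤ) : ℝ)) (relativeConfig (0, y))
            Finset.univ|
        ≤ 1 / 2 ^ (m + 1) * ∑ σ : Fin (m + 1) → ℤˣ, treeConst β 1 (m + 1) := by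
          gcongr
          refine (Finset.abs_sum_le_sum_abs _ _).trans (Finset.sum_le_sum fun σ _ => ?_)
          exact abs_integral_gasUrsell_le hβ0 hβ one_pos hM hm (units_int_sq_eq_one σ)
      _ = treeConst β 1 (m + 1) := by
          simp
  refine h1.trans ?_
  -- A single term of the exponential series bounds the number of trees over the factorial; this is
  -- the origin of the `e` in the radius.
  have h2 : ((m + 1 : ℕ) : ℝ) ^ (m + 1) / ((m + 1).factorial : ℝ) ≤ Real.exp ((m + 1 : ℕ) : ℝ) :=
    Real.pow_div_factorial_le_exp _ (by positivity) _
  have h3 : ((m + 1 : ℕ) : ℝ) ^ (m + 1 - 2) ≤ ((m + 1 : ℕ) : ℝ) ^ m :=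
    pow_le_pow_right₀ (by simp) (by omega)
  have h4 : ((m + 1 : ℕ) : ℝ) ^ (m + 1) / ((m + 1).factorial : ℝ) =
      1 / (m.factorial : ℝ) * ((m + 1 : ℕ) : ℝ) ^ m := by
    rw [Nat.factorial_succ, Nat.cast_mul, pow_succ]
    have : ((m + 1 : ℕ) : ℝ) ≠ 0 := by positivity
    field_simp
  have h5 : Real.exp ((m + 1 : ℕ) : ℝ) = Real.exp 1 * Real.exp 1 ^ m := by
    rw [← pow_succ', ← Real.exp_nat_mul, mul_one]
  rw [h4, h5] at h2
  rw [treeConst, div_one, Nat.add_sub_cancel, mul_pow, ← mul_assoc, ← mul_assoc]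
  refine mul_le_mul_of_nonneg_right (le_trans ?_ h2) (by positivity)
  gcongr

theorem norm_termWithoutLinear_le (hβ0 : 0 < β) (hβ : β < 16 * Real.pi / 3) (hM : 1 ≤ M) (z : ℂ)
    (m : ℕ) : ‖termWithoutLinear (densityCoeff β M) z m‖ ≤
      Real.exp 1 * (Real.exp 1 * treeRate β * ‖z‖) ^ m := by
  have hrate := treeRate_pos hβ0 hβ
  unfold termWithoutLinear
  split_ifs with hm
  · rw [norm_zero]
    positivity
  · rw [norm_mul, norm_pow, Complex.norm_real, Real.norm_eq_abs, mul_pow, ← mul_assoc]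
    gcongr
    exact abs_densityCoeff_le hβ0 hβ hM hm

/-- The radius in the theorem is exactly `1 / (e * treeRate β)`. -/
theorem treeRate_mul_lt_one (hβ0 : 0 < β) (hβ : β < 16 * Real.pi / 3) {r : ℝ}
    (hr : r < (16 * Real.pi - 3 * β) / (16 * Real.pi * β * Real.exp 1)) :
    Real.exp 1 * treeRate β * r < 1 := by
  have hrate := treeRate_pos hβ0 hβ
  have h1 : (16 * Real.pi - 3 * β) / (16 * Real.pi * β * Real.exp 1) =
      1 / (Real.exp 1 * treeRate β) := by
    have h2 := one_sub_pos hβ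
    have h3 : 16 * Real.pi - 3 * β ≠ 0 := by linarith
    unfold treeRate
    have := Real.pi_pos
    have := Real.exp_pos 1
    field_simp
  rw [h1, lt_div_iff₀ (by positivity)] at hr
  linarith

theorem summable_geometric_bound (hβ0 : 0 < β) (hβ : β < 16 * Real.pi / 3) {r : ℝ} (hr0 : 0 ≤ r)
    (hr : r < (16 * Real.pi - 3 * β) / (16 * Real.pi * β * Real.exp 1)) :
    Summable fun m : ℕ => Real.exp 1 * (Real.exp 1 * treeRate β * r) ^ m := by
  have hrate := treeRate_pos hβ0 hβ
  exact (summable_geometric_of_lt_one (by positivity)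
    (treeRate_mul_lt_one hβ0 hβ hr)).mul_left _

end Density

end YukawaGas

end

/-! ### Convergence of the Mayer series, uniformly in the cutoff. -/

theorem mainTheorem4 (β : ℝ) (hβ_pos : 0 < β) (hβ : β < 16 * Real.pi / 3)
    (κ : ℝ → ℝ) (hκ : YukawaGas.IsScaleFunction κ) :
    ∃ c : ℝ → ℕ → ℝ,
      (∀ t₀ : ℝ, t₀ < 0 → ∀ X : ℕ → Set YukawaGas.Plane, YukawaGas.IsVanHove X → ∀ m : ℕ,
        Tendsto
          (fun j => PowerSeries.coeff m
            (YukawaGas.densitySeries (YukawaGas.cutoffPotential β κ t₀) (X j)))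
          atTop (𝓝 (c t₀ m))) ∧
      (∀ t₀ : ℝ, t₀ < 0 → ∀ z : ℂ,
        ‖z‖ < (16 * Real.pi - 3 * β) / (16 * Real.pi * β * Real.exp 1) →
          Summable (YukawaGas.termWithoutLinear (c t₀) z)) ∧
      (∀ r : ℝ, r < (16 * Real.pi - 3 * β) / (16 * Real.pi * β * Real.exp 1) →
        TendstoUniformlyOn
          (fun (N : ℕ) (p : ℝ × ℂ) =>
            ∑ m ∈ Finset.range N, YukawaGas.termWithoutLinear (c p.1) p.2 m)
          (fun p : ℝ × ℂ => ∑' m : ℕ, YukawaGas.termWithoutLinear (c p.1) p.2 m)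
          atTop (Set.Iio (0 : ℝ) ×ˢ Metric.closedBall (0 : ℂ) r)) := by
  have hM : ∀ t₀ : ℝ, t₀ < 0 → 1 ≤ κ t₀ := fun t₀ ht => by
    rw [← hκ.map_zero]
    exact hκ.antitoneOn (Set.mem_Iic.2 ht.le) (Set.mem_Iic.2 le_rfl) ht.le
  refine ⟨fun t₀ => YukawaGas.densityCoeff β (κ t₀), fun t₀ ht X hX m => ?_, fun t₀ ht z hz => ?_,
    fun r hr => ?_⟩
  · simp_rw [YukawaGas.densitySeries_cutoffPotential β hκ ht.le]
    exact YukawaGas.tendsto_coeff_densitySeries hβ_pos hβ (hM t₀ ht) hX m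
  · exact Summable.of_norm_bounded
      (YukawaGas.summable_geometric_bound hβ_pos hβ (norm_nonneg z) hz)
      (YukawaGas.norm_termWithoutLinear_le hβ_pos hβ (hM t₀ ht) z)
  · rcases lt_or_ge r 0 with hr0 | hr0
    · rw [Metric.closedBall_eq_empty.2 hr0, Set.prod_empty]
      exact tendstoUniformlyOn_empty
    -- Weierstrass test: the geometric majorant depends on neither the cutoff nor the phase of the
    -- activity.
    refine tendstoUniformlyOn_tsum_nat (YukawaGas.summable_geometric_bound hβ_pos hβ hr0 hr)
      fun m p hp => ?_
    refine (YukawaGas.norm_termWithoutLinear_le hβ_pos hβ (hM p.1 hp.1) p.2 m).trans ?_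
    have hrate := YukawaGas.treeRate_pos hβ_pos hβ
    have hz : ‖p.2‖ ≤ r := mem_closedBall_zero_iff.1 hp.2
    gcongr
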